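/- Let $[\omega]^\omega$ be the space of infinite subsets of $\omega=\mathbb N$ with the Ellentuck topology, i.e. the topology generated by the sets $$[a,A]=\{H\in[\omega]^\omega : H\setminus A=a,\ H\setminus a\subseteq A\},$$ where $a\subseteq\omega$ is finite and $A\subseteq\omega\setminus a$ is infinite. Call a subset of $[\omega]^\omega$ \emph{Ramsey positive} if it is not meager in this topology. Fix an enumeration $s_0,s_1,\dots$ (without repetition) of all finite binary strings, and identify a set $H\in[\omega]^\omega$ with the infinite oracle $\{s_i : i\in H\}$. For an oracle (a set of binary strings) $A$, let $\mathbf{PSPACE}^A$ be the class of languages decided in polynomial space by deterministic Turing machines with oracle $A$, where the query tape counts towards the space. Let $\mathbf{PH}^A$ be the class of languages $L$ such that, for some $l\ge 0$, some polynomial $p$ and some relation $R$ decidable in polynomial time with oracle $A$, for all strings $y$, $$y\in L\iff \exists x_1\,\forall x_2\cdots Q x_l\; R(x_1,\dots,x_l,y),$$ the quantifiers alternating and ranging over binary strings of length at most $p(|y|)$. Let $\mathbf{PSPACE}$ and $\mathbf{PH}$ be the corresponding classes without oracle. Let $$\mathbf S=\{A : \mathbf{PH}^A\neq\mathbf{PSPACE}^A\}$$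 be the set of infinite oracles separating the two classes, viewed as a subset of $[\omega]^\omega$. If $\mathbf S$ is Ramsey positive, then $\mathbf{PSPACE}\nsubseteq\mathbf{PH}$ (in particular $\mathbf{PSPACE}\neq\mathbf{PH}$). -/

import Mathlib

open StateTransition

/-! ### Turing machines

Machines are the multi-stack Turing machines `Turing.TM2` of Mathlib (a tape is a pair of
stacks), with finitely many stacks, stack symbols, labels and internal states. -/

/-- A finite deterministic Turing machine that takes `n` binary strings as input, each on an input
stack of its own, and that accepts or rejects when it halts. -/
structure Machine (n : ℕ) where
  K : Type
  Γ : Type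
  Λ : Type
  σ : Type
  [fintypeK : Fintype K]
  [decEqK : DecidableEq K]
  [finiteΓ : Finite Γ]
  [finiteΛ : Finite Λ]
  [finiteσ : Finite σ]
  /-- the symbols that stand for the two bits -/
  bit : Bool ↪ Γ
  /-- the input stacks -/
  inp : Fin n ↪ K
  start : Λ
  init : σ
  /-- the program -/
  prog : Λ → Turing.TM2.Stmt (fun _ : K => Γ) Λ σ
  /-- tells the accepting from the rejecting halting configurations -/
  accept : σ → Bool

attribute [instance] Machine.fintypeK Machine.decEqK Machine.finiteΓ Machine.finiteΛ
  Machine.finiteσ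

namespace Machine

variable {n : ℕ} (M : Machine n)

/-- Configurations: a label (`none` when the machine has halted), an internal state, the stacks. -/
abbrev Cfg : Type := Turing.TM2.Cfg (fun _ : M.K => M.Γ) M.Λ M.σ

/-- One step of the machine without oracle. -/
def step : M.Cfg → Option M.Cfg := Turing.TM2.step M.prog

/-- The initial configuration on input `x`: the `i`-th input stack holds `x i` (first bit on top),
and all other stacks are empty. -/
noncomputable def initCfg (x : Fin n → List Bool) : M.Cfg where
  l := some M.start
  var := M.init
  stk := Function.extend M.inp (fun i => (x i).map M.bit) (fun _ => [])

/-- The space that a configuration occupies: the number of symbols on all stacks together. -/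
def space (c : M.Cfg) : ℕ := ∑ k, (c.stk k).length

/-- When run with the step function `f`, the machine decides the relation `R`, and on inputs of
total length `m` it halts within `p m` steps. -/
def DecidesInTime (f : M.Cfg → Option M.Cfg) (R : (Fin n → List Bool) → Prop) (p : ℕ → ℕ) : Prop :=
  ∀ x : Fin n → List Bool, ∃ c : M.Cfg, c.l = none ∧
    Nonempty (EvalsToInTime f (M.initCfg x) (some c) (p (∑ i, (x i).length))) ∧
    (M.accept c.var = true ↔ R x)

/-- When run with the step function `f`, the machine halts on every input and decides the relation
`R`, and on inputs of total length `m` no configuration of the run occupies more than `p m`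
space. -/
def DecidesInSpace (f : M.Cfg → Option M.Cfg) (R : (Fin n → List Bool) → Prop) (p : ℕ → ℕ) : Prop :=
  ∀ x : Fin n → List Bool,
    (∃ c : M.Cfg, c.l = none ∧ Reaches f (M.initCfg x) c ∧ (M.accept c.var = true ↔ R x)) ∧
    ∀ c : M.Cfg, Reaches f (M.initCfg x) c → M.space c ≤ p (∑ i, (x i).length)

end Machine

/-- An oracle machine: a machine with a query stack and three special labels. -/
structure OracleMachine (n : ℕ) extends Machine n where
  qStack : K
  query : Λ
  yes : Λ
  no : Λ

open Classical in
/-- One step of the machine with oracle `A`. At the label `query` the machine moves in one step to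
`yes` or to `no`, according to whether the string on the query stack (first bit on top) is in `A`;
at all other labels it runs its program. The query stack counts as space like every other. -/
noncomputable def OracleMachine.stepWith {n : ℕ} (M : OracleMachine n) (A : Set (List Bool))
    (c : M.Cfg) : Option M.Cfg :=
  if c.l = some M.query then
    some { c with
      l := some (if ∃ w ∈ A, c.stk M.qStack = w.map M.bit then M.yes else M.no) }
  else M.step c

/-! ### Complexity classes -/

/-- The relation `R` on strings is decidable in polynomial time. -/
def PolyTimeRel (n : ℕ) (R : (Fin n → List Bool) → Prop) : Prop :=
  ∃ (M : Machine n) (p : Polynomial ℕ), M.DecidesInTime M.step R (fun m => p.eval m)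

/-- The relation `R` on strings is decidable in polynomial time with oracle `A`. -/
def PolyTimeRelWith (A : Set (List Bool)) (n : ℕ) (R : (Fin n → List Bool) → Prop) : Prop :=
  ∃ (M : OracleMachine n) (p : Polynomial ℕ),
    M.DecidesInTime (M.stepWith A) R (fun m => p.eval m)

/-- `l` alternating quantifiers, the first one existential iff `b` is true, over strings of length
at most `m`: `∃ x₁, ∀ x₂, …, R (x₁, …, x_l)` or `∀ x₁, ∃ x₂, …, R (x₁, …, x_l)`. -/
def AltQuant (m : ℕ) : (l : ℕ) → (b : Bool) → ((Fin l → List Bool) → Prop) → Prop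
  | 0, _, R => R Fin.elim0
  | l + 1, true, R =>
      ∃ x : List Bool, x.length ≤ m ∧ AltQuant m l false (fun v => R (Fin.cons x v))
  | l + 1, false, R =>
      ∀ x : List Bool, x.length ≤ m → AltQuant m l true (fun v => R (Fin.cons x v))

/-- The polynomial hierarchy over a class `C` of relations: the languages `L` such that
`y ∈ L ↔ ∃ x₁, ∀ x₂, …, R (y, x₁, …, x_l)` for some `l` and some `R` in `C`, where the quantifiers
range over the strings of length at most `p |y|` for a polynomial `p`. -/
def PHOver (C : (n : ℕ) → ((Fin n → List Bool) → Prop) → Prop) : Set (Set (List Bool)) :=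
  {L | ∃ (l : ℕ) (R : (Fin (l + 1) → List Bool) → Prop) (p : Polynomial ℕ), C (l + 1) R ∧
    ∀ y : List Bool, y ∈ L ↔ AltQuant (p.eval y.length) l true (fun v => R (Fin.cons y v))}

/-- The polynomial hierarchy. -/
def PH : Set (Set (List Bool)) := PHOver PolyTimeRel

/-- The polynomial hierarchy relative to the oracle `A`. -/
def PHWith (A : Set (List Bool)) : Set (Set (List Bool)) := PHOver (PolyTimeRelWith A)

/-- The languages that are decidable in polynomial space. -/
def PSPACE : Set (Set (List Bool)) :=
  {L | ∃ (M : Machine 1) (p : Polynomial ℕ),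
    M.DecidesInSpace M.step (fun x => x 0 ∈ L) (fun m => p.eval m)}

/-- The languages that are decidable in polynomial space with oracle `A`. -/
def PSPACEWith (A : Set (List Bool)) : Set (Set (List Bool)) :=
  {L | ∃ (M : OracleMachine 1) (p : Polynomial ℕ),
    M.DecidesInSpace (M.stepWith A) (fun x => x 0 ∈ L) (fun m => p.eval m)}

/-! ### The Ellentuck topology -/

/-- The space of infinite sets of natural numbers. -/
def InfiniteSets : Type := {H : Set ℕ // H.Infinite}

/-- The basic set `[a, A]`: the infinite sets `H` with `a ⊆ H ⊆ a ∪ A`, for `A` disjoint from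
`a`. -/
def ellentuckBasic (a : Finset ℕ) (A : Set ℕ) : Set InfiniteSets :=
  {H | H.1 \ A = a ∧ H.1 \ a ⊆ A}

/-- The Ellentuck topology. -/
instance ellentuckTopology : TopologicalSpace InfiniteSets :=
  TopologicalSpace.generateFrom
    {U | ∃ (a : Finset ℕ) (A : Set ℕ), A.Infinite ∧ Disjoint (a : Set ℕ) A ∧ U = ellentuckBasic a A}

/-- A set is Ramsey positive if it is not meager in the Ellentuck topology. -/
def RamseyPositive (S : Set InfiniteSets) : Prop := ¬ IsMeagre S

/-- The infinite oracles that separate `PSPACE` from `PH`, as sets of natural numbers with respect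
to the enumeration `s` of the binary strings. -/
def separatingOracles (s : ℕ ≃ List Bool) : Set InfiniteSets :=
  {H | PHWith (s '' H.1) ≠ PSPACEWith (s '' H.1)}

/-! ### Runs of a transition function -/

/-! Suppose that PSPACE is contained in PH. The separating oracles are then shown to form a nowhere
dense set. Call an oracle sparse if, for some `N`, it has at most `N + m` strings of length at most
`m`, for all `m`. Two facts are combined: the sets that code non-sparse oracles are nowhere dense,
and no sparse oracle separates.

The first fact is `isNowhereDense_not_sparse`. Inside a basic set `[a, A]`, thin `A` to an infinite
`B` with at most one string of each length; every element of `[a, B]` is then sparse.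

For the second fact, the inclusion of PH in PSPACE holds relative to every oracle
(`PHWith_subset_PSPACEWith`): a quantifier over strings of polynomial length is decided by trying
all strings in turn and reusing the space.

The converse for a sparse oracle `A` is `Sparse.PSPACEWith_subset_PHWith`. A machine for `L` in
polynomial space asks only about strings of polynomial length, and the members of `A` among these
fit into a list of polynomial length. By `exists_reduction_of_mem_PSPACEWith`, an oracle-free
language `L'` in PSPACE decides `L` when it is given the input `y`, a block `b` whose length bounds
space and time, and the list in place of the oracle. A clock of `b.length` bits suffices, because a
halting run in space `s` takes fewer than `2 ^ (D * (s + 1))` steps (`Machine.exists_time_le`). By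
assumption `L'` is in PH. Now `y ∈ L` holds iff there is a certificate `c`, made of `b` and a list,
such that for all `w` of length at most `y.length + b.length` the list is right about `w`, and `y`
with `c` is in `L'`. Correctness at one `w` costs one query, so this is a prefix `∃ c ∀ w` in front
of the prefix of `L'`, over a relation in polynomial time with oracle `A` (`PolyTimeRel.verifyRel`).
A certificate with too short a `b` does no harm, since the simulation may then reject but never
accepts wrongly.

The machines are written as programs `Cmd` with the cost semantics `Exec`, which `Exec.trace`
transfers to stack machines. Subroutines are analysed for time only; `Exec.space` turns time bounds
into space bounds. -/

/-- `Trace f P a t b`: iterating `f` leads from `a` to `b` in `t` steps, and `P` holds at every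
configuration on the way, both ends included. -/
inductive Trace {α : Type*} (f : α → Option α) (P : α → Prop) : α → ℕ → α → Prop
  | refl {a} : P a → Trace f P a 0 a
  | head {a b c t} : P a → f a = some b → Trace f P b t c → Trace f P a (t + 1) c

namespace Trace

variable {α : Type*} {f : α → Option α} {P Q : α → Prop} {a b c : α} {t u : ℕ}

theorem trans (h : Trace f P a t b) (h' : Trace f P b u c) : Trace f P a (t + u) c := by
  induction h with
  | refl _ => simpa using h'
  | head hP hf _ ih => rw [Nat.add_right_comm]; exact .head hP hf (ih h')

theorem single (ha : P a) (hf : f a = some b) (hb : P b) : Trace f P a 1 b :=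
  .head ha hf (.refl hb)

theorem right (h : Trace f P a t b) : P b := by
  induction h with
  | refl h => exact h
  | head _ _ _ ih => exact ih

theorem mono (h : Trace f P a t b) (hPQ : ∀ x, P x → Q x) : Trace f Q a t b := by
  induction h with
  | refl hP => exact .refl (hPQ _ hP)
  | head hP hf _ ih => exact .head (hPQ _ hP) hf ih

theorem reaches (h : Trace f P a t b) : Reaches f a b := by
  induction h with
  | refl _ => exact .refl
  | head _ hf _ ih => exact .head hf ih

theorem evalsTo (h : Trace f P a t b) : (flip bind f)^[t] (some a) = some b := by
  induction h with
  | refl _ => rfl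
  | head _ hf _ ih => rw [Function.iterate_succ_apply]; simpa [flip, hf] using ih

theorem of_reaches (h : Reaches f a b) (hP : ∀ x, Reaches f a x → P x) : ∃ t, Trace f P a t b := by
  induction h using Relation.ReflTransGen.head_induction_on with
  | refl => exact ⟨0, .refl (hP _ .refl)⟩
  | head h _ ih =>
    obtain ⟨t, ht⟩ := ih fun x hx => hP x (.head h hx)
    exact ⟨t + 1, .head (hP _ .refl) h ht⟩

theorem of_evalsTo (t : ℕ) (a b : α) (h : (flip bind f)^[t] (some a) = some b) :
    Trace f (fun _ => True) a t b := by
  induction t generalizing a with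
  | zero => simp at h; subst h; exact .refl trivial
  | succ t ih =>
    rw [Function.iterate_succ_apply] at h
    cases hf : f a with
    | none =>
      have h0 : flip bind f (none : Option α) = none := rfl
      simp only [flip, Option.bind_eq_bind, Option.bind_some, hf] at h
      have : ∀ t, (flip bind f)^[t] (none : Option α) = none := fun t =>
        Function.iterate_fixed h0 t
      have h2 := this t
      simp only [Option.bind_eq_bind] at h2
      rw [h2] at h
      cases h
    | some d =>
      refine .head trivial hf (ih d ?_)
      simpa [flip, hf] using h

/-- A halting run passes through every reachable configuration. -/
theorem forall_reaches (h : Trace f P a t b) (hb : f b = none) {x : α} (hx : Reaches f a x) :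
    P x := by
  induction h with
  | refl hP =>
    cases hx.cases_head with
    | inl h => exact h ▸ hP
    | inr h => obtain ⟨y, hy, _⟩ := h; simp [hb] at hy
  | head hP hf _ ih =>
    cases hx.cases_head with
    | inl h => exact h ▸ hP
    | inr h =>
      obtain ⟨y, hy, hy'⟩ := h
      rw [hf] at hy; cases hy
      exact ih hb hy'

/-- Runs of a function are deterministic. This identifies the halting configuration of a run under a
modified oracle with that of the original run. -/
theorem halt_unique (h : Trace f P a t b) (hb : f b = none) (hc : Reaches f a c)
    (hc' : f c = none) : b = c := by
  have := (mono h (Q := fun _ => True) fun _ _ => trivial).reaches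
  induction h with
  | refl hP =>
    cases hc.cases_head with
    | inl h => exact h
    | inr h => obtain ⟨y, hy, _⟩ := h; simp [hb] at hy
  | head hP hf hp ih =>
    cases hc.cases_head with
    | inl h => subst h; simp [hf] at hc'
    | inr h =>
      obtain ⟨y, hy, hy'⟩ := h
      rw [hf] at hy; cases hy
      exact ih hb hy' hp.reaches

end Trace

/-! ### Polynomially bounded functions -/

/-- The function `f` is bounded by a polynomial. -/
def PolyBounded (f : ℕ → ℕ) : Prop := ∃ p : Polynomial ℕ, ∀ n, f n ≤ p.eval n

theorem Polynomial.eval_nat_mono (p : Polynomial ℕ) : Monotone fun n => p.eval n := by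
  intro a b hab
  simp only [Polynomial.eval_eq_sum, Polynomial.sum]
  gcongr

namespace PolyBounded

variable {f g : ℕ → ℕ}

theorem const (a : ℕ) : PolyBounded fun _ => a := ⟨Polynomial.C a, by simp⟩

theorem id : PolyBounded fun n => n := ⟨Polynomial.X, by simp⟩

theorem eval (p : Polynomial ℕ) : PolyBounded fun n => p.eval n := ⟨p, fun _ => le_rfl⟩

theorem add (hf : PolyBounded f) (hg : PolyBounded g) : PolyBounded fun n => f n + g n := by
  obtain ⟨p, hp⟩ := hf
  obtain ⟨q, hq⟩ := hg
  exact ⟨p + q, fun n => by simpa using add_le_add (hp n) (hq n)⟩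

theorem mul (hf : PolyBounded f) (hg : PolyBounded g) : PolyBounded fun n => f n * g n := by
  obtain ⟨p, hp⟩ := hf
  obtain ⟨q, hq⟩ := hg
  exact ⟨p * q, fun n => by simpa using Nat.mul_le_mul (hp n) (hq n)⟩

theorem comp_poly (p : Polynomial ℕ) (hg : PolyBounded g) :
    PolyBounded fun n => p.eval (g n) := by
  obtain ⟨q, hq⟩ := hg
  exact ⟨p.comp q, fun n => by simpa using p.eval_nat_mono (hq n)⟩

theorem mono (hg : PolyBounded g) (h : ∀ n, f n ≤ g n) : PolyBounded f := by
  obtain ⟨q, hq⟩ := hg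
  exact ⟨q, fun n => (h n).trans (hq n)⟩

end PolyBounded

/-! ### A structured programming language over stacks -/

/-- Programs over the stacks `K` with symbols `Γ` and a control state in `σ`. -/
inductive Cmd (K Γ σ : Type) : Type 1
  | push (k : K) (f : σ → Γ)
  | pop (k : K) (f : σ → Option Γ → σ)
  | load (f : σ → σ)
  /-- query the oracle -/
  | ask (f : σ → Bool → σ)
  | seq (a b : Cmd K Γ σ)
  | switch {ι : Type} (hι : Finite ι) (f : σ → ι) (c : ι → Cmd K Γ σ)
  | wh (p : σ → Bool) (c : Cmd K Γ σ)

/-- The total length of the stacks. -/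
def total {K Γ : Type} [Fintype K] (S : K → List Γ) : ℕ := ∑ k, (S k).length

namespace Cmd

variable {K Γ σ : Type} [DecidableEq K]

/-- `Exec O P c s t s'`: with oracle answers `O`, the program `c` takes the state `s` to the state
`s'` in at most `t` steps, and `P` holds of the stacks all the time. -/
inductive Exec (O : (K → List Γ) → Bool) (P : (K → List Γ) → Prop) :
    Cmd K Γ σ → σ × (K → List Γ) → ℕ → σ × (K → List Γ) → Prop
  | push {k f v S} : P S → P (Function.update S k (f v :: S k)) →
      Exec O P (.push k f) (v, S) 1 (v, Function.update S k (f v :: S k))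
  | pop {k f v S} : P S → P (Function.update S k (S k).tail) →
      Exec O P (.pop k f) (v, S) 1 (f v (S k).head?, Function.update S k (S k).tail)
  | load {f v S} : P S → Exec O P (.load f) (v, S) 1 (f v, S)
  | ask {f v S} : P S → Exec O P (.ask f) (v, S) 4 (f v (O S), S)
  | seq {a b s s' s'' t t'} : Exec O P a s t s' → Exec O P b s' t' s'' →
      Exec O P (.seq a b) s (t + t') s''
  | switch {ι hι f} {c : ι → Cmd K Γ σ} {v S t s'} : P S → Exec O P (c (f v)) (v, S) t s' →
      Exec O P (.switch hι f c) (v, S) (t + 1) s'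
  | whFalse {p c v S} : P S → p v = false → Exec O P (.wh p c) (v, S) 1 (v, S)
  | whTrue {p c v S s' s'' t t'} : P S → p v = true → Exec O P c (v, S) t s' →
      Exec O P (.wh p c) s' t' s'' → Exec O P (.wh p c) (v, S) (1 + t + t') s''
  | weaken {c s t u r} : Exec O P c s t r → t ≤ u → Exec O P c s u r

/-- Two-way branching. -/
def ite (p : σ → Bool) (a b : Cmd K Γ σ) : Cmd K Γ σ :=
  .switch (inferInstance : Finite Bool) p (fun x => cond x a b)

/-! ### Space bounds from time bounds. -/

section Space

variable [Fintype K]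

theorem total_update_add (S : K → List Γ) (k : K) (x : List Γ) :
    total (Function.update S k x) + (S k).length = total S + x.length := by
  unfold total
  rw [← Finset.add_sum_erase _ _ (Finset.mem_univ k),
    ← Finset.add_sum_erase _ (fun k => (S k).length) (Finset.mem_univ k)]
  have : ∑ j ∈ Finset.univ.erase k, (Function.update S k x j).length
      = ∑ j ∈ Finset.univ.erase k, (S j).length :=
    Finset.sum_congr rfl fun j hj => by rw [Function.update_of_ne (Finset.ne_of_mem_erase hj)]
  rw [this]
  simp
  omega

theorem total_push (S : K → List Γ) (k : K) (g : Γ) :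
    total (Function.update S k (g :: S k)) = total S + 1 := by
  have := total_update_add S k (g :: S k)
  simp only [List.length_cons] at this
  omega

theorem total_pop_le (S : K → List Γ) (k : K) :
    total (Function.update S k (S k).tail) ≤ total S := by
  have := total_update_add S k (S k).tail
  simp only [List.length_tail] at this
  omega

/-- A program pushes at most one symbol per step. -/
theorem Exec.space {O : (K → List Γ) → Bool} {c : Cmd K Γ σ} {s s' t}
    (h : Exec O (fun _ => True) c s t s') {m : ℕ} (hm : total s.2 + t ≤ m) :
    Exec O (fun S => total S ≤ m) c s t s' ∧ total s'.2 ≤ total s.2 + t := by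
  induction h with
  | @push k f v S _ _ =>
    have := total_push S k (f v)
    simp only at hm ⊢
    exact ⟨.push (by omega) (by omega), by omega⟩
  | @pop k f v S _ _ =>
    have := total_pop_le S k
    simp only at hm ⊢
    exact ⟨.pop (by omega) (by omega), by omega⟩
  | load _ => simp only at hm ⊢; exact ⟨.load (by omega), by omega⟩
  | ask _ => simp only at hm ⊢; exact ⟨.ask (by omega), by omega⟩
  | seq _ _ ih ih' =>
    obtain ⟨h1, h2⟩ := ih (by omega)
    obtain ⟨h3, h4⟩ := ih' (by omega)
    exact ⟨h1.seq h3, by omega⟩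
  | switch _ _ ih =>
    simp only at hm ih ⊢
    obtain ⟨h1, h2⟩ := ih (by omega)
    exact ⟨.switch (by omega) h1, by omega⟩
  | whFalse _ hp => simp only at hm ⊢; exact ⟨.whFalse (by omega) hp, by omega⟩
  | whTrue _ hp _ _ ih ih' =>
    simp only at hm ih ⊢
    obtain ⟨h1, h2⟩ := ih (by omega)
    obtain ⟨h3, h4⟩ := ih' (by omega)
    exact ⟨.whTrue (by omega) hp h1 h3, by omega⟩
  | weaken _ ht ih =>
    obtain ⟨h1, h2⟩ := ih (by omega)
    exact ⟨h1.weaken ht, by omega⟩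

end Space

/-! ### Compilation to stack machines -/

/-- The program points. -/
def Pos : Cmd K Γ σ → Type
  | .push _ _ => Unit
  | .pop _ _ => Unit
  | .load _ => Unit
  | .ask _ => Bool
  | .seq a b => Pos a ⊕ Pos b
  | .switch _ _ c => Option (Σ i, Pos (c i))
  | .wh _ c => Option (Pos c)

theorem finite_pos (c : Cmd K Γ σ) : Finite (Pos c) := by
  induction c with
  | push | pop | load => exact inferInstanceAs (Finite Unit)
  | ask => exact inferInstanceAs (Finite Bool)
  | seq a b ha hb => exact inferInstanceAs (Finite (Pos a ⊕ Pos b))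
  | switch hι f c ih => exact inferInstanceAs (Finite (Option (Σ i, Pos (c i))))
  | wh p c ih => exact inferInstanceAs (Finite (Option (Pos c)))

/-- The program point where the execution starts. -/
def entry : (c : Cmd K Γ σ) → Pos c
  | .push _ _ => ()
  | .pop _ _ => ()
  | .load _ => ()
  | .ask _ => false
  | .seq a _ => Sum.inl (entry a)
  | .switch _ _ _ => none
  | .wh _ _ => none

/-- The code of a program, with program points injected into a type `Λ` of labels. Besides the
control state of the program, the machine keeps a return label and an oracle answer. -/
def code {Λ : Type} (query : Λ) : (c : Cmd K Γ σ) → (Pos c → Λ) → Λ → Pos c →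
    Turing.TM2.Stmt (fun _ : K => Γ) Λ (σ × Λ × Bool)
  | .push k f, _, exit, _ =>
      Turing.TM2.Stmt.push k (fun v => f v.1) (Turing.TM2.Stmt.goto fun _ => exit)
  | .pop k f, _, exit, _ =>
      Turing.TM2.Stmt.pop k (fun v g => (f v.1 g, v.2)) (Turing.TM2.Stmt.goto fun _ => exit)
  | .load f, _, exit, _ =>
      Turing.TM2.Stmt.load (fun v => (f v.1, v.2)) (Turing.TM2.Stmt.goto fun _ => exit)
  | .ask _, inj, _, false =>
      Turing.TM2.Stmt.load (fun v => (v.1, inj true, v.2.2)) (Turing.TM2.Stmt.goto fun _ => query)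
  | .ask f, _, exit, true =>
      Turing.TM2.Stmt.load (fun v => (f v.1 v.2.2, v.2)) (Turing.TM2.Stmt.goto fun _ => exit)
  | .seq a b, inj, _, Sum.inl p =>
      code query a (fun x => inj (Sum.inl x)) (inj (Sum.inr (entry b))) p
  | .seq _ b, inj, exit, Sum.inr p => code query b (fun x => inj (Sum.inr x)) exit p
  | .switch _ f c, inj, _, none =>
      Turing.TM2.Stmt.goto fun v => inj (some ⟨f v.1, entry (c (f v.1))⟩)
  | .switch _ _ c, inj, exit, some ⟨i, p⟩ =>
      code query (c i) (fun x => inj (some ⟨i, x⟩)) exit p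
  | .wh p c, inj, exit, none =>
      Turing.TM2.Stmt.goto fun v => if p v.1 then inj (some (entry c)) else exit
  | .wh _ c, inj, _, some q => code query c (fun x => inj (some x)) (inj none) q

/-- Correctness of the compilation, by induction on the execution. The step function `f` is
constrained only at the labels of the program and at the three oracle labels, so the induction
passes to subprograms, whose points are injected into the same labels with another exit. The final
`aux` is left open since the return label and the answer are scratch data. -/
theorem Exec.trace {O : (K → List Γ) → Bool} {P : (K → List Γ) → Prop} {c : Cmd K Γ σ} {s s' t}
    (h : Exec O P c s t s') {Λ : Type} {Q Y N : Λ}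
    {f : Turing.TM2.Cfg (fun _ : K => Γ) Λ (σ × Λ × Bool) →
      Option (Turing.TM2.Cfg (fun _ : K => Γ) Λ (σ × Λ × Bool))}
    (hQ : ∀ v S, f ⟨some Q, v, S⟩ = some ⟨some (if O S then Y else N), v, S⟩)
    (hY : ∀ v S, f ⟨some Y, v, S⟩ = some ⟨some v.2.1, (v.1, v.2.1, true), S⟩)
    (hN : ∀ v S, f ⟨some N, v, S⟩ = some ⟨some v.2.1, (v.1, v.2.1, false), S⟩)
    (inj : Pos c → Λ) (exit : Λ)
    (hf : ∀ p v S, f ⟨some (inj p), v, S⟩ = some (Turing.TM2.stepAux (code Q c inj exit p) v S))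
    (aux : Λ × Bool) :
    ∃ t' ≤ t, ∃ aux' : Λ × Bool, Trace f (fun c => P c.stk)
      ⟨some (inj (entry c)), (s.1, aux), s.2⟩ t' ⟨some exit, (s'.1, aux'), s'.2⟩ := by
  induction h generalizing aux exit with
  | push h1 h2 =>
    exact ⟨1, le_rfl, aux, .single h1 (hf _ _ _) h2⟩
  | pop h1 h2 =>
    exact ⟨1, le_rfl, aux, .single h1 (hf _ _ _) h2⟩
  | load h1 =>
    exact ⟨1, le_rfl, aux, .single h1 (hf _ _ _) h1⟩
  | @ask g v S h1 =>
    -- The four steps: store the return label, query, record the answer at `Y` or `N` and return,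
    -- use the answer.
    refine ⟨4, le_rfl, (inj true, O S), .head (b := ⟨some Q, (v, inj true, aux.2), S⟩) h1
      (hf _ _ _) (.head h1 (hQ _ _)
      (.head (b := ⟨some (inj true), (v, inj true, O S), S⟩) h1 ?_ (.single h1 ?_ h1)))⟩
    · cases O S
      · exact hN _ _
      · exact hY _ _
    · exact hf true _ _
  | @seq a b s s' s'' t t' _ _ ih ih' =>
    obtain ⟨t1, ht1, aux1, p1⟩ := ih (fun x => inj (Sum.inl x)) (inj (Sum.inr (entry b)))
      (fun p v S => hf (Sum.inl p) v S) aux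
    obtain ⟨t2, ht2, aux2, p2⟩ := ih' (fun x => inj (Sum.inr x)) exit
      (fun p v S => hf (Sum.inr p) v S) aux1
    exact ⟨t1 + t2, by omega, aux2, p1.trans p2⟩
  | @switch ι hι g c v S t s' h1 _ ih =>
    obtain ⟨t1, ht1, aux1, p1⟩ := ih (fun x => inj (some ⟨_, x⟩)) exit
      (fun p v S => hf (some ⟨_, p⟩) v S) aux
    exact ⟨t1 + 1, by omega, aux1, .head h1
      (hf _ _ _) p1⟩
  | whFalse h1 hp =>
    exact ⟨1, le_rfl, aux, .single h1
      ((hf none _ _).trans (by simp [code, Turing.TM2.stepAux, hp])) h1⟩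
  | @whTrue p c v S s' s'' t t' h1 hp _ _ ih ih' =>
    obtain ⟨t1, ht1, aux1, p1⟩ := ih (fun x => inj (some x)) (inj none)
      (fun p v S => hf (some p) v S) aux
    obtain ⟨t2, ht2, aux2, p2⟩ := ih' inj exit hf aux1
    refine ⟨t1 + t2 + 1, by omega, aux2, .head h1 ?_ (p1.trans p2)⟩
    exact (hf none _ _).trans (by simp [code, Turing.TM2.stepAux, hp])
  | weaken _ ht ih =>
    obtain ⟨t1, ht1, aux1, p1⟩ := ih inj exit hf aux
    exact ⟨t1, ht1.trans ht, aux1, p1⟩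

/-- The labels of the compiled machine: the program points, an exit, and three labels for the
oracle. -/
abbrev Label (c : Cmd K Γ σ) : Type := Pos c ⊕ Fin 4

/-- The compiled machine. Without oracle it answers all its queries negatively. -/
def toOracleMachine {n : ℕ} [Fintype K] [Finite Γ] [Finite σ] (c : Cmd K Γ σ) (bit : Bool ↪ Γ)
    (inp : Fin n ↪ K) (init : σ) (accept : σ → Bool) (qStack : K) : OracleMachine n where
  K := K
  Γ := Γ
  Λ := Label c
  σ := σ × Label c × Bool
  finiteΛ := by have := finite_pos c; infer_instance
  finiteσ := by have := finite_pos c; infer_instance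
  bit := bit
  inp := inp
  start := Sum.inl (entry c)
  init := (init, Sum.inr 0, false)
  prog
    | Sum.inl p => code (Sum.inr 1) c Sum.inl (Sum.inr 0) p
    | Sum.inr 0 => Turing.TM2.Stmt.halt
    | Sum.inr 1 => Turing.TM2.Stmt.goto fun _ => Sum.inr 3
    | Sum.inr 2 => Turing.TM2.Stmt.load (fun v => (v.1, v.2.1, true))
        (Turing.TM2.Stmt.goto fun v => v.2.1)
    | Sum.inr 3 => Turing.TM2.Stmt.load (fun v => (v.1, v.2.1, false))
        (Turing.TM2.Stmt.goto fun v => v.2.1)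
  accept v := accept v.1
  qStack := qStack
  query := Sum.inr 1
  yes := Sum.inr 2
  no := Sum.inr 3

/-! ### Classes of relations decided by compiled programs. -/

section Compiled

variable {n : ℕ} [Fintype K] [Finite Γ] [Finite σ] {c : Cmd K Γ σ} {bit : Bool ↪ Γ}
    {inp : Fin n ↪ K} {init : σ} {accept : σ → Bool} {qStack : K}

/-- The initial stacks on input `x`. -/
noncomputable def initStk (bit : Bool ↪ Γ) (inp : Fin n ↪ K) (x : Fin n → List Bool) :
    K → List Γ :=
  Function.extend inp (fun i => (x i).map bit) (fun _ => [])

open Classical in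
theorem Exec.trace_stepWith {A : Set (List Bool)} {P : (K → List Γ) → Prop} {x : Fin n → List Bool}
    {t : ℕ} {s' : σ × (K → List Γ)}
    (h : Exec (fun S => decide (∃ w ∈ A, S qStack = w.map bit)) P c (init, initStk bit inp x) t s') :
    ∃ t' ≤ t + 1, ∃ aux, Trace ((toOracleMachine c bit inp init accept qStack).stepWith A)
      (fun c => P c.stk) ((toOracleMachine c bit inp init accept qStack).initCfg x) t'
      ⟨none, (s'.1, aux), s'.2⟩ := by
  obtain ⟨t1, ht1, aux, p⟩ := h.trace (Λ := Label c) (Q := Sum.inr 1) (Y := Sum.inr 2)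
    (N := Sum.inr 3)
    (f := (toOracleMachine c bit inp init accept qStack).stepWith A)
    (fun v S => by simp [OracleMachine.stepWith, toOracleMachine]; rfl)
    (fun v S => by
      simp [OracleMachine.stepWith, toOracleMachine, Machine.step, Turing.TM2.step,
        Turing.TM2.stepAux])
    (fun v S => by
      simp [OracleMachine.stepWith, toOracleMachine, Machine.step, Turing.TM2.step,
        Turing.TM2.stepAux])
    Sum.inl (Sum.inr 0)
    (fun p v S => by
      simp [OracleMachine.stepWith, toOracleMachine, Machine.step, Turing.TM2.step]; rfl)
    (Sum.inr 0, false)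
  -- The additional step executes `halt` at the exit label.
  refine ⟨t1 + 1, by omega, aux, p.trans (.single p.right ?_ p.right)⟩
  simp [OracleMachine.stepWith, toOracleMachine, Machine.step, Turing.TM2.step,
    Turing.TM2.stepAux]

variable {A : Set (List Bool)} {R : (Fin n → List Bool) → Prop} {B : ℕ → ℕ}

open Classical in
theorem polyTimeRelWith (c : Cmd K Γ σ) (bit : Bool ↪ Γ) (inp : Fin n ↪ K) (init : σ)
    (accept : σ → Bool) (qStack : K) (hB : PolyBounded B)
    (h : ∀ x : Fin n → List Bool, ∃ s',
      Exec (fun S => decide (∃ w ∈ A, S qStack = w.map bit)) (fun _ => True) c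
        (init, initStk bit inp x) (B (∑ i, (x i).length)) s' ∧ (accept s'.1 = true ↔ R x)) :
    PolyTimeRelWith A n R := by
  obtain ⟨p, hp⟩ := hB
  refine ⟨toOracleMachine c bit inp init accept qStack, p + 1, fun x => ?_⟩
  obtain ⟨s', h1, h2⟩ := h x
  obtain ⟨t', ht', aux, tr⟩ := h1.trace_stepWith (accept := accept)
  refine ⟨_, rfl, ⟨⟨⟨t', tr.evalsTo⟩, ht'.trans ?_⟩⟩, h2⟩
  simpa using hp _

/-- The relation `R` on strings is decidable in polynomial space with oracle `A`. -/
def _root_.PolySpaceRelWith (A : Set (List Bool)) (n : ℕ) (R : (Fin n → List Bool) → Prop) : Prop :=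
  ∃ (M : OracleMachine n) (p : Polynomial ℕ),
    M.DecidesInSpace (M.stepWith A) R (fun m => p.eval m)

open Classical in
theorem decidesInSpace (c : Cmd K Γ σ) (bit : Bool ↪ Γ) (inp : Fin n ↪ K) (init : σ)
    (accept : σ → Bool) (qStack : K)
    (h : ∀ x : Fin n → List Bool, ∃ t s',
      Exec (fun S => decide (∃ w ∈ A, S qStack = w.map bit))
        (fun S => total S ≤ B (∑ i, (x i).length)) c
        (init, initStk bit inp x) t s' ∧ (accept s'.1 = true ↔ R x)) :
    (toOracleMachine c bit inp init accept qStack).DecidesInSpace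
      ((toOracleMachine c bit inp init accept qStack).stepWith A) R B := by
  intro x
  obtain ⟨t, s', h1, h2⟩ := h x
  obtain ⟨t', ht', aux, tr⟩ := h1.trace_stepWith (accept := accept)
  refine ⟨⟨_, rfl, tr.reaches, h2⟩, fun d hd => ?_⟩
  exact tr.forall_reaches (by simp [OracleMachine.stepWith, Machine.step, Turing.TM2.step]) hd

theorem _root_.Machine.DecidesInSpace.mono {M : Machine n} {f : M.Cfg → Option M.Cfg} {B' : ℕ → ℕ}
    (h : M.DecidesInSpace f R B) (hB : ∀ m, B m ≤ B' m) : M.DecidesInSpace f R B' :=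
  fun x => ⟨(h x).1, fun c hc => ((h x).2 c hc).trans (hB _)⟩

open Classical in
theorem polySpaceRelWith (c : Cmd K Γ σ) (bit : Bool ↪ Γ) (inp : Fin n ↪ K) (init : σ)
    (accept : σ → Bool) (qStack : K) (hB : PolyBounded B)
    (h : ∀ x : Fin n → List Bool, ∃ t s',
      Exec (fun S => decide (∃ w ∈ A, S qStack = w.map bit))
        (fun S => total S ≤ B (∑ i, (x i).length)) c
        (init, initStk bit inp x) t s' ∧ (accept s'.1 = true ↔ R x)) :
    PolySpaceRelWith A n R := by
  obtain ⟨p, hp⟩ := hB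
  exact ⟨_, p, (decidesInSpace c bit inp init accept qStack h).mono hp⟩

/-- The instruction at the query label is to go to `no`, which is also the answer of the empty
oracle. Hence programs without oracle need no compilation of their own. -/
theorem toOracleMachine_step :
    (toOracleMachine c bit inp init accept qStack).stepWith ∅ =
      (toOracleMachine c bit inp init accept qStack).step := by
  funext d
  obtain ⟨l, v, S⟩ := d
  rcases l with _ | l
  · simp [OracleMachine.stepWith]
  · by_cases hl : l = Sum.inr 1
    · subst hl
      simp [OracleMachine.stepWith, toOracleMachine, Machine.step, Turing.TM2.step,
        Turing.TM2.stepAux]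
    · have : ¬ (some l = some (toOracleMachine c bit inp init accept qStack).query) :=
        fun h => hl (Option.some.inj h)
      simp only [OracleMachine.stepWith, if_neg this]

theorem mem_PSPACE {L : Set (List Bool)} (c : Cmd K Γ σ) (bit : Bool ↪ Γ) (inp : Fin 1 ↪ K)
    (init : σ) (accept : σ → Bool) (qStack : K) (hB : PolyBounded B)
    (h : ∀ z : List Bool, ∃ t s', Exec (fun _ => false) (fun S => total S ≤ B z.length) c
        (init, initStk bit inp fun _ => z) t s' ∧ (accept s'.1 = true ↔ z ∈ L)) :
    L ∈ PSPACE := by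
  obtain ⟨p, hp⟩ := hB
  refine ⟨(toOracleMachine c bit inp init accept qStack).toMachine, p, ?_⟩
  have := decidesInSpace (A := ∅) (R := fun x => x 0 ∈ L) (B := B) c bit inp init accept qStack
    (fun x => by
      obtain ⟨t, s', h1, h2⟩ := h (x 0)
      have hx : x = fun _ => x 0 := by funext i; rw [Subsingleton.elim i 0]
      refine ⟨t, s', ?_, h2⟩
      rw [hx]
      simpa using h1)
  rw [toOracleMachine_step] at this
  exact this.mono hp

end Compiled

end Cmd

/-! ### Subroutines -/

/-- The control state of our programs: a label and an internal state of a simulated machine, two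
registers for symbols, and three flags. -/
structure Ctl (Λ σ Γ : Type) where
  lab : Option Λ
  var : σ
  reg : Option Γ
  reg2 : Option Γ
  ok : Bool
  res : Bool
  flag : Bool

instance {Λ σ Γ : Type} [Finite Λ] [Finite σ] [Finite Γ] : Finite (Ctl Λ σ Γ) :=
  Finite.of_injective (fun v : Ctl Λ σ Γ => (v.lab, v.var, v.reg, v.reg2, v.ok, v.res, v.flag))
    fun v w h => by cases v; cases w; simpa using h

namespace Cmd

/-! ### Registers, branching, and loops over a stack. -/

section Basic

variable {K Γ Λ σ : Type} [DecidableEq K] {O : (K → List Γ) → Bool} {P : (K → List Γ) → Prop}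

/-- Pop a symbol into the first register. -/
def popR (k : K) : Cmd K Γ (Ctl Λ σ Γ) := .pop k fun v g => { v with reg := g }

/-- Push the symbol in the first register. -/
def pushR (bit : Bool ↪ Γ) (k : K) : Cmd K Γ (Ctl Λ σ Γ) := .push k fun v => v.reg.getD (bit false)

/-- Push a bit. -/
def pushB (bit : Bool ↪ Γ) (k : K) (b : Bool) : Cmd K Γ (Ctl Λ σ Γ) := .push k fun _ => bit b

/-- Execution without any condition on the stacks. -/
abbrev Run {σ : Type} (O : (K → List Γ) → Bool) (c : Cmd K Γ σ) (s : σ × (K → List Γ)) (t : ℕ)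
    (s' : σ × (K → List Γ)) : Prop :=
  Exec O (fun _ => True) c s t s'

theorem popR_run (k : K) (v : Ctl Λ σ Γ) (S : K → List Γ) :
    Run O (popR k) (v, S) 1 ({ v with reg := (S k).head? }, Function.update S k (S k).tail) :=
  .pop trivial trivial

theorem pushR_run (bit : Bool ↪ Γ) (k : K) (v : Ctl Λ σ Γ) (S : K → List Γ) {g : Γ}
    (h : v.reg = some g) : Run O (pushR bit k) (v, S) 1 (v, Function.update S k (g :: S k)) := by
  have := Exec.push (O := O) (P := fun _ => True) (k := k)
    (f := fun v : Ctl Λ σ Γ => v.reg.getD (bit false)) (v := v) (S := S) trivial trivial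
  rw [h] at this
  exact this

theorem pushB_run (bit : Bool ↪ Γ) (k : K) (b : Bool) (v : Ctl Λ σ Γ) (S : K → List Γ) :
    Run O (pushB bit k b) (v, S) 1 (v, Function.update S k (bit b :: S k)) :=
  .push trivial trivial

theorem load_run {σ : Type} (f : σ → σ) (v : σ) (S : K → List Γ) :
    Run O (.load f) (v, S) 1 (f v, S) :=
  .load trivial

theorem ite_true {σ : Type} {p : σ → Bool} {a b : Cmd K Γ σ} {v S t s'} (hP : P S) (h : p v = true)
    (ha : Exec O P a (v, S) t s') : Exec O P (ite p a b) (v, S) (t + 1) s' :=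
  .switch hP (by rw [h]; exact ha)

theorem ite_false {σ : Type} {p : σ → Bool} {a b : Cmd K Γ σ} {v S t s'} (hP : P S)
    (h : p v = false) (ha : Exec O P b (v, S) t s') : Exec O P (ite p a b) (v, S) (t + 1) s' :=
  .switch hP (by rw [h]; exact ha)

/-- The rules of `Exec` produce nested updates and exact times; this replaces them by the stacks and
the bound that are wanted. -/
theorem Exec.conv {σ : Type} {c : Cmd K Γ σ} {v v' : σ} {S S' S₁ S₂ : K → List Γ} {t t' : ℕ}
    (h : Exec O P c (v, S) t (v', S')) (h₁ : S₁ = S) (h₂ : S' = S₂) (ht : t ≤ t') :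
    Exec O P c (v, S₁) t' (v', S₂) := by
  subst h₁ h₂
  exact h.weaken ht

/-- The loop of `each`. -/
def eachLoop (k : K) (body : Cmd K Γ (Ctl Λ σ Γ)) : Cmd K Γ (Ctl Λ σ Γ) :=
  .wh (fun v => v.reg.isSome) (.seq body (popR k))

/-- Pop the stack `k` until it is empty, and run `body` for each symbol. -/
def each (k : K) (body : Cmd K Γ (Ctl Λ σ Γ)) : Cmd K Γ (Ctl Λ σ Γ) :=
  .seq (popR k) (eachLoop k body)

/-- The execution of the loop of `each`, entered from the state after the first pop. -/
def EachRun (O : (K → List Γ) → Bool) (k : K) (body : Cmd K Γ (Ctl Λ σ Γ))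
    (s : Ctl Λ σ Γ × (K → List Γ)) (t : ℕ) (s' : Ctl Λ σ Γ × (K → List Γ)) : Prop :=
  Run O (eachLoop k body) ({ s.1 with reg := (s.2 k).head? },
    Function.update s.2 k (s.2 k).tail) t s'

variable {k : K} {body : Cmd K Γ (Ctl Λ σ Γ)} {v : Ctl Λ σ Γ} {S : K → List Γ} {t t' : ℕ}

theorem EachRun.nil (h : S k = []) : EachRun O k body (v, S) 1 ({ v with reg := none }, S) := by
  have : Function.update S k (S k).tail = S := by funext j; grind [Function.update_apply]
  simp only [EachRun, this]
  rw [h]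
  exact .whFalse trivial rfl

/-- The rest of the loop starts from whatever the body leaves on `k`, so a body may itself consume
symbols of `k` or put them back. -/
theorem EachRun.cons {g : Γ} {l : List Γ} {s₁ s₂} (h : S k = g :: l)
    (h₁ : Run O body ({ v with reg := some g }, Function.update S k l) t s₁)
    (h₂ : EachRun O k body s₁ t' s₂) : EachRun O k body (v, S) (t + t' + 2) s₂ := by
  simp only [EachRun, h]
  refine .weaken (.whTrue trivial rfl (.seq h₁ (popR_run k s₁.1 s₁.2)) h₂) (by omega)

theorem EachRun.conv {v v' : Ctl Λ σ Γ} {S S' S₁ S₂ : K → List Γ}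
    (h : EachRun O k body (v, S) t (v', S')) (h₁ : S₁ = S) (h₂ : S' = S₂) (ht : t ≤ t') :
    EachRun O k body (v, S₁) t' (v', S₂) := by
  subst h₁ h₂
  exact Exec.weaken h ht

theorem EachRun.run {s s'} (h : EachRun O k body s t s') : Run O (each k body) s (t + 1) s' :=
  .weaken (.seq (popR_run k s.1 s.2) h) (by omega)

end Basic

/-! ### Clearing, moving and copying stacks. -/

section Move

variable {K Γ Λ σ : Type} [DecidableEq K] {O : (K → List Γ) → Bool} (bit : Bool ↪ Γ)

/-- Empty a stack. -/
def clear (k : K) : Cmd K Γ (Ctl Λ σ Γ) := each k (.load id)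

theorem clear_run (k : K) (v : Ctl Λ σ Γ) (S : K → List Γ) :
    Run O (clear k) (v, S) (3 * (S k).length + 2)
      ({ v with reg := none }, Function.update S k []) := by
  refine EachRun.run ?_
  generalize hl : S k = l
  induction l generalizing v S with
  | nil =>
    have : Function.update S k [] = S := by rw [← hl]; simp
    rw [this]; exact EachRun.nil hl
  | cons g l ih =>
    have := ih { v with reg := some g } (Function.update S k l) (by simp)
    rw [Function.update_idem] at this
    exact .weaken (EachRun.cons hl (load_run _ _ _) this) (by simp; omega)

/-- Move the stack `a` to the stack `b`; this reverses the order. -/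
def move (a b : K) : Cmd K Γ (Ctl Λ σ Γ) := each a (pushR bit b)

theorem move_run {a b : K} (hab : a ≠ b) (v : Ctl Λ σ Γ) (S : K → List Γ) :
    Run O (move bit a b) (v, S) (3 * (S a).length + 2)
      ({ v with reg := none },
        Function.update (Function.update S a []) b ((S a).reverse ++ S b)) := by
  refine EachRun.run ?_
  generalize hl : S a = l
  induction l generalizing v S with
  | nil => exact (EachRun.nil hl).conv rfl (by funext k; grind [Function.update_apply]) (by simp)
  | cons g l ih =>
    have := ih { v with reg := some g }
      (Function.update (Function.update S a l) b (g :: S b)) (by simp [hab])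
    exact (EachRun.cons hl (pushR_run bit b _ _ (g := g) rfl)
      (this.conv (by funext k; grind [Function.update_apply]) rfl le_rfl)).conv rfl
      (by funext k; grind [Function.update_apply]) (by simp; omega)

/-- Copy the stack `a` onto the stack `b`, with the help of an empty stack `c`. -/
def copy (a b c : K) : Cmd K Γ (Ctl Λ σ Γ) :=
  .seq (move bit a c) (each c (.seq (pushR bit a) (pushR bit b)))

theorem copy_run {a b c : K} (hab : a ≠ b) (hac : a ≠ c) (hbc : b ≠ c) (v : Ctl Λ σ Γ)
    (S : K → List Γ) (hc : S c = []) :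
    Run O (copy bit a b c) (v, S) (7 * (S a).length + 4)
      ({ v with reg := none }, Function.update S b (S a ++ S b)) := by
  -- After the move, `c` holds the string in reverse; unloading it restores `a` and writes the same
  -- string on `b`.
  have key : ∀ (l : List Γ) (v : Ctl Λ σ Γ) (S : K → List Γ), S c = l →
      EachRun O c (.seq (pushR bit a) (pushR bit b)) (v, S) (4 * l.length + 1)
        ({ v with reg := none }, Function.update (Function.update (Function.update S c [])
          a (l.reverse ++ S a)) b (l.reverse ++ S b)) := by
    intro l
    induction l with
    | nil =>
      intro v S hl
      exact (EachRun.nil hl).conv rfl (by funext k; grind [Function.update_apply]) (by simp)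
    | cons g l ih =>
      intro v S hl
      have := ih { v with reg := some g }
        (Function.update (Function.update (Function.update S c l) a (g :: S a)) b (g :: S b))
        (by simp [hbc.symm, hac.symm])
      exact (EachRun.cons hl (.seq (pushR_run bit a _ _ (g := g) rfl)
        (pushR_run bit b _ _ (g := g) rfl))
        (this.conv (by funext k; grind [Function.update_apply]) rfl le_rfl)).conv rfl
        (by funext k; grind [Function.update_apply]) (by simp; omega)
  have h1 := move_run (O := O) bit hac v S
  have h2 := key (S a).reverse { v with reg := none }
    (Function.update (Function.update S a []) c ((S a).reverse ++ S c)) (by simp [hc])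
  exact (h1.seq (EachRun.run h2)).conv rfl
    (by clear key h1 h2; funext k; grind [Function.update_apply]) (by simp; omega)

end Move

/-! ### Values of polynomials in unary. -/

section Poly

variable {K Γ Λ σ : Type} [DecidableEq K] {O : (K → List Γ) → Bool} (bit : Bool ↪ Γ)

/-- Push `n` symbols. -/
def pushN (k : K) : ℕ → Cmd K Γ (Ctl Λ σ Γ)
  | 0 => .load id
  | n + 1 => .seq (pushN k n) (pushB bit k false)

theorem pushN_run (k : K) (n : ℕ) (v : Ctl Λ σ Γ) (S : K → List Γ) :
    Run O (pushN bit k n) (v, S) (n + 1)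
      (v, Function.update S k (List.replicate n (bit false) ++ S k)) := by
  induction n with
  | zero => exact (load_run id v S).conv rfl (by simp) (by simp)
  | succ n ih =>
    have := ih.seq (pushB_run bit k false _ _)
    rwa [Function.update_idem, Function.update_self] at this

/-- The value of the polynomial with the given list of coefficients. -/
def hornerEval (n : ℕ) : List ℕ → ℕ
  | [] => 0
  | a :: l => a + n * hornerEval n l

theorem exists_hornerEval (p : Polynomial ℕ) : ∃ l, ∀ n, hornerEval n l = p.eval n := by
  induction p using Polynomial.recOnHorner with
  | M0 => exact ⟨[], by simp [hornerEval]⟩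
  | MC p a _ _ ih =>
    obtain ⟨l, hl⟩ := ih
    cases l with
    | nil => exact ⟨[a], fun n => by simp [hornerEval, ← hl]⟩
    | cons b l => exact ⟨(b + a) :: l, fun n => by simp [← hl, hornerEval]; ring⟩
  | MX p _ ih =>
    obtain ⟨l, hl⟩ := ih
    exact ⟨0 :: l, fun n => by simp [hornerEval, hl, mul_comm]⟩

/-- Push as many symbols on the empty stack `acc` as the value of a polynomial at the length of
`x`, with the help of two empty stacks. -/
def poly (x acc acc' tmp : K) : List ℕ → Cmd K Γ (Ctl Λ σ Γ)
  | [] => .load id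
  | a :: l => .seq (poly x acc acc' tmp l)
      (.seq (each acc (copy bit x acc' tmp)) (.seq (move bit acc' acc) (pushN bit acc a)))

/-- The running time of `poly`. -/
def polyTime (n : ℕ) : List ℕ → ℕ
  | [] => 1
  | a :: l => polyTime n l + (7 * n + 6) * hornerEval n l + 3 * (n * hornerEval n l) + a + 5

theorem polyBounded_hornerEval (l : List ℕ) : PolyBounded fun n => hornerEval n l := by
  induction l with
  | nil => exact .const 0
  | cons a l ih => exact (PolyBounded.const a).add (PolyBounded.id.mul ih)

theorem polyBounded_polyTime (l : List ℕ) : PolyBounded fun n => polyTime n l := by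
  induction l with
  | nil => exact .const 1
  | cons a l ih =>
    have h := polyBounded_hornerEval l
    exact (((ih.add ((((PolyBounded.const 7).mul .id).add (.const 6)).mul h)).add
      ((PolyBounded.const 3).mul (PolyBounded.id.mul h))).add (.const a)).add (.const 5)

theorem hornerEval_mono (l : List ℕ) : Monotone fun n => hornerEval n l := by
  induction l with
  | nil => exact monotone_const
  | cons a l ih =>
    intro m n h
    have := ih h
    simp only [hornerEval] at this ⊢
    gcongr

theorem polyTime_mono (l : List ℕ) : Monotone fun n => polyTime n l := by
  induction l with
  | nil => exact monotone_const
  | cons a l ih =>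
    intro m n h
    have h1 := ih h
    have h2 := hornerEval_mono l h
    simp only [polyTime] at h1 h2 ⊢
    gcongr

theorem poly_run {x acc acc' tmp : K} (h1 : x ≠ acc) (h2 : x ≠ acc') (h3 : x ≠ tmp)
    (h4 : acc ≠ acc') (h5 : acc ≠ tmp) (h6 : acc' ≠ tmp) (l : List ℕ) (v : Ctl Λ σ Γ)
    (S : K → List Γ) (ha : S acc = []) (ha' : S acc' = []) (ht : S tmp = []) :
    ∃ r q, r.length = hornerEval (S x).length l ∧
      Run O (poly bit x acc acc' tmp l) (v, S) (polyTime (S x).length l)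
        ({ v with reg := q }, Function.update S acc r) := by
  -- Each symbol on `acc` contributes one copy of `x` to `acc'`: this is the multiplication in
  -- Horner's scheme.
  have key : ∀ (l : List Γ) (v : Ctl Λ σ Γ) (S : K → List Γ), S acc = l → S tmp = [] →
      ∃ r, r.length = (S x).length * l.length + (S acc').length ∧
      EachRun O acc (copy bit x acc' tmp) (v, S) ((7 * (S x).length + 6) * l.length + 1)
        ({ v with reg := none }, Function.update (Function.update S acc []) acc' r) := by
    intro l
    induction l with
    | nil =>
      intro v S hl ht
      refine ⟨S acc', by simp, ?_⟩
      exact (EachRun.nil hl).conv rfl (by funext k; grind [Function.update_apply]) (by simp)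
    | cons g l ih =>
      intro v S hl ht
      have hc := copy_run (O := O) bit h2 h3 h6 { v with reg := some g } (Function.update S acc l)
        (by simp [h5.symm, ht])
      obtain ⟨r, hr, ih⟩ := ih { v with reg := none } (Function.update (Function.update S acc l) acc'
        (S x ++ S acc')) (by simp [h4]) (by simp [h6.symm, h5.symm, ht])
      simp only [Function.update_of_ne h1, Function.update_of_ne h4.symm] at hc
      simp [h1, h2] at hr ih
      refine ⟨r, by simp [hr]; ring, ?_⟩
      exact (EachRun.cons hl hc ih).conv rfl (by funext k; grind [Function.update_apply])
        (by simp; ring_nf; omega)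
  induction l with
  | nil =>
    exact ⟨[], v.reg, rfl, (load_run id v S).conv rfl
      (by funext k; grind [Function.update_apply]) (by simp [polyTime])⟩
  | cons a l ih =>
    obtain ⟨r, q, hr, ih⟩ := ih
    obtain ⟨r', hr', e⟩ := key r { v with reg := q } (Function.update S acc r) (by simp)
      (by simp [h5.symm, ht])
    have hm := move_run (O := O) bit h4.symm { v with reg := none } (Function.update
      (Function.update (Function.update S acc r) acc []) acc' r')
    have hp := pushN_run (O := O) bit acc a { v with reg := none } (Function.update (Function.update
      (Function.update (Function.update (Function.update S acc r) acc []) acc' r') acc' []) acc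
      r'.reverse)
    simp [h1, h4.symm, ha', hr] at hr'
    refine ⟨List.replicate a (bit false) ++ r'.reverse, none, by simp [hr', hornerEval], ?_⟩
    refine (ih.seq (e.run.seq (hm.seq (hp.conv ?_ rfl le_rfl)))).conv rfl ?_ ?_
    · funext k; grind [Function.update_apply]
    · funext k; grind [Function.update_apply]
    · simp [polyTime, hr', hr, h1]
      ring_nf; omega

end Poly

end Cmd

/-! ### The enumeration of the binary strings by length -/

/-- The successor of a string, in the bijective binary numeration. -/
def nextStr : List Bool → List Bool
  | [] => [false]
  | false :: x => true :: x
  | true :: x => false :: nextStr x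

/-- The position of a string in the enumeration. -/
def strVal : List Bool → ℕ
  | [] => 0
  | b :: x => (if b then 2 else 1) + 2 * strVal x

theorem strVal_nextStr (x : List Bool) : strVal (nextStr x) = strVal x + 1 := by
  induction x with
  | nil => rfl
  | cons b x ih => cases b <;> simp [nextStr, strVal, ih] <;> ring

theorem strVal_injective : Function.Injective strVal := by
  intro x
  induction x with
  | nil => intro y h; cases y with
    | nil => rfl
    | cons b y => cases b <;> simp [strVal] at h <;> omega
  | cons a x ih =>
    intro y h
    cases y with
    | nil => cases a <;> simp [strVal] at h
    | cons b y =>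
      have : a = b ∧ strVal x = strVal y := by
        cases a <;> cases b <;> simp [strVal] at h ⊢ <;> omega
      rw [this.1, ih this.2]

theorem strVal_bounds (x : List Bool) :
    2 ^ x.length ≤ strVal x + 1 ∧ strVal x + 2 ≤ 2 ^ (x.length + 1) := by
  induction x with
  | nil => simp [strVal]
  | cons b x ih => cases b <;> simp [strVal, pow_succ] at ih ⊢ <;> omega

/-- The enumeration goes by length, so the strings of length at most `m` are those with value at
most `2 ^ (m + 1) - 2`. A search through successors may stop at the first longer string, and a
counter with room for `m` symbols overflows only there. -/
theorem length_le_iff_strVal (x : List Bool) (m : ℕ) :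
    x.length ≤ m ↔ strVal x + 2 ≤ 2 ^ (m + 1) := by
  obtain ⟨h1, h2⟩ := strVal_bounds x
  constructor
  · intro h
    exact h2.trans (Nat.pow_le_pow_right (by norm_num) (by omega))
  · intro h
    by_contra hlt
    have := Nat.pow_le_pow_right (n := 2) (by norm_num) (show m + 1 ≤ x.length by omega)
    omega

theorem nextStr_replicate_append (j : ℕ) (y : List Bool) :
    nextStr (List.replicate j true ++ false :: y) = List.replicate j false ++ true :: y := by
  induction j with
  | zero => rfl
  | succ j ih => simp [List.replicate_succ, nextStr, ih]

theorem nextStr_replicate (j : ℕ) :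
    nextStr (List.replicate j true) = List.replicate (j + 1) false := by
  induction j with
  | zero => rfl
  | succ j ih => rw [List.replicate_succ, nextStr, ih, ← List.replicate_succ]

/-- The two cases of a carry: it stops at the first `false`, or it runs through the whole string and
makes it longer. -/
theorem eq_replicate_or (x : List Bool) :
    (∃ j y, x = List.replicate j true ++ false :: y) ∨ ∃ j, x = List.replicate j true := by
  induction x with
  | nil => exact .inr ⟨0, rfl⟩
  | cons b x ih =>
    cases b with
    | false => exact .inl ⟨0, x, rfl⟩
    | true =>
      rcases ih with ⟨j, y, rfl⟩ | ⟨j, rfl⟩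
      · exact .inl ⟨j + 1, y, rfl⟩
      · exact .inr ⟨j + 1, rfl⟩

/-! ### Blocks -/

/-- The self-delimiting code of a string. -/
def enc (w : List Bool) : List Bool := w.flatMap (fun b => [true, b]) ++ [false]

/-- Split off the first block of a string. -/
def readBlock : List Bool → List Bool × List Bool
  | [] => ([], [])
  | false :: z => ([], z)
  | [true] => ([false], [])
  | true :: b :: z => (b :: (readBlock z).1, (readBlock z).2)

theorem length_readBlock (z : List Bool) :
    (readBlock z).1.length + (readBlock z).2.length ≤ z.length := by
  fun_induction readBlock z <;> simp_all; omega

theorem length_readBlock_lt (z : List Bool) (hz : z ≠ []) :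
    (readBlock z).2.length < z.length := by
  fun_induction readBlock z with
  | case1 => simp at hz
  | case2 => simp
  | case3 => simp
  | case4 b z ih =>
    by_cases h : z = []
    · subst h; simp [readBlock]
    · have := ih h; simp; omega

theorem readBlock_enc_append (w z : List Bool) : readBlock (enc w ++ z) = (w, z) := by
  induction w with
  | nil => simp [enc, readBlock]
  | cons b w ih =>
    have : enc (b :: w) ++ z = true :: b :: (enc w ++ z) := by simp [enc]
    rw [this, readBlock, ih]

theorem length_enc (w : List Bool) : (enc w).length = 2 * w.length + 1 := by
  induction w with
  | nil => rfl
  | cons b w ih => simp [enc] at ih ⊢; omega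

/-- The list of all blocks of a string. -/
def blocks (z : List Bool) : List (List Bool) :=
  if _h : z = [] then [] else (readBlock z).1 :: blocks (readBlock z).2
termination_by z.length
decreasing_by exact length_readBlock_lt z ‹_›

theorem blocks_flatMap_enc (l : List (List Bool)) : blocks (l.flatMap enc) = l := by
  induction l with
  | nil => rw [List.flatMap_nil, blocks]; simp
  | cons w l ih =>
    have : (w :: l).flatMap enc = enc w ++ l.flatMap enc := by simp
    rw [this, blocks, dif_neg, readBlock_enc_append, ih]
    simp [enc]

namespace Cmd

/-! ### Counting with strings of bounded length. -/

section Incr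

variable {K Γ Λ σ : Type} [DecidableEq K] {O : (K → List Γ) → Bool} (bit : Bool ↪ Γ)

open Classical in
/-- Pop the leading symbols `true` of the stack `X` and push them on the stack `T`. -/
noncomputable def incrLoop (X T : K) : Cmd K Γ (Ctl Λ σ Γ) :=
  .wh (fun v => v.reg = some (bit true)) (.seq (pushB bit T true) (popR X))

/-- Replace the string on the stack `X` by its successor. If this makes the string longer, a symbol
is taken from the stack `F`. If there is none, the flag `ok` is cleared. -/
noncomputable def incr (X T F : K) : Cmd K Γ (Ctl Λ σ Γ) :=
  .seq (popR X) (.seq (incrLoop bit X T) (.seq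
    (ite (fun v => v.reg.isSome) (pushB bit X true)
      (.seq (popR F) (ite (fun v => v.reg.isSome) (pushB bit X false)
        (.load fun v => { v with ok := false }))))
    (each T (pushB bit X false))))

theorem incrLoop_run {X T : K} (hXT : X ≠ T) (j : ℕ) (y : List Γ) (hy : y.head? ≠ some (bit true))
    (v : Ctl Λ σ Γ) (S : K → List Γ) (hS : S X = List.replicate j (bit true) ++ y) :
    Run O (incrLoop bit X T) ({ v with reg := (S X).head? }, Function.update S X (S X).tail)
      (3 * j + 1) ({ v with reg := y.head? }, Function.update (Function.update S X y.tail) T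
        (List.replicate j (bit true) ++ S T)) := by
  induction j generalizing v S with
  | zero =>
    simp at hS
    rw [hS]
    exact (Exec.whFalse trivial (by simpa using hy)).conv rfl
      (by funext k; grind [Function.update_apply]) (by simp)
  | succ j ih =>
    have := ih { v with reg := (S X).head? } (Function.update (Function.update S X (S X).tail) T
      (bit true :: Function.update S X (S X).tail T)) (by simp [hXT, hS, List.replicate_succ])
    refine (Exec.whTrue trivial ?_ (Exec.seq (pushB_run bit T true _ _) (popR_run X _ _))
      this).conv rfl ?_ ?_
    · simp [hS, List.replicate_succ]
    · clear this ih
      funext k; grind [Function.update_apply, List.replicate_succ']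
    · omega

theorem incrRestore_run {X T : K} (hXT : X ≠ T) (v : Ctl Λ σ Γ) (S : K → List Γ) :
    Run O (each T (pushB bit X false)) (v, S) (3 * (S T).length + 2)
      ({ v with reg := none }, Function.update (Function.update S T []) X
        (List.replicate (S T).length (bit false) ++ S X)) := by
  refine EachRun.run ?_
  generalize hl : S T = l
  induction l generalizing v S with
  | nil => exact (EachRun.nil hl).conv rfl (by funext k; grind [Function.update_apply]) (by simp)
  | cons g l ih =>
    refine (EachRun.cons hl (pushB_run bit X false _ _) (ih _ _ (by simp [hXT.symm]))).conv rfl ?_ ?_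
    · clear ih
      funext k; grind [Function.update_apply, List.replicate_succ']
    · simp; omega

/-- The lengths of `X` and `F` together stay constant, so a counter with its store of symbols
occupies constant space. Nothing more is said about `x'` after an overflow, because the loops that
use the counter stop once `ok` is cleared. -/
theorem incr_run {X T F : K} (hXT : X ≠ T) (hXF : X ≠ F) (hTF : T ≠ F) (x : List Bool)
    (v : Ctl Λ σ Γ) (S : K → List Γ) (hX : S X = x.map bit) (hT : S T = []) :
    ∃ x' F', x'.length + F'.length = x.length + (S F).length ∧
      ((nextStr x).length ≤ x.length + (S F).length → x' = nextStr x) ∧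
      Run O (incr bit X T F) (v, S) (6 * x.length + 8)
        ({ v with reg := none, ok := v.ok && decide ((nextStr x).length ≤ x.length + (S F).length) },
          Function.update (Function.update S X (x'.map bit)) F F') := by
  rcases eq_replicate_or x with ⟨j, y, rfl⟩ | ⟨j, rfl⟩
  · have h1 := incrLoop_run (O := O) bit hXT j (bit false :: y.map bit) (by simp) v S
      (by simp [hX])
    refine ⟨_, S F, ?_, fun _ => rfl, ?_⟩
    · simp [nextStr_replicate_append]
    · have h2 := h1.seq ((ite_true (p := fun v : Ctl Λ σ Γ => v.reg.isSome) (b := .seq (popR F)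
        (ite (fun v => v.reg.isSome) (pushB bit X false)
        (.load fun v => { v with ok := false }))) trivial rfl (pushB_run bit X true _ _)).seq
        (incrRestore_run bit hXT _ _))
      have h3 := (popR_run X v S).seq h2
      have hd : (v.ok && decide ((nextStr (List.replicate j true ++ false :: y)).length ≤
        (List.replicate j true ++ false :: y).length + (S F).length)) = v.ok := by
        simp [nextStr_replicate_append]
      rw [hd]
      refine h3.conv rfl ?_ ?_
      · clear h1 h2 h3 hd
        funext k
        rw [nextStr_replicate_append]
        grind [Function.update_apply, List.map_replicate]
      · simp [hXT.symm, hT]; omega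
  · have h1 := incrLoop_run (O := O) bit hXT j [] (by simp) v S (by simp [hX])
    cases hF : S F with
    | cons f F' =>
      refine ⟨_, F', ?_, fun _ => rfl, ?_⟩
      · simp [nextStr_replicate]; omega
      · have h2 := h1.seq ((ite_false (p := fun v : Ctl Λ σ Γ => v.reg.isSome)
          (a := pushB bit X true) trivial rfl
          ((popR_run F _ _).seq (ite_true (p := fun v : Ctl Λ σ Γ => v.reg.isSome)
            (b := .load fun v => { v with ok := false }) trivial
            (by simp [hXF.symm, hTF.symm, hF]) (pushB_run bit X false _ _)))).seq
          (incrRestore_run bit hXT _ _))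
        have h3 := (popR_run X v S).seq h2
        have hd : (v.ok && decide ((nextStr (List.replicate j true)).length ≤
          (List.replicate j true).length + (f :: F').length)) = v.ok := by
          simp [nextStr_replicate]
        rw [hd]
        refine h3.conv rfl ?_ ?_
        · clear h1 h2 h3 hd
          funext k
          rw [nextStr_replicate, List.replicate_succ']
          grind [Function.update_apply, List.map_replicate]
        · simp [hXT.symm, hTF, hT]; omega
    | nil =>
      -- Overflow: the carry has run through and `F` is empty, so all symbols become `false` and the
      -- length stays the same.
      refine ⟨List.replicate j false, [], ?_, ?_, ?_⟩
      · simp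
      · simp [nextStr_replicate]
      · have h2 := h1.seq ((ite_false (p := fun v : Ctl Λ σ Γ => v.reg.isSome)
          (a := pushB bit X true) trivial rfl
          ((popR_run F _ _).seq (ite_false (p := fun v : Ctl Λ σ Γ => v.reg.isSome)
            (a := pushB bit X false) trivial
            (by simp [hXF.symm, hTF.symm, hF]) (load_run (fun v => { v with ok := false }) _ _)))).seq
          (incrRestore_run bit hXT _ _))
        have h3 := (popR_run X v S).seq h2
        have hd : (v.ok && decide ((nextStr (List.replicate j true)).length ≤
          (List.replicate j true).length + ([] : List Γ).length)) = false := by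
          simp [nextStr_replicate]
        rw [hd]
        refine h3.conv rfl ?_ ?_
        · clear h1 h2 h3 hd
          funext k
          grind [Function.update_apply, List.map_replicate]
        · simp [hTF, hT]; omega

end Incr
end Cmd

/-! ### Reading blocks and searching a list of blocks. -/

namespace Cmd

variable {K Γ Λ σ : Type} [DecidableEq K] {O : (K → List Γ) → Bool} (bit : Bool ↪ Γ)

open Classical in
/-- The loop of `readB`. -/
noncomputable def readLoop (Z D : K) : Cmd K Γ (Ctl Λ σ Γ) :=
  .wh (fun v => v.reg = some (bit true)) (.seq (popR Z) (.seq
    (.push D fun v => if v.reg = some (bit true) then bit true else bit false) (popR Z)))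

/-- Read a block from the stack `Z`, and push it on the stack `D`. -/
noncomputable def readB (Z D : K) : Cmd K Γ (Ctl Λ σ Γ) := .seq (popR Z) (readLoop bit Z D)

open Classical in
theorem readB_run {Z D : K} (hZD : Z ≠ D) (z : List Bool) (v : Ctl Λ σ Γ) (S : K → List Γ)
    (hZ : S Z = z.map bit) :
    ∃ q, Run O (readB bit Z D) (v, S) (4 * z.length + 2)
      ({ v with reg := q }, Function.update (Function.update S Z ((readBlock z).2.map bit)) D
        ((readBlock z).1.reverse.map bit ++ S D)) := by
  have key : ∃ q, Run O (readLoop bit Z D) ({ v with reg := (S Z).head? },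
      Function.update S Z (S Z).tail) (4 * z.length + 1) ({ v with reg := q },
        Function.update (Function.update S Z ((readBlock z).2.map bit)) D
        ((readBlock z).1.reverse.map bit ++ S D)) := by
    induction z using readBlock.induct generalizing v S with
    | case1 =>
      exact ⟨_, (Exec.whFalse trivial (by simp [hZ])).conv rfl
        (by funext k; grind [Function.update_apply, readBlock]) (by simp)⟩
    | case2 z =>
      exact ⟨_, (Exec.whFalse trivial (by simp [hZ])).conv rfl
        (by funext k; grind [Function.update_apply, readBlock]) (by simp)⟩
    -- A block that is cut off after its marker: the second pop finds nothing and `false` is pushed,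
    -- in agreement with the value of `readBlock` on `[true]`.
    | case3 =>
      refine ⟨_, (Exec.whTrue trivial (by simp [hZ]) (Exec.seq (popR_run _ _ _)
        (Exec.seq (.push trivial trivial) (popR_run _ _ _)))
        (.whFalse trivial (by simp [hZ, hZD]))).conv rfl ?_ (by simp)⟩
      simp [hZ, hZD, readBlock]
      funext k; grind [Function.update_apply]
    | case4 b z ih =>
      obtain ⟨q, ih⟩ := ih { v with reg := some (bit b) }
        (Function.update (Function.update (Function.update S Z (S Z).tail) Z
          (Function.update S Z (S Z).tail Z).tail) D (bit b :: Function.update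
          (Function.update S Z (S Z).tail) Z (Function.update S Z (S Z).tail Z).tail D))
        (by simp [hZ, hZD])
      have hp : Run O (.push D fun v : Ctl Λ σ Γ =>
          if v.reg = some (bit true) then bit true else bit false)
          ({ v with reg := some (bit b) }, Function.update (Function.update S Z (S Z).tail) Z
          (Function.update S Z (S Z).tail Z).tail) 1 ({ v with reg := some (bit b) },
          (Function.update (Function.update (Function.update S Z (S Z).tail) Z
          (Function.update S Z (S Z).tail Z).tail) D (bit b :: Function.update
          (Function.update S Z (S Z).tail) Z (Function.update S Z (S Z).tail Z).tail D))) := by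
        have := Exec.push (O := O) (P := fun _ => True) (k := D) (f := fun v : Ctl Λ σ Γ =>
          if v.reg = some (bit true) then bit true else bit false)
          (v := { v with reg := some (bit b) })
          (S := Function.update (Function.update S Z (S Z).tail) Z
          (Function.update S Z (S Z).tail Z).tail) trivial trivial
        cases b <;> simpa using this
      have hpop : Run O (popR Z) ({ v with reg := (S Z).head? }, Function.update S Z (S Z).tail) 1
          ({ v with reg := some (bit b) }, Function.update (Function.update S Z (S Z).tail) Z
          (Function.update S Z (S Z).tail Z).tail) := by
        have := popR_run (O := O) Z { v with reg := (S Z).head? } (Function.update S Z (S Z).tail)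
        simpa [hZ] using this
      refine ⟨q, (Exec.whTrue trivial (by simp [hZ]) (hpop.seq (hp.seq (popR_run _ _ _)))
        ih).conv rfl ?_ (by simp; omega)⟩
      clear ih hp hpop
      funext k; grind [Function.update_apply, readBlock]
  obtain ⟨q, key⟩ := key
  exact ⟨q, ((popR_run Z v S).seq key).conv rfl rfl (by omega)⟩

open Classical in
/-- The body of the loop of `eqC`. -/
noncomputable def eqBody (b : K) : Cmd K Γ (Ctl Λ σ Γ) :=
  .seq (.load fun v => { v with reg2 := v.reg }) (.seq (popR b)
    (.load fun v => { v with flag := v.flag && decide (v.reg = v.reg2) }))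

/-- Set `flag` if the stacks `a` and `b` are equal, and empty them. -/
noncomputable def eqC (a b : K) : Cmd K Γ (Ctl Λ σ Γ) :=
  .seq (.load fun v => { v with flag := true }) (.seq (each a (eqBody b))
    (.seq (popR b) (.seq (.load fun v => { v with flag := v.flag && v.reg.isNone }) (clear b))))

open Classical in
theorem eqC_run {a b : K} (hab : a ≠ b) (v : Ctl Λ σ Γ) (S : K → List Γ) :
    ∃ q, Run O (eqC a b) (v, S) (5 * (S a).length + 3 * (S b).length + 7)
      ({ v with reg := none, reg2 := q, flag := decide (S a = S b) },
        Function.update (Function.update S a []) b []) := by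
  -- The loop tests only whether `S a` is a prefix of `S b`; the pop after the loop checks that
  -- nothing remains on `b`.
  have key : ∀ (l : List Γ) (v : Ctl Λ σ Γ) (S : K → List Γ), S a = l →
      ∃ q, EachRun O a (eqBody b) (v, S) (5 * l.length + 1)
        ({ v with reg := none, reg2 := q, flag := v.flag && decide (l <+: S b) },
          Function.update (Function.update S a []) b ((S b).drop l.length)) := by
    intro l
    induction l with
    | nil =>
      intro v S hl
      refine ⟨v.reg2, ?_⟩
      have := (EachRun.nil (O := O) (body := eqBody b) (v := v) hl).conv rfl
        (S₂ := Function.update (Function.update S a []) b ((S b).drop 0))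
        (by funext k; grind [Function.update_apply]) (le_refl 1)
      simpa using this
    | cons g l ih =>
      intro v S hl
      obtain ⟨q, ih⟩ := ih { v with reg := (S b).head?, reg2 := some g, flag := v.flag && decide ((S b).head? = some g) }
        (Function.update (Function.update S a l) b (S b).tail) (by simp [hab])
      refine ⟨q, ?_⟩
      have hb : Run O (eqBody b) ({ v with reg := some g }, Function.update S a l) 3
          ({ v with reg := (S b).head?, reg2 := some g,
                    flag := v.flag && decide ((S b).head? = some g) },
            Function.update (Function.update S a l) b (S b).tail) := by
        have := (load_run (O := O) (fun v : Ctl Λ σ Γ => { v with reg2 := v.reg })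
          { v with reg := some g } (Function.update S a l)).seq ((popR_run b _ _).seq
          (load_run (fun v : Ctl Λ σ Γ => { v with flag := v.flag && decide (v.reg = v.reg2) }) _ _))
        simp only [Function.update_of_ne hab.symm] at this
        exact this
      have h := EachRun.cons hl hb ih
      have hf : (v.flag && decide ((S b).head? = some g) && decide (l <+:
          Function.update (Function.update S a l) b (S b).tail b)) =
          (v.flag && decide (g :: l <+: S b)) := by
        cases hS : S b with
        | nil => simp
        | cons g' r => by_cases h : g' = g <;> simp [List.cons_prefix_cons, h, eq_comm, Bool.and_assoc]
      simp only [hf] at h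
      refine h.conv rfl ?_ (by simp; omega)
      clear h ih hb hf
      have : List.drop (g :: l).length (S b) = List.drop l.length (S b).tail := by
        rw [List.drop_tail, List.length_cons, add_comm]
      funext k; grind [Function.update_apply]
  obtain ⟨q, h1⟩ := key (S a) { v with flag := true } S rfl
  refine ⟨q, ?_⟩
  have h2 := (load_run (O := O) (fun v : Ctl Λ σ Γ => { v with flag := true }) v S).seq
    (h1.run.seq ((popR_run b _ _).seq ((load_run (fun v : Ctl Λ σ Γ =>
      { v with flag := v.flag && v.reg.isNone }) _ _).seq (clear_run b _ _))))
  have hf : (true && decide (S a <+: S b) && (Function.update (Function.update S a []) b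
      ((S b).drop (S a).length) b).head?.isNone) = decide (S a = S b) := by
    by_cases h : S a = S b
    · simp [h]
    · simp only [h, decide_false, Function.update_self]
      by_contra hc
      simp at hc
      exact h (hc.1.eq_of_length_le hc.2)
  simp only [hf] at h2
  refine h2.conv rfl ?_ ?_
  · clear h1 h2 key hf
    funext k; grind [Function.update_apply]
  · simp; omega

/-- The body of the loop of `lookup`. -/
noncomputable def lookupBody (Q Z' Q' D D' T : K) : Cmd K Γ (Ctl Λ σ Γ) :=
  .seq (pushR bit Z') (.seq (readB bit Z' D) (.seq (move bit D D') (.seq (copy bit Q Q' T)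
    (.seq (eqC D' Q') (.load fun v => { v with res := v.res || v.flag })))))

/-- Set `res` if the contents of the stack `Q` is one of the blocks on the stack `Z`. The other
stacks are auxiliary. -/
noncomputable def lookup (Z Q Z' Q' D D' T : K) : Cmd K Γ (Ctl Λ σ Γ) :=
  .seq (.load fun v => { v with res := false }) (.seq (copy bit Z Z' T)
    (each Z' (lookupBody bit Q Z' Q' D D' T)))

open Classical in
theorem lookup_run {Z Q Z' Q' D D' T : K} (hd : [Z, Q, Z', Q', D, D', T].Nodup) (z : List Bool)
    (v : Ctl Λ σ Γ) (S : K → List Γ) (hZ : S Z = z.map bit) (hZ' : S Z' = []) (hQ' : S Q' = [])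
    (hD : S D = []) (hD' : S D' = []) (hT : S T = []) :
    ∃ q f, Run O (lookup bit Z Q Z' Q' D D' T) (v, S)
      (z.length * (20 * z.length + 20 * (S Q).length + 30) + 20 * z.length + 10)
      ({ v with reg := none, reg2 := q, flag := f,
                res := decide (∃ w ∈ blocks z, S Q = w.map bit) }, S) := by
  simp at hd
  obtain ⟨⟨d1, d2, d3, d4, d5, d6⟩, ⟨d7, d8, d9, d10, d11⟩, ⟨d12, d13, d14, d15⟩,
    ⟨d16, d17, d18⟩, ⟨d19, d20⟩, d21⟩ := hd
  -- One round consumes a whole block, hence strong induction on the length that remains. The fixed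
  -- `n` bounds the cost of each round, and there are at most `z.length` rounds.
  have key : ∀ (n : ℕ) (z : List Bool) (v : Ctl Λ σ Γ) (S : K → List Γ), z.length ≤ n →
      S Z' = z.map bit → S Q' = [] → S D = [] → S D' = [] → S T = [] →
      ∃ q f, EachRun O Z' (lookupBody bit Q Z' Q' D D' T) (v, S)
        (z.length * (20 * n + 20 * (S Q).length + 30) + 1)
        ({ v with reg := none, reg2 := q, flag := f,
                  res := v.res || decide (∃ w ∈ blocks z, S Q = w.map bit) },
          Function.update S Z' []) := by
    intro n z
    induction hn : z.length using Nat.strong_induction_on generalizing z with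
    | _ m ih =>
    intro v S hz hZ' hQ' hD hD' hT
    cases z with
    | nil =>
      refine ⟨v.reg2, v.flag, ?_⟩
      have := (EachRun.nil (O := O) (body := lookupBody bit Q Z' Q' D D' T) (v := v) hZ').conv rfl
        (S₂ := Function.update S Z' []) (by funext k; grind [Function.update_apply])
        (t' := m * (20 * n + 20 * (S Q).length + 30) + 1) (by omega)
      simpa [blocks] using this
    | cons b z =>
      -- The loop has already popped the first symbol of the block, so the body begins by putting it
      -- back.
      have h1 := pushR_run (O := O) bit Z' { v with reg := some (bit b) }
        (Function.update S Z' (z.map bit)) (g := bit b) rfl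
      have e1 : Function.update (Function.update S Z' (z.map bit)) Z'
          (bit b :: Function.update S Z' (z.map bit) Z') = S := by
        funext k; grind [Function.update_apply]
      rw [e1] at h1
      obtain ⟨q2, h2⟩ := readB_run (O := O) bit d13 (b :: z) { v with reg := some (bit b) } S hZ'
      have hlen1 := length_readBlock (b :: z)
      have hlen2 := length_readBlock_lt (b :: z) (by simp)
      have hblocks : blocks (b :: z) = (readBlock (b :: z)).1 :: blocks (readBlock (b :: z)).2 := by
        conv_lhs => rw [blocks]
        simp
      generalize (readBlock (b :: z)).1 = u at *
      generalize (readBlock (b :: z)).2 = r at *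
      have h3 := move_run (O := O) bit d19 { v with reg := q2 } (Function.update
        (Function.update S Z' (r.map bit)) D (u.reverse.map bit ++ S D))
      have e3 : Function.update (Function.update (Function.update (Function.update S Z' (r.map bit))
          D (u.reverse.map bit ++ S D)) D []) D' ((Function.update (Function.update S Z'
          (r.map bit)) D (u.reverse.map bit ++ S D) D).reverse ++ Function.update (Function.update
          S Z' (r.map bit)) D (u.reverse.map bit ++ S D) D') =
          Function.update (Function.update S Z' (r.map bit)) D' (u.map bit) := by
        clear h1 h2 h3 ih e1 hblocks hlen1 hlen2
        rw [List.map_reverse]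
        funext k; grind [Function.update_apply]
      rw [e3] at h3
      have h4 := copy_run (O := O) bit d8 d11 d18 { v with reg := none } (Function.update
        (Function.update S Z' (r.map bit)) D' (u.map bit)) (by
          clear h1 h2 h3 ih; grind [Function.update_apply])
      obtain ⟨q5, h5⟩ := eqC_run (O := O) (Ne.symm d17) { v with reg := none } (Function.update
        (Function.update (Function.update S Z' (r.map bit)) D' (u.map bit)) Q'
        (Function.update (Function.update S Z' (r.map bit)) D' (u.map bit) Q ++
          Function.update (Function.update S Z' (r.map bit)) D' (u.map bit) Q'))
      have e5 : Function.update (Function.update (Function.update (Function.update (Function.update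
          S Z' (r.map bit)) D' (u.map bit)) Q'
          (Function.update (Function.update S Z' (r.map bit)) D' (u.map bit) Q ++
          Function.update (Function.update S Z' (r.map bit)) D' (u.map bit) Q')) D' []) Q' []
          = Function.update S Z' (r.map bit) := by
        clear h1 h2 h3 h4 h5 ih
        funext k; grind [Function.update_apply]
      rw [e5] at h5
      have h6 := load_run (O := O) (fun v : Ctl Λ σ Γ => { v with res := v.res || v.flag })
      have hbody := h1.seq (h2.seq (h3.seq (h4.seq (h5.seq (h6 _ _)))))
      obtain ⟨q, f, h7⟩ := ih r.length (by simp at hn hlen2; omega) r rfl _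
        (Function.update S Z' (r.map bit)) (by simp at hn hlen2; omega)
        (by simp) (by simp [Ne.symm d12, hQ']) (by simp [Ne.symm d13, hD])
        (by simp [Ne.symm d14, hD']) (by simp [Ne.symm d15, hT])
      have h8 := EachRun.cons (by simpa using hZ') hbody h7
      refine ⟨q, f, ?_⟩
      have hf : ((v.res || decide ((Function.update (Function.update (Function.update S Z'
          (r.map bit)) D' (u.map bit)) Q'
          (Function.update (Function.update S Z' (r.map bit)) D' (u.map bit) Q ++
          Function.update (Function.update S Z' (r.map bit)) D' (u.map bit) Q')) D' =
          (Function.update (Function.update (Function.update S Z' (r.map bit)) D' (u.map bit)) Q'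
          (Function.update (Function.update S Z' (r.map bit)) D' (u.map bit) Q ++
          Function.update (Function.update S Z' (r.map bit)) D' (u.map bit) Q')) Q')) ||
          decide (∃ w ∈ blocks r, Function.update S Z' (r.map bit) Q = w.map bit)) =
          (v.res || decide (∃ w ∈ blocks (b :: z), S Q = w.map bit)) := by
        rw [hblocks]
        simp [d7, d10, d17, Ne.symm d17, Ne.symm d12, hQ', eq_comm, Bool.or_assoc]
      simp only [hf] at h8
      refine h8.conv rfl (by simp) ?_
      simp only [List.length_cons] at hlen1 hlen2 hn
      have hm := Nat.mul_le_mul_right (20 * n + 20 * (S Q).length + 30)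
        (show r.length ≤ z.length by omega)
      have hm' := Nat.succ_mul z.length (20 * n + 20 * (S Q).length + 30)
      simp [d7, d10, d17, Ne.symm d17, Ne.symm d12, hQ', hD, ← hn]
      rw [Nat.succ_eq_add_one] at hm'
      omega
  have h1 := copy_run (O := O) bit d2 d6 d15 { v with res := false } S hT
  obtain ⟨q, f, h2⟩ := key z.length z { v with reg := none, res := false }
    (Function.update S Z' (S Z ++ S Z')) le_rfl (by simp [hZ, hZ']) (by simp [Ne.symm d12, hQ'])
    (by simp [Ne.symm d13, hD]) (by simp [Ne.symm d14, hD']) (by simp [Ne.symm d15, hT])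
  refine ⟨q, f, ?_⟩
  have h3 := (load_run (O := O) (fun v : Ctl Λ σ Γ => { v with res := false }) v S).seq
    (h1.seq h2.run)
  simp only [Function.update_of_ne d7, Bool.false_or] at h3
  refine h3.conv rfl ?_ ?_
  · clear h1 h2 h3 key
    funext k; grind [Function.update_apply]
  · simp [hZ]; omega

end Cmd

/-! ### Simulation of machines -/

namespace Turing.TM2.Stmt

variable {K : Type*} {Γ : K → Type*} {Λ σ : Type*}

/-- The size of a statement. -/
def size : Stmt Γ Λ σ → ℕ
  | push _ _ q => size q + 1
  | peek _ _ q => size q + 1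
  | pop _ _ q => size q + 1
  | load _ q => size q + 1
  | branch _ q₁ q₂ => size q₁ + size q₂ + 1
  | goto _ => 1
  | halt => 1

theorem exists_size_le [Finite Λ] (prog : Λ → Stmt Γ Λ σ) : ∃ C, ∀ l, (prog l).size ≤ C := by
  obtain ⟨C, hC⟩ := (Set.finite_range fun l => (prog l).size).bddAbove
  exact ⟨C, fun l => hC ⟨l, rfl⟩⟩

end Turing.TM2.Stmt

open Turing.TM2.Stmt in
theorem total_stepAux_le {K Γ Λ σ : Type} [DecidableEq K] [Fintype K]
    (q : Turing.TM2.Stmt (fun _ : K => Γ) Λ σ) (v : σ) (S : K → List Γ) :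
    total (Turing.TM2.stepAux q v S).stk ≤ total S + q.size := by
  induction q generalizing v S with
  | push k f q ih =>
    have := ih v (Function.update S k (f v :: S k))
    have := Cmd.total_push S k (f v)
    simp only [Turing.TM2.stepAux, size]
    omega
  | peek k f q ih => have := ih (f v (S k).head?) S; simp only [Turing.TM2.stepAux, size]; omega
  | pop k f q ih =>
    have := ih (f v (S k).head?) (Function.update S k (S k).tail)
    have := Cmd.total_pop_le S k
    simp only [Turing.TM2.stepAux, size]
    omega
  | load f q ih => have := ih (f v) S; simp only [Turing.TM2.stepAux, size]; omega
  | branch f q₁ q₂ ih₁ ih₂ =>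
    have := ih₁ v S
    have := ih₂ v S
    simp only [Turing.TM2.stepAux, size]
    cases f v <;> simp only [cond_true, cond_false] <;> omega
  | goto f => simp [Turing.TM2.stepAux]
  | halt => simp [Turing.TM2.stepAux]

section OracleStep

variable {K Γ Λ σ : Type} [DecidableEq K]

open Classical in
/-- One step of a program with an optional query label. -/
noncomputable def oracleStep (prog : Λ → Turing.TM2.Stmt (fun _ : K => Γ) Λ σ) (query : Option Λ)
    (yes no : Λ) (ans : (K → List Γ) → Bool) :
    Turing.TM2.Cfg (fun _ : K => Γ) Λ σ → Option (Turing.TM2.Cfg (fun _ : K => Γ) Λ σ)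
  | ⟨none, _, _⟩ => none
  | ⟨some l, v, S⟩ => some (if query = some l then ⟨some (if ans S then yes else no), v, S⟩
      else Turing.TM2.stepAux (prog l) v S)

open Classical in
theorem OracleMachine.stepWith_eq {n : ℕ} (M : OracleMachine n) (A : Set (List Bool)) :
    M.stepWith A = oracleStep M.prog (some M.query) M.yes M.no
      (fun S => decide (∃ w ∈ A, S M.qStack = w.map M.bit)) := by
  funext c
  obtain ⟨l, v, S⟩ := c
  cases l with
  | none => simp [OracleMachine.stepWith, oracleStep, Machine.step, Turing.TM2.step]
  | some l =>
    by_cases h : l = M.query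
    · subst h; simp [OracleMachine.stepWith, oracleStep]
    · simp [OracleMachine.stepWith, oracleStep, Machine.step, Turing.TM2.step, h, Ne.symm h]

/-- Without a query label the answers `ans` are never consulted, so one simulator serves machines
with and without oracle. -/
theorem Machine.step_eq {n : ℕ} (M : Machine n) (ans : (M.K → List M.Γ) → Bool) :
    M.step = oracleStep M.prog none M.start M.start ans := by
  funext c
  obtain ⟨l, v, S⟩ := c
  cases l with
  | none => rfl
  | some l => simp [oracleStep, Machine.step, Turing.TM2.step]

end OracleStep

namespace Cmd

variable {K E Γ Λ σ : Type} [DecidableEq K] [DecidableEq E] (bit : Bool ↪ Γ)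
  {O : (K ⊕ E → List Γ) → Bool}

/-- The program that executes a statement. -/
def stmtC : Turing.TM2.Stmt (fun _ : K => Γ) Λ σ → Cmd (K ⊕ E) Γ (Ctl Λ σ Γ)
  | .push k f q => .seq (.push (Sum.inl k) fun v => f v.var) (stmtC q)
  | .peek k f q => .seq (popR (Sum.inl k)) (.seq
      (ite (fun v => v.reg.isSome) (pushR bit (Sum.inl k)) (.load id))
      (.seq (.load fun v => { v with var := f v.var v.reg }) (stmtC q)))
  | .pop k f q => .seq (.pop (Sum.inl k) fun v g => { v with var := f v.var g }) (stmtC q)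
  | .load f q => .seq (.load fun v => { v with var := f v.var }) (stmtC q)
  | .branch f q₁ q₂ => ite (fun v => f v.var) (stmtC q₁) (stmtC q₂)
  | .goto f => .load fun v => { v with lab := some (f v.var) }
  | .halt => .load fun v => { v with lab := none }

/-- The factor 4 comes from `peek`, which is a pop, a branch, a push that restores the symbol, and
an update of the state. -/
theorem stmtC_run (q : Turing.TM2.Stmt (fun _ : K => Γ) Λ σ) (v : Ctl Λ σ Γ) (S : K → List Γ)
    (e : E → List Γ) :
    ∃ r, Run O (stmtC bit q) (v, Sum.elim S e) (4 * q.size)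
      ({ v with lab := (Turing.TM2.stepAux q v.var S).l, var := (Turing.TM2.stepAux q v.var S).var,
                reg := r }, Sum.elim (Turing.TM2.stepAux q v.var S).stk e) := by
  induction q generalizing v S with
  | push k f q ih =>
    obtain ⟨r, h⟩ := ih v (Function.update S k (f v.var :: S k))
    refine ⟨r, ?_⟩
    have h1 := Exec.push (O := O) (P := fun _ => True) (k := Sum.inl k)
      (f := fun v : Ctl Λ σ Γ => f v.var) (v := v) (S := Sum.elim S e) trivial trivial
    rw [Sum.update_elim_inl] at h1
    exact (h1.seq h).weaken (by simp [Turing.TM2.Stmt.size]; omega)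
  | peek k f q ih =>
    obtain ⟨r, h⟩ := ih { v with var := f v.var (S k).head?, reg := (S k).head? } S
    refine ⟨r, ?_⟩
    have h1 := popR_run (O := O) (Sum.inl k) v (Sum.elim S e)
    have h2 : Run O (ite (fun v => v.reg.isSome) (pushR bit (Sum.inl k)) (.load id))
        ({ v with reg := (S k).head? }, Function.update (Sum.elim S e) (Sum.inl k) (S k).tail) 2
        ({ v with reg := (S k).head? }, Sum.elim S e) := by
      cases hk : S k with
      | nil =>
        have : Function.update (Sum.elim S e) (Sum.inl k) ([] : List Γ).tail = Sum.elim S e := by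
          funext j; grind [Function.update_apply]
        rw [this]
        exact ite_false trivial rfl (load_run _ _ _)
      | cons g l =>
        have : Function.update (Function.update (Sum.elim S e) (Sum.inl k) (g :: l).tail)
            (Sum.inl k) (g :: (Function.update (Sum.elim S e) (Sum.inl k) (g :: l).tail) (Sum.inl k))
            = Sum.elim S e := by
          funext j; grind [Function.update_apply]
        have h := pushR_run (O := O) bit (Sum.inl k) { v with reg := some g }
          (Function.update (Sum.elim S e) (Sum.inl k) (g :: l).tail) (g := g) rfl
        rw [this] at h
        exact ite_true trivial rfl h
    have h3 := load_run (O := O) (fun v : Ctl Λ σ Γ => { v with var := f v.var v.reg })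
      { v with reg := (S k).head? } (Sum.elim S e)
    exact (h1.seq (h2.seq (h3.seq h))).weaken (by simp [Turing.TM2.Stmt.size]; omega)
  | pop k f q ih =>
    obtain ⟨r, h⟩ := ih { v with var := f v.var (S k).head? } (Function.update S k (S k).tail)
    refine ⟨r, ?_⟩
    have h1 := Exec.pop (O := O) (P := fun _ => True) (k := Sum.inl k)
      (f := fun (v : Ctl Λ σ Γ) g => { v with var := f v.var g }) (v := v) (S := Sum.elim S e)
      trivial trivial
    rw [Sum.update_elim_inl] at h1
    exact (h1.seq h).weaken (by simp [Turing.TM2.Stmt.size]; omega)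
  | load f q ih =>
    obtain ⟨r, h⟩ := ih { v with var := f v.var } S
    exact ⟨r, ((load_run _ _ _).seq h).weaken (by simp [Turing.TM2.Stmt.size]; omega)⟩
  | branch f q₁ q₂ ih₁ ih₂ =>
    cases hf : f v.var with
    | true =>
      obtain ⟨r, h⟩ := ih₁ v S
      refine ⟨r, ?_⟩
      simp only [Turing.TM2.stepAux, hf, cond_true]
      have h' := ite_true (p := fun v : Ctl Λ σ Γ => f v.var) (b := stmtC bit q₂) trivial hf h
      exact h'.weaken (by rw [Turing.TM2.Stmt.size]; omega)
    | false =>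
      obtain ⟨r, h⟩ := ih₂ v S
      refine ⟨r, ?_⟩
      simp only [Turing.TM2.stepAux, hf, cond_false]
      have h' := ite_false (p := fun v : Ctl Λ σ Γ => f v.var) (a := stmtC bit q₁) trivial hf h
      exact h'.weaken (by rw [Turing.TM2.Stmt.size]; omega)
  | goto f => exact ⟨v.reg, (load_run _ _ _).weaken (by simp [Turing.TM2.Stmt.size])⟩
  | halt => exact ⟨v.reg, (load_run _ _ _).weaken (by simp [Turing.TM2.Stmt.size])⟩

open Classical in
/-- The program that simulates one step of a machine. -/
noncomputable def stepC (prog : Λ → Turing.TM2.Stmt (fun _ : K => Γ) Λ σ) (query : Option Λ)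
    (yes no : Λ) : Option Λ → Cmd (K ⊕ E) Γ (Ctl Λ σ Γ)
  | none => .load id
  | some l => if query = some l then .ask fun v b => { v with lab := some (if b then yes else no) }
      else stmtC bit (prog l)

/-- The program that simulates a machine. -/
noncomputable def simC [Finite Λ] (prog : Λ → Turing.TM2.Stmt (fun _ : K => Γ) Λ σ)
    (query : Option Λ) (yes no : Λ) : Cmd (K ⊕ E) Γ (Ctl Λ σ Γ) :=
  .wh (fun v => v.lab.isSome) (.switch inferInstance (fun v => v.lab) (stepC bit prog query yes no))

/-- The hypothesis `hP` lifts the simulation of a single step, a run of bounded length, to an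
execution under `P`. For time bounds all predicates are trivial. For space bounds `P₀` limits the
simulated configurations: such a run may be exponentially long, so its space cannot be read off from
its time. -/
theorem simC_exec [Finite Λ] {prog : Λ → Turing.TM2.Stmt (fun _ : K => Γ) Λ σ} {query : Option Λ}
    {yes no : Λ} {ans : (K → List Γ) → Bool} {C : ℕ} (hC : ∀ l, (prog l).size ≤ C)
    {e : E → List Γ} (hO : ∀ S, O (Sum.elim S e) = ans S) {P₀ : (K → List Γ) → Prop}
    {P : (K ⊕ E → List Γ) → Prop}
    (hP : ∀ S, P₀ S → ∀ c (v : Ctl Λ σ Γ) t s', t ≤ 4 * C + 5 →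
      Run O c (v, Sum.elim S e) t s' → Exec O P c (v, Sum.elim S e) t s')
    (hP₀ : ∀ S, P₀ S → P (Sum.elim S e)) {c c' : Turing.TM2.Cfg (fun _ : K => Γ) Λ σ} {t : ℕ}
    (h : Trace (oracleStep prog query yes no ans) (fun c => P₀ c.stk) c t c') (hc' : c'.l = none)
    (v : Ctl Λ σ Γ) (hl : v.lab = c.l) (hv : v.var = c.var) :
    ∃ r, Exec O P (simC bit prog query yes no) (v, Sum.elim c.stk e) ((4 * C + 7) * t + 1)
      ({ v with lab := none, var := c'.var, reg := r }, Sum.elim c'.stk e) := by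
  induction h generalizing v with
  | @refl c hc =>
    refine ⟨v.reg, ?_⟩
    rw [← hv, ← hc', ← hl]
    exact (Exec.whFalse (hP₀ _ hc) (by simp [hl, hc'])).weaken (by simp)
  | @head a b c t ha hab hbc ih =>
    obtain ⟨l, av, aS⟩ := a
    simp only at hl hv ha ⊢
    cases l with
    | none => simp [oracleStep] at hab
    | some l =>
      have key : ∃ r, Run O (stepC bit prog query yes no (some l)) (v, Sum.elim aS e) (4 * C + 4)
          ({ v with lab := b.l, var := b.var, reg := r }, Sum.elim b.stk e) := by
        simp only [oracleStep, Option.some.injEq] at hab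
        by_cases hq : query = some l
        · refine ⟨v.reg, ?_⟩
          simp only [stepC, hq, if_true] at hab ⊢
          subst hab
          have := Exec.ask (O := O) (P := fun _ => True)
            (f := fun (v : Ctl Λ σ Γ) b => { v with lab := some (if b then yes else no) })
            (v := v) (S := Sum.elim aS e) trivial
          rw [hO] at this
          subst hv
          exact this.weaken (show 4 ≤ 4 * C + 4 by omega)
        · simp only [stepC, hq, if_false] at hab ⊢
          subst hab hv
          obtain ⟨r, h⟩ := stmtC_run (O := O) bit (prog l) v aS e
          exact ⟨r, h.weaken (by have := hC l; omega)⟩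
      obtain ⟨r, key⟩ := key
      rw [← hl] at key
      have h1 := hP _ ha _ v _ _ (by omega) key
      obtain ⟨r', h2⟩ := ih hc' { v with lab := b.l, var := b.var, reg := r } rfl rfl
      refine ⟨r', ?_⟩
      refine (Exec.whTrue (hP₀ _ ha) (by simp [hl]) (.switch (hP₀ _ ha) h1) h2).weaken ?_
      rw [Nat.mul_succ]
      omega

end Cmd

theorem total_elim {K E Γ : Type} [Fintype K] [Fintype E] (S : K → List Γ) (e : E → List Γ) :
    total (Sum.elim S e) = total S + total e := by
  simp [total, Fintype.sum_sum_type]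

theorem length_le_total {K Γ : Type} [Fintype K] (S : K → List Γ) (k : K) :
    (S k).length ≤ total S :=
  Finset.single_le_sum (f := fun k => (S k).length) (fun _ _ => Nat.zero_le _) (Finset.mem_univ k)

/-! ### Preparing the stacks for a simulation. -/

namespace Cmd

/-- Execute a list of programs. -/
def seqAll {K Γ σ ι : Type} (c : ι → Cmd K Γ σ) : List ι → Cmd K Γ σ
  | [] => .load id
  | i :: l => .seq (c i) (seqAll c l)

variable {K E Γ Λ σ : Type} [DecidableEq K] [DecidableEq E] (bit : Bool ↪ Γ)
  {O : (K ⊕ E → List Γ) → Bool}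

/-- Empty all stacks of the simulated machine. -/
noncomputable def clearAll [Fintype K] : Cmd (K ⊕ E) Γ (Ctl Λ σ Γ) :=
  seqAll (fun k => clear (Sum.inl k)) Finset.univ.toList

theorem clearAll_run [Fintype K] (v : Ctl Λ σ Γ) (S : K → List Γ) (e : E → List Γ) :
    ∃ r, Run O clearAll (v, Sum.elim S e) (Fintype.card K * (3 * total S + 2) + 1)
      ({ v with reg := r }, Sum.elim (fun _ => []) e) := by
  have key : ∀ (l : List K) (v : Ctl Λ σ Γ) (S : K → List Γ) (L : ℕ), (∀ k, (S k).length ≤ L) →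
      ∃ r, Run O (seqAll (fun k => clear (Sum.inl k)) l) (v, Sum.elim S e)
        (l.length * (3 * L + 2) + 1)
        ({ v with reg := r }, Sum.elim (fun k => if k ∈ l then [] else S k) e) := by
    intro l
    induction l with
    | nil =>
      intro v S L _
      exact ⟨v.reg, (load_run _ _ _).conv rfl (by simp) (by simp)⟩
    | cons a l ih =>
      intro v S L hL
      have h1 := clear_run (O := O) (Sum.inl a) v (Sum.elim S e)
      rw [Sum.update_elim_inl] at h1
      obtain ⟨r, h2⟩ := ih { v with reg := none } (Function.update S a []) L (fun k => by
        have := hL k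
        simp only [Function.update_apply]
        split_ifs <;> simp [this])
      refine ⟨r, (h1.seq h2).conv rfl ?_ ?_⟩
      · congr 1
        funext k
        by_cases hk : k = a <;> simp [hk]
      · have := hL a
        simp only [Sum.elim_inl, List.length_cons, Nat.succ_mul]
        omega
  obtain ⟨r, h⟩ := key Finset.univ.toList v S (total S) (length_le_total S)
  exact ⟨r, h.conv rfl (by simp) (by simp)⟩

variable {m : ℕ}

/-- Copy the stacks `src i` to the input stacks of the simulated machine. -/
def loadArgs (inp : Fin m ↪ K) (src : Fin m → E) (T : E) : Cmd (K ⊕ E) Γ (Ctl Λ σ Γ) :=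
  seqAll (fun j => copy bit (Sum.inr (src j)) (Sum.inl (inp j)) (Sum.inr T)) (List.finRange m)

theorem loadArgs_run (inp : Fin m ↪ K) (src : Fin m → E) (T : E) (hT : ∀ j, src j ≠ T)
    (v : Ctl Λ σ Γ) (e : E → List Γ) (heT : e T = []) (x : Fin m → List Bool)
    (hx : ∀ j, e (src j) = (x j).map bit) (L : ℕ) (hL : ∀ j, (x j).length ≤ L) :
    ∃ r, Run O (loadArgs bit inp src T) (v, Sum.elim (fun _ => []) e) (m * (7 * L + 4) + 1)
      ({ v with reg := r }, Sum.elim (initStk bit inp x) e) := by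
  have key : ∀ (l : List (Fin m)), l.Nodup → ∀ (v : Ctl Λ σ Γ) (S : K → List Γ),
      (∀ j ∈ l, S (inp j) = []) → ∃ r S', (∀ j ∈ l, S' (inp j) = (x j).map bit) ∧
      (∀ k, (∀ j ∈ l, k ≠ inp j) → S' k = S k) ∧
      Run O (seqAll (fun j => copy bit (Sum.inr (src j)) (Sum.inl (inp j)) (Sum.inr T)) l)
        (v, Sum.elim S e) (l.length * (7 * L + 4) + 1)
        ({ v with reg := r }, Sum.elim S' e) := by
    intro l
    induction l with
    | nil =>
      intro _ v S _
      exact ⟨v.reg, S, by simp, by simp, (load_run _ _ _).conv rfl rfl (by simp)⟩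
    | cons a l ih =>
      intro hl v S hS
      rw [List.nodup_cons] at hl
      have h1 := copy_run (O := O) bit (a := Sum.inr (src a)) (b := Sum.inl (inp a))
        (c := Sum.inr T) (by simp) (by simpa using hT a) (by simp) v (Sum.elim S e) heT
      rw [Sum.update_elim_inl] at h1
      obtain ⟨r, S', h2, h3, h4⟩ := ih hl.2 { v with reg := none }
        (Function.update S (inp a) ((x a).map bit)) (fun j hj => by
          rw [Function.update_of_ne, hS j (by simp [hj])]
          intro h
          rw [inp.injective h] at hj
          exact hl.1 hj)
      refine ⟨r, S', ?_, ?_, (h1.seq (h4.conv ?_ rfl le_rfl)).weaken ?_⟩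
      · intro j hj
        rw [List.mem_cons] at hj
        rcases hj with rfl | hj
        · rw [h3]
          · simp
          · intro i hi h
            rw [inp.injective h] at hl
            exact hl.1 hi
        · exact h2 j hj
      · intro k hk
        rw [h3 k (fun j hj => hk j (by simp [hj])), Function.update_of_ne (hk a (by simp))]
      · rw [Sum.elim_inr, Sum.elim_inl, hx, hS a (by simp), List.append_nil]
      · have := hL a
        simp only [Sum.elim_inr, hx, List.length_map, List.length_cons, Nat.succ_mul]
        omega
  obtain ⟨r, S', h1, h2, h3⟩ := key _ (List.nodup_finRange m) v (fun _ => []) (by simp)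
  refine ⟨r, h3.conv rfl ?_ (by simp)⟩
  congr 1
  funext k
  unfold initStk
  by_cases hk : ∃ j, inp j = k
  · obtain ⟨j, rfl⟩ := hk
    rw [inp.injective.extend_apply, h1 j (by simp)]
  · rw [Function.extend_apply' _ _ _ hk, h2]
    intro j _ h
    exact hk ⟨j, h.symm⟩

end Cmd

/-! ### Quantifiers in polynomial space -/

/-- The stacks of the machine for a quantifier: the inputs, the current string, the unary bound for
its length, and two auxiliary stacks. -/
inductive QuantStack (n : ℕ)
  | arg (i : Fin (n + 1))
  | cur
  | fuel
  | aux
  | tmp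
  deriving DecidableEq, Fintype

namespace QuantStack

variable {n : ℕ} {Γ : Type}

/-- The contents of the stacks. -/
def contents (u : Fin (n + 1) → List Γ) (x f : List Γ) : QuantStack n → List Γ
  | arg i => u i
  | cur => x
  | fuel => f
  | aux => []
  | tmp => []

/-- The inputs of the simulated machine. -/
def source : Fin (n + 2) → QuantStack n := Fin.snoc (α := fun _ => QuantStack n) arg cur

/-- The input stacks. -/
def input (K : Type) : Fin (n + 1) ↪ K ⊕ QuantStack n :=
  ⟨fun i => Sum.inr (arg i), fun i j h => by simpa using h⟩

theorem initStk_input {K : Type} [DecidableEq K] (bit : Bool ↪ Γ) (u : Fin (n + 1) → List Bool) :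
    Cmd.initStk bit (input K) u =
      Sum.elim (fun _ => []) (contents (fun i => (u i).map bit) [] []) := by
  funext j
  unfold Cmd.initStk
  by_cases hj : ∃ i, input K i = j
  · obtain ⟨i, rfl⟩ := hj
    rw [(input K).injective.extend_apply]
    rfl
  · rw [Function.extend_apply' _ _ _ hj]
    rcases j with j | j
    · rfl
    · cases j with
      | arg i => exact absurd ⟨i, rfl⟩ hj
      | _ => rfl

theorem source_ne (j : Fin (n + 2)) : source j ≠ (tmp : QuantStack n) := by
  refine Fin.lastCases ?_ (fun i => ?_) j <;> simp [source]

theorem total_contents (u : Fin (n + 1) → List Γ) (x f : List Γ) :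
    total (contents u x f) = ∑ i, (u i).length + x.length + f.length := by
  let φ : (Fin (n + 1) ⊕ Fin 4) ≃ QuantStack n :=
    { toFun := Sum.elim arg ![cur, fuel, aux, tmp]
      invFun := fun k => match k with
        | arg i => Sum.inl i
        | cur => Sum.inr 0
        | fuel => Sum.inr 1
        | aux => Sum.inr 2
        | tmp => Sum.inr 3
      left_inv := by rintro (i | i); · rfl
                     · fin_cases i <;> rfl
      right_inv := by rintro (i | _) <;> rfl }
  rw [total, ← φ.sum_comp, Fintype.sum_sum_type, Fin.sum_univ_four]
  simp [φ, contents, add_assoc]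

end QuantStack

namespace Cmd

open QuantStack

variable {n : ℕ} (M : OracleMachine (n + 2))

/-- Simulate the machine `M` on the current string. -/
noncomputable def quantRun : Cmd (M.K ⊕ QuantStack n) M.Γ (Ctl M.Λ M.σ M.Γ) :=
  .seq clearAll (.seq (loadArgs M.bit M.inp source tmp)
    (.load fun v => { v with lab := some M.start, var := M.init }))

/-- The body of the loop of `quantC`. -/
noncomputable def quantBody : Cmd (M.K ⊕ QuantStack n) M.Γ (Ctl M.Λ M.σ M.Γ) :=
  .seq (quantRun M) (.seq (simC M.bit M.prog (some M.query) M.yes M.no)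
    (.seq (.load fun v => { v with res := M.accept v.var })
      (incr M.bit (Sum.inr cur) (Sum.inr tmp) (Sum.inr fuel))))

/-- The loop of `quantC`. -/
noncomputable def quantLoop : Cmd (M.K ⊕ QuantStack n) M.Γ (Ctl M.Λ M.σ M.Γ) :=
  .wh (fun v => v.ok && !v.res) (quantBody M)

/-- Search for a string of bounded length such that the machine `M` accepts if it is given this
string as its last input. -/
noncomputable def quantC (l : List ℕ) : Cmd (M.K ⊕ QuantStack n) M.Γ (Ctl M.Λ M.σ M.Γ) :=
  .seq (poly M.bit (Sum.inr (arg 0)) (Sum.inr fuel) (Sum.inr aux) (Sum.inr tmp) l) (quantLoop M)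

open Classical in
-- The simulation stays within the space of `M`, up to the work for one step. Loading the arguments
-- before it and counting after it take polynomial time, so `Exec.space` bounds their space. The
-- stacks `S` are the remains of the previous round, of which only the size is known.
theorem quantBody_exec {A : Set (List Bool)} {R : (Fin (n + 2) → List Bool) → Prop} {q : ℕ → ℕ}
    (hM : M.DecidesInSpace (M.stepWith A) R q) (hq : Monotone q) {C : ℕ}
    (hC : ∀ l, (M.prog l).size ≤ C) (u : Fin (n + 1) → List Bool) (x : List Bool) (f : List M.Γ)
    (N : ℕ) (hN : ∑ i, (u i).length + x.length + f.length ≤ N) (W : ℕ)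
    (hW : q N + N + Fintype.card M.K * (3 * q N + 2) + (n + 2) * (7 * N + 4) + 6 * N + 4 * C + 20 ≤ W)
    (v : Ctl M.Λ M.σ M.Γ) (S : M.K → List M.Γ) (hS : total S ≤ q N) :
    ∃ t v' S' x' f', total S' ≤ q N ∧ x'.length + f'.length = x.length + f.length ∧
      ((nextStr x).length ≤ x.length + f.length → x' = nextStr x) ∧
      v'.ok = (v.ok && decide ((nextStr x).length ≤ x.length + f.length)) ∧
      (v'.res = true ↔ R (Fin.snoc u x)) ∧
      Exec (fun S => decide (∃ w ∈ A, S (Sum.inl M.qStack) = w.map M.bit)) (fun S => total S ≤ W)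
        (quantBody M) (v, Sum.elim S (contents (fun i => (u i).map M.bit) (x.map M.bit) f)) t
        (v', Sum.elim S' (contents (fun i => (u i).map M.bit) (x'.map M.bit) f')) := by
  set O : (M.K ⊕ QuantStack n → List M.Γ) → Bool :=
    fun S => decide (∃ w ∈ A, S (Sum.inl M.qStack) = w.map M.bit)
  set e := contents (fun i => (u i).map M.bit) (x.map M.bit) f with he
  have hte : total e ≤ N := by rw [he, total_contents]; simpa using hN
  let y : Fin (n + 2) → List Bool := Fin.snoc (α := fun _ => List Bool) u x
  have hsum : ∑ j, (y j).length = ∑ i, (u i).length + x.length := by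
    rw [Fin.sum_univ_castSucc]; simp [y]
  have hy : ∀ j, e (source j) = (y j).map M.bit := by
    intro j
    refine Fin.lastCases ?_ (fun i => ?_) j <;> simp [source, y, he, contents]
  have hyl : ∀ j, (y j).length ≤ N := by
    intro j
    have := Finset.single_le_sum (f := fun j => (y j).length) (fun _ _ => Nat.zero_le _)
      (Finset.mem_univ j)
    omega
  obtain ⟨r1, h1⟩ := clearAll_run (O := O) v S e
  obtain ⟨r2, h2⟩ := loadArgs_run (O := O) M.bit M.inp source tmp source_ne { v with reg := r1 } e
    (by simp [he, contents]) y hy N hyl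
  have h3 := load_run (O := O) (fun v : Ctl M.Λ M.σ M.Γ =>
    { v with lab := some M.start, var := M.init }) { v with reg := r2 }
    (Sum.elim (initStk M.bit M.inp y) e)
  have hpre : Run O (quantRun M) (v, Sum.elim S e)
      (Fintype.card M.K * (3 * q N + 2) + (n + 2) * (7 * N + 4) + 3)
      ({ v with lab := some M.start, var := M.init, reg := r2 },
        Sum.elim (initStk M.bit M.inp y) e) := by
    refine (h1.seq (h2.seq h3)).weaken ?_
    have := Nat.mul_le_mul_left (Fintype.card M.K) (show 3 * total S + 2 ≤ 3 * q N + 2 by omega)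
    omega
  have hpre' := (hpre.space (m := W) (by
    show total (Sum.elim S e) + _ ≤ _
    rw [total_elim]; omega)).1
  obtain ⟨⟨c', hc', hreach, hacc⟩, hspace⟩ := hM y
  have hqy : q (∑ j, (y j).length) ≤ q N := hq (by omega)
  obtain ⟨t, htr⟩ := Trace.of_reaches (P := fun c : M.Cfg => total c.stk ≤ q N) hreach
    (fun c hc => (hspace c hc).trans hqy)
  have hc'q : total c'.stk ≤ q N := htr.right
  rw [M.stepWith_eq] at htr
  obtain ⟨r4, h4⟩ := simC_exec (O := O) M.bit hC (e := e) (fun S => rfl)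
    (P₀ := fun S => total S ≤ q N) (P := fun S => total S ≤ W)
    (fun S hS c v t s' ht h => (h.space (m := W) (by
      show total (Sum.elim S e) + _ ≤ _
      rw [total_elim]; omega)).1)
    (fun S hS => by rw [total_elim]; omega) htr hc'
    { v with lab := some M.start, var := M.init, reg := r2 } rfl rfl
  have h5 := load_run (O := O) (fun v : Ctl M.Λ M.σ M.Γ => { v with res := M.accept v.var })
    { v with lab := none, var := c'.var, reg := r4 } (Sum.elim c'.stk e)
  obtain ⟨x', f', h6, h7, h8⟩ := incr_run (O := O) M.bit (X := Sum.inr cur) (T := Sum.inr tmp)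
    (F := Sum.inr fuel) (by simp) (by simp) (by simp) x
    { v with lab := none, var := c'.var, reg := r4, res := M.accept c'.var } (Sum.elim c'.stk e)
    (by simp [he, contents]) (by simp [he, contents])
  have hpost := ((h5.seq h8).space (m := W) (by
    show total (Sum.elim c'.stk e) + _ ≤ _
    rw [total_elim]; omega)).1
  have hef : (Sum.elim c'.stk e (Sum.inr fuel)).length = f.length := by simp [he, contents]
  rw [hef] at h6 h7
  refine ⟨_, _, c'.stk, x', f', hc'q, h6, h7, ?_, ?_, (hpre'.seq (h4.seq (hpost.conv rfl ?_ le_rfl)))⟩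
  · simp only [hef]
  · exact hacc
  · rw [Sum.update_elim_inr, Sum.update_elim_inr]
    congr 1
    funext k
    cases k <;> simp [he, contents]

open Classical in
-- The invariant is `hR`: all strings of smaller value have failed. The number `d` exceeds the
-- number of candidates left. The loop ends with a success, or with an overflow of the counter when
-- all strings of length at most `m` have been tried.
theorem quantLoop_exec {A : Set (List Bool)} {R : (Fin (n + 2) → List Bool) → Prop} {q : ℕ → ℕ}
    (hM : M.DecidesInSpace (M.stepWith A) R q) (hq : Monotone q) {C : ℕ}
    (hC : ∀ l, (M.prog l).size ≤ C) (u : Fin (n + 1) → List Bool) (m N : ℕ)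
    (hN : ∑ i, (u i).length + m ≤ N) (W : ℕ)
    (hW : q N + N + Fintype.card M.K * (3 * q N + 2) + (n + 2) * (7 * N + 4) + 6 * N + 4 * C + 20 ≤ W)
    (d i : ℕ) (hd : 2 ^ (m + 1) ≤ i + d) (x : List Bool) (f : List M.Γ) (hx : strVal x = i)
    (hxf : x.length + f.length = m)
    (hR : ∀ y, strVal y < i → ¬ R (Fin.snoc u y))
    (v : Ctl M.Λ M.σ M.Γ) (hok : v.ok = true) (hres : v.res = false) (S : M.K → List M.Γ)
    (hS : total S ≤ q N) :
    ∃ t s', Exec (fun S => decide (∃ w ∈ A, S (Sum.inl M.qStack) = w.map M.bit))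
      (fun S => total S ≤ W) (quantLoop M)
      (v, Sum.elim S (contents (fun i => (u i).map M.bit) (x.map M.bit) f)) t s' ∧
      (s'.1.res = true ↔ ∃ x : List Bool, x.length ≤ m ∧ R (Fin.snoc u x)) := by
  induction d generalizing i x f v S with
  | zero =>
    have := (length_le_iff_strVal x m).1 (by omega)
    omega
  | succ d ih =>
    have hWS : ∀ S' : M.K → List M.Γ, total S' ≤ q N → ∀ (x' : List Bool) (f' : List M.Γ),
        x'.length + f'.length = m →
        total (Sum.elim S' (contents (fun i => (u i).map M.bit) (x'.map M.bit) f')) ≤ W := by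
      intro S' hS' x' f' h
      rw [total_elim, total_contents]
      simp only [List.length_map]
      omega
    obtain ⟨t, v', S', x', f', h1, h2, h3, h4, h5, h6⟩ := quantBody_exec M hM hq hC u x f N
      (by omega) W hW v S hS
    rw [hxf] at h2 h3 h4
    rw [hok, Bool.true_and] at h4
    by_cases hRx : R (Fin.snoc u x)
    · have hv' : v'.res = true := h5.2 hRx
      refine ⟨_, _, .whTrue (hWS S hS x f hxf) (by simp [hok, hres]) h6
        (.whFalse (hWS S' h1 x' f' h2) (by simp [hv'])), ?_⟩
      simp only [hv', true_iff]
      exact ⟨x, by omega, hRx⟩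
    · have hv' : v'.res = false := by
        rw [← Bool.not_eq_true]; exact fun h => hRx (h5.1 h)
      have hR' : ∀ y, strVal y < i + 1 → ¬ R (Fin.snoc u y) := by
        intro y hy
        rcases Nat.lt_succ_iff_lt_or_eq.1 hy with hy | hy
        · exact hR y hy
        · rw [strVal_injective (hy.trans hx.symm)]; exact hRx
      have hnext : strVal (nextStr x) = i + 1 := by rw [strVal_nextStr, hx]
      by_cases hle : (nextStr x).length ≤ m
      · obtain ⟨t', s', h7, h8⟩ := ih (i + 1) (by omega) x' f' (by rw [h3 hle, hnext]) h2 hR'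
          v' (by simp [h4, hle]) hv' S' h1
        exact ⟨_, s', .whTrue (hWS S hS x f hxf) (by simp [hok, hres]) h6 h7, h8⟩
      · refine ⟨_, _, .whTrue (hWS S hS x f hxf) (by simp [hok, hres]) h6
          (.whFalse (hWS S' h1 x' f' h2) (by simp [h4, hle])), ?_⟩
        simp only [hv', Bool.false_eq_true, false_iff]
        rintro ⟨y, hy, hRy⟩
        rw [length_le_iff_strVal] at hle hy
        exact hR' y (by omega) hRy

end Cmd

/-- Polynomial space is closed under existential quantifiers over strings of polynomial length. -/
theorem PolySpaceRelWith.exists_snoc {A : Set (List Bool)} {n : ℕ}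
    {R : (Fin (n + 2) → List Bool) → Prop} (hR : PolySpaceRelWith A (n + 2) R)
    (p : Polynomial ℕ) : PolySpaceRelWith A (n + 1) fun u =>
      ∃ x : List Bool, x.length ≤ p.eval (u 0).length ∧ R (Fin.snoc u x) := by
  classical
  obtain ⟨M, q, hM⟩ := hR
  obtain ⟨C, hC⟩ := Turing.TM2.Stmt.exists_size_le M.prog
  obtain ⟨l, hl⟩ := Cmd.exists_hornerEval p
  -- `N k` bounds the arguments together with the quantified string. `B k` is the bound that
  -- `quantLoop_exec` needs for `N k`, enlarged by the space for computing the value of `p` in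
  -- unary.
  let N : ℕ → ℕ := fun k => k + p.eval k
  let B : ℕ → ℕ := fun k => q.eval (N k) + N k + Fintype.card M.K * (3 * q.eval (N k) + 2) +
    (n + 2) * (7 * N k + 4) + 6 * N k + 4 * C + 20 + (k + k + 1) + Cmd.polyTime k l
  have hNb : PolyBounded N := PolyBounded.id.add (.eval p)
  have hqb : PolyBounded fun k => q.eval (N k) := .comp_poly q hNb
  have hB : PolyBounded B :=
    ((((((((hqb.add hNb).add ((PolyBounded.const _).mul (((PolyBounded.const 3).mul hqb).add
      (.const 2)))).add ((PolyBounded.const _).mul (((PolyBounded.const 7).mul hNb).add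
      (.const 4)))).add ((PolyBounded.const 6).mul hNb)).add (.const _)).add (.const 20)).add
      ((PolyBounded.id.add .id).add (.const 1))).add (Cmd.polyBounded_polyTime l))
  refine Cmd.polySpaceRelWith (Cmd.quantC M l) M.bit (QuantStack.input M.K)
    (⟨none, M.init, none, none, true, false, false⟩) (fun v => v.res)
    (Sum.inl M.qStack) hB fun u => ?_
  set k := ∑ i, (u i).length with hk
  rw [QuantStack.initStk_input]
  have hu0 : (u 0).length ≤ k :=
    Finset.single_le_sum (f := fun i => (u i).length) (fun _ _ => Nat.zero_le _) (Finset.mem_univ 0)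
  obtain ⟨r, q', hr, h1⟩ := Cmd.poly_run
    (O := fun S => decide (∃ w ∈ A, S (Sum.inl M.qStack) = w.map M.bit)) M.bit
    (x := (Sum.inr (.arg 0) : M.K ⊕ QuantStack n)) (acc := Sum.inr .fuel) (acc' := Sum.inr .aux)
    (tmp := Sum.inr .tmp)
    (by simp) (by simp) (by simp) (by simp) (by simp) (by simp) l
    (⟨none, M.init, none, none, true, false, false⟩ : Ctl M.Λ M.σ M.Γ)
    (Sum.elim (fun _ => []) (QuantStack.contents (fun i => (u i).map M.bit) [] []))
    rfl rfl rfl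
  simp only [Sum.elim_inr, QuantStack.contents, List.length_map, hl] at hr h1
  have hp : p.eval (u 0).length ≤ p.eval k := p.eval_nat_mono hu0
  have ht : Cmd.polyTime (u 0).length l ≤ Cmd.polyTime k l := Cmd.polyTime_mono l hu0
  have h2 := (h1.space (m := B k) (by
    show total (Sum.elim _ _) + _ ≤ _
    rw [total_elim, QuantStack.total_contents]
    simp only [List.length_map, ← hk, total, List.length_nil, Finset.sum_const_zero]
    simp only [B, N]
    omega)).1
  obtain ⟨t, s', h3, h4⟩ := Cmd.quantLoop_exec M hM q.eval_nat_mono hC u (p.eval (u 0).length)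
    (N k) (by simp only [N, ← hk]; omega) (B k) (by simp only [B]; omega) (2 ^ (p.eval (u 0).length + 1)) 0
    (by omega) [] r rfl (by simp [hr]) (by simp)
    ⟨none, M.init, q', none, true, false, false⟩ rfl rfl (fun _ => []) (by simp [total])
  refine ⟨_, s', h2.seq (h3.conv ?_ rfl le_rfl), h4⟩
  rw [Sum.update_elim_inr]
  congr 1
  funext k
  cases k <;> simp [QuantStack.contents]

/-! ### The polynomial hierarchy is contained in polynomial space -/

theorem Machine.total_initCfg {n : ℕ} (M : Machine n) (x : Fin n → List Bool) :
    total (M.initCfg x).stk = ∑ i, (x i).length := by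
  classical
  have h0 : ∀ k ∉ Set.range M.inp, ((M.initCfg x).stk k).length = 0 := by
    intro k hk
    simp only [Machine.initCfg]
    rw [Function.extend_apply' _ _ _ hk]
    rfl
  have h1 : ∀ i, ((M.initCfg x).stk (M.inp i)).length = (x i).length := by
    intro i
    simp only [Machine.initCfg]
    rw [M.inp.injective.extend_apply]
    simp
  unfold total
  rw [← Finset.sum_subset (Finset.subset_univ (Finset.univ.map M.inp)), Finset.sum_map]
  · exact Finset.sum_congr rfl fun i _ => h1 i
  · intro k _ hk
    exact h0 k (by simpa using hk)

/-- A step adds at most `C` symbols, the maximal size of a statement, so the space is at most the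
input length plus `C` times the running time. -/
theorem PolyTimeRelWith.polySpaceRelWith {A : Set (List Bool)} {n : ℕ}
    {R : (Fin n → List Bool) → Prop} (h : PolyTimeRelWith A n R) : PolySpaceRelWith A n R := by
  obtain ⟨M, p, hM⟩ := h
  obtain ⟨C, hC⟩ := Turing.TM2.Stmt.exists_size_le M.prog
  refine ⟨M, Polynomial.X + Polynomial.C C * p, fun x => ?_⟩
  obtain ⟨c, hc, ⟨⟨⟨t, ht⟩, htp⟩⟩, hacc⟩ := hM x
  have tr := Trace.of_evalsTo t _ _ ht
  have key : ∀ {a b : M.Cfg} {t : ℕ}, Trace (M.stepWith A) (fun _ => True) a t b →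
      ∀ m, total a.stk + C * t ≤ m → Trace (M.stepWith A) (fun c => total c.stk ≤ m) a t b := by
    intro a b t h
    induction h with
    | refl _ => intro m hm; exact .refl (by omega)
    | @head a b c t _ hab _ ih =>
      intro m hm
      rw [Nat.mul_succ] at hm
      refine .head (by omega) hab (ih m ?_)
      have : total b.stk ≤ total a.stk + C := by
        rw [M.stepWith_eq] at hab
        obtain ⟨l, v, S⟩ := a
        cases l with
        | none => simp [oracleStep] at hab
        | some l =>
          simp only [oracleStep, Option.some.injEq] at hab
          subst hab
          split_ifs
          · exact Nat.le_add_right _ _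
          · exact Nat.le_add_right _ _
          · exact (total_stepAux_le _ _ _).trans (Nat.add_le_add_left (hC l) _)
      omega
  have tr' := key tr ((Polynomial.X + Polynomial.C C * p).eval (∑ i, (x i).length)) (by
    rw [M.total_initCfg]
    simp only [Polynomial.eval_add, Polynomial.eval_X, Polynomial.eval_mul, Polynomial.eval_C]
    gcongr)
  refine ⟨⟨c, hc, tr.reaches, hacc⟩, fun d hd => tr'.forall_reaches ?_ hd⟩
  obtain ⟨l, v, S⟩ := c
  simp only at hc
  subst hc
  simp [OracleMachine.stepWith, Machine.step, Turing.TM2.step]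

theorem PolySpaceRelWith.compl {A : Set (List Bool)} {n : ℕ}
    {R : (Fin n → List Bool) → Prop} (h : PolySpaceRelWith A n R) :
    PolySpaceRelWith A n fun x => ¬ R x := by
  obtain ⟨M, p, hM⟩ := h
  refine ⟨{ M with accept := fun v => !M.accept v }, p, fun x => ?_⟩
  obtain ⟨⟨c, hc, hr, hacc⟩, hs⟩ := hM x
  exact ⟨⟨c, hc, hr, by simp [← hacc]⟩, hs⟩

theorem PolySpaceRelWith.forall_snoc {A : Set (List Bool)} {n : ℕ}
    {R : (Fin (n + 2) → List Bool) → Prop} (hR : PolySpaceRelWith A (n + 2) R)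
    (p : Polynomial ℕ) : PolySpaceRelWith A (n + 1) fun u =>
      ∀ x : List Bool, x.length ≤ p.eval (u 0).length → R (Fin.snoc u x) := by
  have := (hR.compl.exists_snoc p).compl
  simpa using this

/-- The last quantifier of an alternating sequence of quantifiers of length `l + 1`. -/
def lastQuant (m : ℕ) (l : ℕ) (b : Bool) (Q : List Bool → Prop) : Prop :=
  if l.bodd = b then ∀ x : List Bool, x.length ≤ m → Q x else ∃ x : List Bool, x.length ≤ m ∧ Q x

/-- `AltQuant` unfolds from the outside, whereas a search eliminates the innermost quantifier, with
the outer variables as parameters. -/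
theorem altQuant_snoc (m l : ℕ) (b : Bool) (R : (Fin (l + 1) → List Bool) → Prop) :
    AltQuant m (l + 1) b R ↔
      AltQuant m l b (fun v => lastQuant m l b fun x => R (Fin.snoc v x)) := by
  induction l generalizing b with
  | zero =>
    have : ∀ x : List Bool, (Fin.cons x Fin.elim0 : Fin 1 → List Bool) = Fin.snoc Fin.elim0 x := by
      intro x; funext i; rw [Subsingleton.elim (α := Fin 1) i 0]; rfl
    cases b <;> simp [AltQuant, lastQuant, this]
  | succ l ih =>
    have hl : ∀ Q, lastQuant m (l + 1) b Q = lastQuant m l (!b) Q := by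
      intro Q; unfold lastQuant; cases b <;> cases h : l.bodd <;> simp [h]
    cases b with
    | true =>
      rw [AltQuant, AltQuant]
      simp only [ih, hl, Bool.not_true, Fin.cons_snoc_eq_snoc_cons]
    | false =>
      rw [AltQuant, AltQuant]
      simp only [ih, hl, Bool.not_false, Fin.cons_snoc_eq_snoc_cons]

/-- The quantifiers are absorbed into the relation one at a time, from the inside. The first
argument stays in place throughout, and all the bounds are measured by its length. -/
theorem PolySpaceRelWith.altQuant {A : Set (List Bool)} (p : Polynomial ℕ) (l : ℕ) (b : Bool)
    {R : (Fin (l + 1) → List Bool) → Prop} (hR : PolySpaceRelWith A (l + 1) R) :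
    PolySpaceRelWith A 1 fun u =>
      AltQuant (p.eval (u 0).length) l b (fun v => R (Fin.cons (u 0) v)) := by
  induction l with
  | zero =>
    have : ∀ u : Fin 1 → List Bool, (Fin.cons (u 0) Fin.elim0 : Fin 1 → List Bool) = u := by
      intro u; funext i; rw [Subsingleton.elim (α := Fin 1) i 0]; rfl
    simpa only [AltQuant, this] using hR
  | succ l ih =>
    have h : PolySpaceRelWith A (l + 1) fun u =>
        lastQuant (p.eval (u 0).length) l b fun x => R (Fin.snoc u x) := by
      unfold lastQuant
      split_ifs
      · exact hR.forall_snoc p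
      · exact hR.exists_snoc p
    have := ih h
    simp only [altQuant_snoc, Fin.cons_snoc_eq_snoc_cons]
    simpa only [Fin.cons_zero] using this

theorem PHWith_subset_PSPACEWith (A : Set (List Bool)) : PHWith A ⊆ PSPACEWith A := by
  rintro L ⟨l, R, p, hR, hL⟩
  have := hR.polySpaceRelWith.altQuant p l true
  simp only [← hL] at this
  exact this

/-! ### Simulation with a bound on space and time -/

namespace Cmd

/-! ### Executing a statement within a space budget. -/

section Fueled

variable {K E Γ Λ σ : Type} [DecidableEq K] [DecidableEq E] (bit : Bool ↪ Γ)
  {O : (K ⊕ E → List Γ) → Bool}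

/-- The program that executes a statement, where each push takes a symbol from the stack `F` and
each pop gives one back. If there is no symbol left, the flag `ok` is cleared. -/
def fueledC (F : E) : Turing.TM2.Stmt (fun _ : K => Γ) Λ σ → Cmd (K ⊕ E) Γ (Ctl Λ σ Γ)
  | .push k f q => .seq (.seq (popR (Sum.inr F)) (ite (fun v => v.reg.isSome)
      (.push (Sum.inl k) fun v => f v.var) (.load fun v => { v with ok := false }))) (fueledC F q)
  | .peek k f q => .seq (stmtC bit (.peek k f .halt)) (fueledC F q)
  | .pop k f q => .seq (.seq (popR (Sum.inl k)) (.seq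
      (ite (fun v => v.reg.isSome) (pushB bit (Sum.inr F) false) (.load id))
      (.load fun v => { v with var := f v.var v.reg }))) (fueledC F q)
  | .load f q => .seq (.load fun v => { v with var := f v.var }) (fueledC F q)
  | .branch f q₁ q₂ => ite (fun v => f v.var) (fueledC F q₁) (fueledC F q₂)
  | .goto f => .load fun v => { v with lab := some (f v.var) }
  | .halt => .load fun v => { v with lab := none }

/-- Symbols on the simulated stacks and free symbols on `F` have a constant sum, even after a
failure. The simulation is claimed to be faithful only if `ok` survives, and it does survive when
`F` can pay for every push in the statement. -/
theorem fueledC_run [Fintype K] (F : E) (q : Turing.TM2.Stmt (fun _ : K => Γ) Λ σ) (v : Ctl Λ σ Γ)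
    (S : K → List Γ) (e : E → List Γ) :
    ∃ v' S' f, Run O (fueledC bit F q) (v, Sum.elim S e) (8 * q.size)
        (v', Sum.elim S' (Function.update e F f)) ∧
      total S' + f.length = total S + (e F).length ∧
      (v'.ok = true → v.ok = true ∧ v'.lab = (Turing.TM2.stepAux q v.var S).l ∧
        v'.var = (Turing.TM2.stepAux q v.var S).var ∧ S' = (Turing.TM2.stepAux q v.var S).stk) ∧
      (v.ok = true → q.size ≤ (e F).length → v'.ok = true) := by
  induction q generalizing v S e with
  | push k f q ih =>
    cases hF : e F with
    | nil =>
      have h1 := (popR_run (O := O) (Sum.inr F) v (Sum.elim S e)).seq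
        (ite_false (p := fun v : Ctl Λ σ Γ => v.reg.isSome)
          (a := .push (Sum.inl k) fun v : Ctl Λ σ Γ => f v.var) trivial (by simp [hF])
          (load_run (fun v : Ctl Λ σ Γ => { v with ok := false }) _ _))
      have e1 : Function.update (Sum.elim S e) (Sum.inr F) (Sum.elim S e (Sum.inr F)).tail
          = Sum.elim S e := by
        funext j; grind [Function.update_apply]
      rw [e1] at h1
      obtain ⟨v', S', f', h2, h3, h4, h5⟩ := ih _ S e
      refine ⟨v', S', f', (h1.seq h2).weaken (by simp [Turing.TM2.Stmt.size]; omega), ?_, ?_, ?_⟩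
      · rw [h3, hF]
      · intro h
        exact absurd (h4 h).1 (by simp)
      · simp [Turing.TM2.Stmt.size]
    | cons g l =>
      have h1 := (popR_run (O := O) (Sum.inr F) v (Sum.elim S e)).seq
        (ite_true (p := fun v : Ctl Λ σ Γ => v.reg.isSome)
          (b := .load fun v : Ctl Λ σ Γ => { v with ok := false }) trivial (by simp [hF])
          (Exec.push (O := O) (P := fun _ => True) (k := Sum.inl k)
            (f := fun v : Ctl Λ σ Γ => f v.var) trivial trivial))
      have e1 : Function.update (Function.update (Sum.elim S e) (Sum.inr F)
          (Sum.elim S e (Sum.inr F)).tail) (Sum.inl k) (f v.var :: Function.update (Sum.elim S e)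
          (Sum.inr F) (Sum.elim S e (Sum.inr F)).tail (Sum.inl k)) =
          Sum.elim (Function.update S k (f v.var :: S k)) (Function.update e F l) := by
        rw [Sum.update_elim_inr, Sum.elim_inr, hF, Sum.elim_inl, Sum.update_elim_inl, List.tail_cons]
      simp only [e1] at h1
      obtain ⟨v', S', f', h2, h3, h4, h5⟩ := ih _ (Function.update S k (f v.var :: S k))
        (Function.update e F l)
      refine ⟨v', S', f', (h1.seq h2).conv rfl (by rw [Function.update_idem])
        (by simp [Turing.TM2.Stmt.size]; omega), ?_, ?_, ?_⟩
      · rw [h3, total_push]; simp; omega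
      · intro h
        exact h4 h
      · intro h h'
        exact h5 h (by simp [Turing.TM2.Stmt.size] at h' ⊢; omega)
  | peek k f q ih =>
    -- The auxiliary `.halt` sets the simulated label to `none`; this is harmless because the rest
    -- of the statement ends by setting the label anew.
    obtain ⟨r, h1⟩ := stmtC_run (O := O) bit (.peek k f .halt) v S e
    obtain ⟨v', S', f', h2, h3, h4, h5⟩ := ih _ S e
    refine ⟨v', S', f', (h1.seq h2).weaken (by simp [Turing.TM2.Stmt.size]; omega), h3, ?_, ?_⟩
    · exact h4
    · intro h h'
      exact h5 h (by simp [Turing.TM2.Stmt.size] at h' ⊢; omega)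
  | pop k f q ih =>
    have h0 : ∃ f', f'.length + (S k).tail.length = (e F).length + (S k).length ∧
        Run O (ite (fun v : Ctl Λ σ Γ => v.reg.isSome) (pushB bit (Sum.inr F) false) (.load id))
          ({ v with reg := (S k).head? }, Sum.elim (Function.update S k (S k).tail) e) 2
          ({ v with reg := (S k).head? }, Sum.elim (Function.update S k (S k).tail)
            (Function.update e F f')) := by
      cases hk : S k with
      | nil => exact ⟨e F, by simp, (ite_false trivial rfl (load_run _ _ _)).conv rfl
          (by rw [Function.update_eq_self]) le_rfl⟩
      | cons g l =>
        refine ⟨bit false :: e F, by simp; omega, (ite_true trivial rfl (pushB_run _ _ _ _ _)).conv rfl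
          ?_ le_rfl⟩
        rw [Sum.update_elim_inr, Sum.elim_inr]
    obtain ⟨f', hf', h0⟩ := h0
    have h1 := popR_run (O := O) (Sum.inl k) v (Sum.elim S e)
    rw [Sum.update_elim_inl] at h1
    obtain ⟨v', S', f'', h2, h3, h4, h5⟩ := ih { v with var := f v.var (S k).head?, reg := (S k).head? }
      (Function.update S k (S k).tail) (Function.update e F f')
    refine ⟨v', S', f'', ((h1.seq (h0.seq (load_run _ _ _))).seq h2).conv rfl
      (by rw [Function.update_idem]) (by simp [Turing.TM2.Stmt.size]; omega), ?_, h4, ?_⟩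
    · have := total_update_add S k (S k).tail
      simp at h3 ⊢
      simp at hf'
      simp at this
      omega
    · intro h h'
      simp at hf'
      exact h5 h (by simp [Turing.TM2.Stmt.size] at h' ⊢; omega)
  | load f q ih =>
    obtain ⟨v', S', f', h2, h3, h4, h5⟩ := ih { v with var := f v.var } S e
    refine ⟨v', S', f', ((load_run _ _ _).seq h2).weaken (by simp [Turing.TM2.Stmt.size]; omega),
      h3, h4, ?_⟩
    intro h h'
    exact h5 h (by simp [Turing.TM2.Stmt.size] at h' ⊢; omega)
  | branch f q₁ q₂ ih₁ ih₂ =>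
    cases hf : f v.var with
    | true =>
      obtain ⟨v', S', f', h2, h3, h4, h5⟩ := ih₁ v S e
      have h2' := ite_true (p := fun v : Ctl Λ σ Γ => f v.var) (b := fueledC bit F q₂) trivial hf h2
      simp only [Turing.TM2.stepAux, hf, cond_true]
      refine ⟨v', S', f', h2'.weaken (by rw [Turing.TM2.Stmt.size]; omega), h3, h4, ?_⟩
      intro h h'
      exact h5 h (by simp [Turing.TM2.Stmt.size] at h' ⊢; omega)
    | false =>
      obtain ⟨v', S', f', h2, h3, h4, h5⟩ := ih₂ v S e
      have h2' := ite_false (p := fun v : Ctl Λ σ Γ => f v.var) (a := fueledC bit F q₁) trivial hf h2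
      simp only [Turing.TM2.stepAux, hf, cond_false]
      refine ⟨v', S', f', h2'.weaken (by rw [Turing.TM2.Stmt.size]; omega), h3, h4, ?_⟩
      intro h h'
      exact h5 h (by simp [Turing.TM2.Stmt.size] at h' ⊢; omega)
  | goto f =>
    exact ⟨_, S, e F, (load_run _ _ _).conv rfl (by simp) (by simp [Turing.TM2.Stmt.size]), rfl,
      fun h => ⟨h, rfl, rfl, rfl⟩, fun h _ => h⟩
  | halt =>
    exact ⟨_, S, e F, (load_run _ _ _).conv rfl (by simp) (by simp [Turing.TM2.Stmt.size]), rfl,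
      fun h => ⟨h, rfl, rfl, rfl⟩, fun h _ => h⟩

end Fueled

end Cmd

/-! ### Oracle machines with a list of strings as oracle. -/

/-- The stacks of the machine that simulates an oracle machine within bounded space and time: the
input, which contains the blocks of the oracle; unary stores of space and of bits for the clock;
the clock; and auxiliary stacks. -/
inductive BoundedStack
  | tape
  | space
  | clock
  | bits
  | tape'
  | query'
  | word
  | word'
  | tmp
  deriving DecidableEq

namespace BoundedStack

instance : Fintype BoundedStack where
  elems := {tape, space, clock, bits, tape', query', word, word', tmp}
  complete k := by cases k <;> decide

/-- The contents of the stacks. -/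
def contents {Γ : Type} (z f x g : List Γ) : BoundedStack → List Γ
  | tape => z
  | space => f
  | clock => x
  | bits => g
  | _ => []

theorem total_contents {Γ : Type} (z f x g : List Γ) :
    total (contents z f x g) = z.length + f.length + x.length + g.length := by
  let φ : Fin 9 ≃ BoundedStack :=
    { toFun := ![tape, space, clock, bits, tape', query', word, word', tmp]
      invFun := fun k => match k with
        | tape => 0
        | space => 1
        | clock => 2
        | bits => 3
        | tape' => 4
        | query' => 5
        | word => 6
        | word' => 7
        | tmp => 8
      left_inv := fun i => by fin_cases i <;> rfl
      right_inv := fun k => by cases k <;> rfl }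
  rw [total, ← φ.sum_comp, Fin.sum_univ_castSucc, Fin.sum_univ_eight]
  simp [φ, contents]

end BoundedStack

namespace Cmd

open BoundedStack

variable (M : OracleMachine 1)

open Classical in
/-- One step of the simulation. -/
noncomputable def boundedStep : Option M.Λ → Cmd (M.K ⊕ BoundedStack) M.Γ (Ctl M.Λ M.σ M.Γ)
  | none => .load id
  | some l => if l = M.query then .seq
      (lookup M.bit (Sum.inr tape) (Sum.inl M.qStack) (Sum.inr tape') (Sum.inr query')
        (Sum.inr word) (Sum.inr word') (Sum.inr tmp))
      (.load fun v => { v with lab := some (if v.res then M.yes else M.no) })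
    else fueledC M.bit space (M.prog l)

/-- The loop of the simulation. -/
noncomputable def boundedLoop : Cmd (M.K ⊕ BoundedStack) M.Γ (Ctl M.Λ M.σ M.Γ) :=
  .wh (fun v => v.lab.isSome && v.ok)
    (.seq (.switch inferInstance (fun v => v.lab) (boundedStep M))
      (incr M.bit (Sum.inr clock) (Sum.inr tmp) (Sum.inr bits)))

/-- Read an input and bounds for space and time, and simulate the machine `M` on the input within
these bounds, where the other blocks replace the oracle. -/
noncomputable def boundedC : Cmd (M.K ⊕ BoundedStack) M.Γ (Ctl M.Λ M.σ M.Γ) :=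
  .seq (.seq (readB M.bit (Sum.inr tape) (Sum.inr word))
    (.seq (move M.bit (Sum.inr word) (Sum.inl (M.inp 0)))
    (.seq (readB M.bit (Sum.inr tape) (Sum.inr space))
      (.seq (copy M.bit (Sum.inr space) (Sum.inr bits) (Sum.inr tmp))
        (.load fun v => { v with lab := some M.start, var := M.init, ok := true })))))
    (boundedLoop M)

/-- A machine accepts when it halts in time, without lack of space, in an accepting state. -/
def boundedAccept (v : Ctl M.Λ M.σ M.Γ) : Bool := v.ok && v.lab.isNone && M.accept v.var

open Classical in
/-- The step function of `M` with a finite oracle. -/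
noncomputable abbrev listStep (r : List (List Bool)) : M.Cfg → Option M.Cfg :=
  M.stepWith {w | w ∈ r}

variable {C : ℕ}

/-- The simulating program never queries, so its own oracle is constantly `false`; a query of `M` is
answered by a search in the blocks of `r`. -/
theorem boundedStep_run (hC : ∀ l, (M.prog l).size ≤ C) (r : List Bool) (f x g : List M.Γ) (N : ℕ)
    (hr : r.length ≤ N) (c : M.Cfg) (hc : total c.stk ≤ N) (l : M.Λ) (hl : c.l = some l)
    (v : Ctl M.Λ M.σ M.Γ) (hvl : v.lab = c.l) (hv : v.var = c.var) (hok : v.ok = true) :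
    ∃ v' S' f' c', listStep M (blocks r) c = some c' ∧
      Run (fun _ => false) (boundedStep M (some l))
        (v, Sum.elim c.stk (contents (r.map M.bit) f x g))
        (N * (40 * N + 30) + 20 * N + 11 + 8 * C)
        (v', Sum.elim S' (contents (r.map M.bit) f' x g)) ∧
      total S' + f'.length = total c.stk + f.length ∧
      (v'.ok = true → v'.lab = c'.l ∧ v'.var = c'.var ∧ S' = c'.stk) ∧
      (C ≤ f.length → v'.ok = true) := by
  classical
  obtain ⟨cl, cv, cS⟩ := c
  simp only at hl hvl hv hc ⊢
  subst hl hv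
  rw [listStep, M.stepWith_eq]
  by_cases hq : l = M.query
  · subst hq
    obtain ⟨q, fl, h⟩ := lookup_run (O := fun _ => false) M.bit (Z := Sum.inr tape)
      (Q := Sum.inl M.qStack) (Z' := Sum.inr tape') (Q' := Sum.inr query') (D := Sum.inr word)
      (D' := Sum.inr word') (T := Sum.inr tmp) (by simp) r v
      (Sum.elim cS (contents (r.map M.bit) f x g)) rfl rfl rfl rfl rfl rfl
    have h' := h.seq (load_run (O := fun _ => false)
      (fun v : Ctl M.Λ M.σ M.Γ => { v with lab := some (if v.res then M.yes else M.no) }) _ _)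
    rw [boundedStep, if_pos rfl]
    refine ⟨_, cS, f, _, rfl, h'.weaken ?_, rfl, ?_, ?_⟩
    · have h1 : (cS M.qStack).length ≤ N := (length_le_total _ _).trans hc
      have h2 : r.length * (20 * r.length + 20 * (cS M.qStack).length + 30) ≤
          N * (40 * N + 30) := Nat.mul_le_mul hr (by omega)
      simp only [Sum.elim_inl]
      omega
    · intro _
      rw [if_pos rfl]
      refine ⟨?_, rfl, rfl⟩
      simp only [Sum.elim_inl, decide_eq_true_eq, Set.mem_ofPred_eq]
      congr 2
      exact propext decide_eq_true_iff
    · intro _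
      exact hok
  · obtain ⟨v', S', f', h1, h2, h3, h4⟩ := fueledC_run (O := fun _ => false) M.bit space (M.prog l) v
      cS (contents (r.map M.bit) f x g)
    refine ⟨v', S', f', _, rfl, ?_, h2, ?_, ?_⟩
    · simp only [boundedStep, hq, if_false]
      refine h1.conv rfl ?_ ?_
      · congr 1
        funext k
        cases k <;> simp [contents]
      · have := hC l
        omega
    · intro h
      simpa [Ne.symm hq] using (h3 h).2
    · intro h
      exact h4 hok ((hC l).trans h)

end Cmd

theorem OracleMachine.stepWith_eq_none {n : ℕ} (M : OracleMachine n) (A : Set (List Bool))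
    {c : M.Cfg} (h : c.l = none) : M.stepWith A c = none := by
  obtain ⟨l, v, S⟩ := c
  simp only at h
  subst h
  rw [M.stepWith_eq]
  rfl

namespace Cmd

open BoundedStack

variable (M : OracleMachine 1) {C : ℕ}

/-- Soundness needs no reserve: acceptance means that `ok` was never cleared, so the simulation was
faithful and stayed within `L`. For completeness the run must leave `C` symbols free, because a
statement may push before it pops, and the clock, started at `i`, must not overflow within `t'`
steps. Once more `d` bounds the number of rounds left. -/
theorem boundedLoop_exec (hC : ∀ l, (M.prog l).size ≤ C) (r : List Bool) (m L N W : ℕ)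
    (hr : r.length ≤ N) (hL : L ≤ N) (hm : m ≤ N)
    (hW : N * (40 * N + 30) + 30 * N + 8 * C + 30 ≤ W)
    (d i : ℕ) (hd : 2 ^ (m + 1) ≤ i + d) (x : List Bool) (f g : List M.Γ) (hx : strVal x = i)
    (hxg : x.length + g.length = m) (c : M.Cfg) (hcf : total c.stk + f.length = L)
    (v : Ctl M.Λ M.σ M.Γ) (hvl : v.lab = c.l) (hv : v.var = c.var) (hok : v.ok = true) :
    ∃ t s', Exec (fun _ => false) (fun S => total S ≤ W) (boundedLoop M)
        (v, Sum.elim c.stk (contents (r.map M.bit) f (x.map M.bit) g)) t s' ∧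
      (boundedAccept M s'.1 = true → ∃ t' c', Trace (listStep M (blocks r))
        (fun c => total c.stk ≤ L) c t' c' ∧ c'.l = none ∧ M.accept c'.var = true) ∧
      (∀ t' c', Trace (listStep M (blocks r)) (fun c => total c.stk + C ≤ L) c t' c' →
        c'.l = none → M.accept c'.var = true → i + t' + 2 ≤ 2 ^ (m + 1) →
        boundedAccept M s'.1 = true) := by
  induction d generalizing i x f g c v with
  | zero =>
    have := (length_le_iff_strVal x m).1 (by omega)
    omega
  | succ d ih =>
    have hWS : ∀ (S' : M.K → List M.Γ) (f' : List M.Γ), total S' + f'.length = L →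
        ∀ (x' : List Bool) (g' : List M.Γ), x'.length + g'.length = m →
        total (Sum.elim S' (contents (r.map M.bit) f' (x'.map M.bit) g')) ≤ 3 * N := by
      intro S' f' h x' g' h'
      rw [total_elim, total_contents]
      simp only [List.length_map]
      omega
    cases hl : c.l with
    | none =>
      refine ⟨1, _, .whFalse ((hWS _ _ hcf _ _ hxg).trans (by omega)) (by simp [hvl, hl]), ?_, ?_⟩
      · intro h
        simp only [boundedAccept, Bool.and_eq_true] at h
        exact ⟨0, c, .refl (by omega), hl, by rw [← hv]; exact h.2⟩
      · intro t' c' htr hc' hacc _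
        cases htr with
        | refl _ => simp [boundedAccept, hok, hvl, hl, hv, hacc]
        | head _ h _ => rw [listStep, M.stepWith_eq_none _ hl] at h; cases h
    | some l =>
      obtain ⟨v', S', f', c', hstep, h1, h2, h3, h4⟩ := boundedStep_run M hC r f (x.map M.bit) g N hr
        c (by omega) l hl v hvl hv hok
      obtain ⟨x', g', h5, h6, h7⟩ := incr_run (O := fun _ => false) M.bit (X := Sum.inr clock)
        (T := Sum.inr tmp) (F := Sum.inr bits) (by simp) (by simp) (by simp) x v'
        (Sum.elim S' (contents (r.map M.bit) f' (x.map M.bit) g)) rfl rfl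
      rw [Sum.elim_inr, contents, hxg] at h5 h6 h7
      have hS' : Function.update (Function.update (Sum.elim S' (contents (r.map M.bit) f'
          (x.map M.bit) g)) (Sum.inr clock) (x'.map M.bit)) (Sum.inr bits) g' =
          Sum.elim S' (contents (r.map M.bit) f' (x'.map M.bit) g') := by
        rw [Sum.update_elim_inr, Sum.update_elim_inr]
        congr 1
        funext k
        cases k <;> simp [contents]
      rw [hS'] at h7
      rw [← hl, ← hvl] at h1
      have hbody := ((Exec.switch (hι := inferInstance) (f := fun v : Ctl M.Λ M.σ M.Γ => v.lab)
        (c := boundedStep M) trivial h1).seq h7).space (m := W) (by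
          have := hWS _ _ hcf x g hxg
          simp only
          omega)
      have hp : (v.lab.isSome && v.ok) = true := by simp [hvl, hl, hok]
      have hWc := (hWS _ _ hcf x g hxg).trans (show 3 * N ≤ W by omega)
      have hWc' := (hWS S' f' (h2.trans hcf) x' g' h5).trans (show 3 * N ≤ W by omega)
      -- Since `total c.stk + f.length = L`, the reserve in the assumed run gives `C ≤ f.length`, so
      -- the next statement does not run out of symbols.
      have hno : ∀ t' c'', Trace (listStep M (blocks r)) (fun c => total c.stk + C ≤ L) c t' c'' →
          c''.l = none → ∃ u, t' = u + 1 ∧ C ≤ f.length ∧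
            Trace (listStep M (blocks r)) (fun c => total c.stk + C ≤ L) c' u c'' := by
        intro t' c'' htr hc''
        cases htr with
        | refl _ => rw [hl] at hc''; cases hc''
        | head hP h htr =>
          rw [hstep] at h
          cases h
          exact ⟨_, rfl, by omega, htr⟩
      by_cases hgo : v'.ok = true ∧ (nextStr x).length ≤ m
      · obtain ⟨hok', hlen⟩ := hgo
        obtain ⟨e1, e2, e3⟩ := h3 hok'
        subst e3
        obtain ⟨t, s', h8, h9, h10⟩ := ih (i + 1) (by omega) x' f' g'
          (by rw [h6 hlen, strVal_nextStr, hx]) h5 c' (h2.trans hcf)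
          { v' with reg := none, ok := v'.ok && decide ((nextStr x).length ≤ m) } e1 e2
          (by simp [hok', hlen])
        refine ⟨_, s', .whTrue hWc hp hbody.1 h8, ?_, ?_⟩
        · intro h
          obtain ⟨t', c'', htr, hc''⟩ := h9 h
          exact ⟨_, c'', .head (by omega) hstep htr, hc''⟩
        · intro t' c'' htr hc'' hacc ht'
          obtain ⟨u, rfl, _, htr⟩ := hno t' c'' htr hc''
          exact h10 u c'' htr hc'' hacc (by omega)
      · have hf : (v'.ok && decide ((nextStr x).length ≤ m)) = false := by
          rw [← Bool.not_eq_true]; simpa using hgo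
        refine ⟨_, _, .whTrue hWc hp hbody.1 (.whFalse hWc' (by simp [hf])), ?_, ?_⟩
        · simp [boundedAccept, hf]
        · intro t' c'' htr hc'' hacc ht'
          obtain ⟨u, rfl, hCf, htr⟩ := hno t' c'' htr hc''
          refine absurd ⟨h4 hCf, ?_⟩ hgo
          rw [length_le_iff_strVal, strVal_nextStr]
          omega

/-- The length of the block `b` is used twice: as a store of space in addition to the `y.length`
symbols that the input occupies, and as the number of bits of the clock. -/
theorem boundedC_exec (hC : ∀ l, (M.prog l).size ≤ C) (z : List Bool) (W : ℕ)
    (hW : z.length * (40 * z.length + 30) + 30 * z.length + 8 * C + 30 ≤ W)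
    (v : Ctl M.Λ M.σ M.Γ) (y b r : List Bool) (hy : readBlock z = (y, (readBlock z).2))
    (hb : readBlock (readBlock z).2 = (b, r)) :
    ∃ t s', Exec (fun _ => false) (fun S => total S ≤ W) (boundedC M)
        (v, Sum.elim (fun _ => []) (contents (z.map M.bit) [] [] [])) t s' ∧
      (boundedAccept M s'.1 = true → ∃ t' c', Trace (listStep M (blocks r))
        (fun c => total c.stk ≤ y.length + b.length) (M.initCfg fun _ => y) t' c' ∧
        c'.l = none ∧ M.accept c'.var = true) ∧
      (∀ t' c', Trace (listStep M (blocks r)) (fun c => total c.stk + C ≤ y.length + b.length)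
        (M.initCfg fun _ => y) t' c' → c'.l = none → M.accept c'.var = true →
        t' + 2 ≤ 2 ^ (b.length + 1) → boundedAccept M s'.1 = true) := by
  have hlen1 := length_readBlock z
  have hlen2 := length_readBlock (readBlock z).2
  have hy1 : (readBlock z).1 = y := by rw [hy]
  rw [hb] at hlen2
  rw [hy1] at hlen1
  simp only at hlen2
  obtain ⟨q1, h1⟩ := readB_run (O := fun _ => false) M.bit (Z := Sum.inr tape) (D := Sum.inr word)
    (by simp) z v (Sum.elim (fun _ : M.K => []) (contents (z.map M.bit) [] [] [])) rfl
  have e1 : Function.update (Function.update (Sum.elim (fun _ : M.K => [])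
      (contents (z.map M.bit) [] [] [])) (Sum.inr tape) ((readBlock z).2.map M.bit)) (Sum.inr word)
      ((readBlock z).1.reverse.map M.bit ++ Sum.elim (fun _ : M.K => [])
      (contents (z.map M.bit) [] [] []) (Sum.inr word)) =
      Sum.elim (fun _ : M.K => []) (Function.update (contents ((readBlock z).2.map M.bit) [] [] [])
        word (y.reverse.map M.bit)) := by
    rw [Sum.update_elim_inr, Sum.update_elim_inr, hy1, Sum.elim_inr]
    congr 1
    funext k
    cases k <;> simp [contents]
  rw [e1] at h1
  have h2 := move_run (O := fun _ => false) M.bit (a := Sum.inr word) (b := Sum.inl (M.inp 0))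
    (by simp) { v with reg := q1 } (Sum.elim (fun _ : M.K => []) (Function.update
      (contents ((readBlock z).2.map M.bit) [] [] []) word (y.reverse.map M.bit)))
  have e2 : Function.update (Function.update (Sum.elim (fun _ : M.K => []) (Function.update
      (contents ((readBlock z).2.map M.bit) [] [] []) word (y.reverse.map M.bit))) (Sum.inr word) [])
      (Sum.inl (M.inp 0)) ((Sum.elim (fun _ : M.K => []) (Function.update
      (contents ((readBlock z).2.map M.bit) [] [] []) word (y.reverse.map M.bit))
      (Sum.inr word)).reverse ++ Sum.elim (fun _ : M.K => []) (Function.update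
      (contents ((readBlock z).2.map M.bit) [] [] []) word (y.reverse.map M.bit))
      (Sum.inl (M.inp 0))) =
      Sum.elim (M.initCfg fun _ => y).stk (contents ((readBlock z).2.map M.bit) [] [] []) := by
    rw [Sum.update_elim_inr, Sum.update_elim_inl, Sum.elim_inr, Sum.elim_inl, Function.update_self,
      Function.update_idem, List.append_nil, ← List.map_reverse, List.reverse_reverse]
    congr 1
    · funext k
      simp only [Machine.initCfg]
      by_cases hk : k = M.inp 0
      · subst hk
        rw [Function.update_self, M.inp.injective.extend_apply]
      · rw [Function.update_of_ne hk, Function.extend_apply']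
        rintro ⟨i, rfl⟩
        exact hk (by rw [Subsingleton.elim i 0])
    · funext k
      cases k <;> simp [contents]
  rw [e2, Sum.elim_inr, Function.update_self] at h2
  set S₀ := (M.initCfg fun _ => y).stk with hS₀
  obtain ⟨q3, h3⟩ := readB_run (O := fun _ => false) M.bit (Z := Sum.inr tape) (D := Sum.inr space)
    (by simp) (readBlock z).2 { v with reg := none }
    (Sum.elim S₀ (contents ((readBlock z).2.map M.bit) [] [] [])) rfl
  have e3 : Function.update (Function.update (Sum.elim S₀
      (contents ((readBlock z).2.map M.bit) [] [] [])) (Sum.inr tape)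
      ((readBlock (readBlock z).2).2.map M.bit)) (Sum.inr space)
      ((readBlock (readBlock z).2).1.reverse.map M.bit ++ Sum.elim S₀
      (contents ((readBlock z).2.map M.bit) [] [] []) (Sum.inr space)) =
      Sum.elim S₀ (contents (r.map M.bit) (b.reverse.map M.bit) [] []) := by
    rw [Sum.update_elim_inr, Sum.update_elim_inr, hb, Sum.elim_inr]
    congr 1
    funext k
    cases k <;> simp [contents]
  rw [e3] at h3
  have h4 := copy_run (O := fun _ => false) M.bit (a := Sum.inr space) (b := Sum.inr bits)
    (c := Sum.inr tmp) (by simp) (by simp) (by simp) { v with reg := q3 }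
    (Sum.elim S₀ (contents (r.map M.bit) (b.reverse.map M.bit) [] [])) rfl
  have e4 : Function.update (Sum.elim S₀ (contents (r.map M.bit) (b.reverse.map M.bit) [] []))
      (Sum.inr bits) (Sum.elim S₀ (contents (r.map M.bit) (b.reverse.map M.bit) [] [])
        (Sum.inr space) ++ Sum.elim S₀ (contents (r.map M.bit) (b.reverse.map M.bit) [] [])
        (Sum.inr bits)) =
      Sum.elim S₀ (contents (r.map M.bit) (b.reverse.map M.bit) [] (b.reverse.map M.bit)) := by
    rw [Sum.update_elim_inr, Sum.elim_inr, Sum.elim_inr]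
    congr 1
    funext k
    cases k <;> simp [contents]
  rw [e4] at h4
  have h5 := load_run (O := fun _ => false) (fun v : Ctl M.Λ M.σ M.Γ =>
    { v with lab := some M.start, var := M.init, ok := true }) { v with reg := none }
    (Sum.elim S₀ (contents (r.map M.bit) (b.reverse.map M.bit) [] (b.reverse.map M.bit)))
  have hS₀len : total S₀ = y.length := by
    rw [hS₀, M.total_initCfg]
    simp
  have hpre := ((h1.seq (h2.seq (h3.seq (h4.seq h5)))).space (m := W) (by
    show total (Sum.elim _ _) + _ ≤ _
    rw [total_elim, total_contents]
    simp only [Sum.elim_inr, contents, List.length_map, List.length_reverse, total,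
      Finset.sum_const_zero, List.length_nil]
    omega)).1
  obtain ⟨t, s', h6, h7, h8⟩ := boundedLoop_exec M hC r b.length (y.length + b.length) z.length W
    (by omega) (by omega) (by omega) hW (2 ^ (b.length + 1)) 0 (by omega) [] (b.reverse.map M.bit)
    (b.reverse.map M.bit) rfl (by simp) (M.initCfg fun _ => y) (by rw [← hS₀, hS₀len]; simp)
    { v with reg := none, lab := some M.start, var := M.init, ok := true } rfl rfl rfl
  refine ⟨_, s', hpre.seq h6, h7, ?_⟩
  intro t' c' h9 h10 h11 h12
  exact h8 t' c' h9 h10 h11 (by omega)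

/-- The input stack. -/
def _root_.BoundedStack.input (K : Type) : Fin 1 ↪ K ⊕ BoundedStack :=
  ⟨fun _ => Sum.inr tape, fun i j _ => Subsingleton.elim i j⟩

theorem _root_.BoundedStack.initStk_input {K Γ : Type} [DecidableEq K] (bit : Bool ↪ Γ)
    (z : List Bool) : initStk bit (BoundedStack.input K) (fun _ => z) =
      Sum.elim (fun _ => []) (contents (z.map bit) [] [] []) := by
  funext j
  unfold initStk
  by_cases hj : ∃ i, BoundedStack.input K i = j
  · obtain ⟨i, rfl⟩ := hj
    rw [(BoundedStack.input K).injective.extend_apply]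
    rfl
  · rw [Function.extend_apply' _ _ _ hj]
    rcases j with j | j
    · rfl
    · cases j with
      | tape => exact absurd ⟨0, rfl⟩ hj
      | _ => rfl

end Cmd

/-- The language of the simulations of `M` with bounds on space and time and a finite oracle. -/
theorem OracleMachine.exists_boundedLanguage (M : OracleMachine 1) {C : ℕ}
    (hC : ∀ l, (M.prog l).size ≤ C) : ∃ L ∈ PSPACE, ∀ y z b r : List Bool, readBlock z = (b, r) →
      (enc y ++ z ∈ L → ∃ t' c', Trace (Cmd.listStep M (blocks r))
        (fun c => total c.stk ≤ y.length + b.length) (M.initCfg fun _ => y) t' c' ∧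
        c'.l = none ∧ M.accept c'.var = true) ∧
      (∀ t' c', Trace (Cmd.listStep M (blocks r)) (fun c => total c.stk + C ≤ y.length + b.length)
        (M.initCfg fun _ => y) t' c' → c'.l = none → M.accept c'.var = true →
        t' + 2 ≤ 2 ^ (b.length + 1) → enc y ++ z ∈ L) := by
  choose t s' hs hsound hcompl using fun z : List Bool => Cmd.boundedC_exec M hC z _ le_rfl
    ⟨none, M.init, none, none, true, false, false⟩ _ _ _ rfl rfl
  refine ⟨{z | Cmd.boundedAccept M (s' z).1 = true}, ?_, ?_⟩
  · refine Cmd.mem_PSPACE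
      (B := fun k => k * (40 * k + 30) + 30 * k + 8 * C + 30)
      (Cmd.boundedC M) M.bit (BoundedStack.input M.K)
      ⟨none, M.init, none, none, true, false, false⟩ (Cmd.boundedAccept M) (Sum.inl M.qStack) ?_ ?_
    · exact (((PolyBounded.id.mul (((PolyBounded.const 40).mul .id).add (.const 30))).add
        ((PolyBounded.const 30).mul .id)).add (.const _)).add (.const 30)
    · intro z
      refine ⟨t z, s' z, ?_, Iff.rfl⟩
      rw [BoundedStack.initStk_input]
      exact hs z
  · intro y z b r hz
    have h1 := hsound (enc y ++ z)
    have h2 := hcompl (enc y ++ z)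
    simp only [readBlock_enc_append, hz] at h1 h2
    exact ⟨h1, h2⟩

/-! ### The length of runs in bounded space -/

namespace Trace

variable {α : Type*} {f : α → Option α} {P Q : α → Prop} {a b c : α} {t u : ℕ}

theorem halt_length_unique (h : Trace f P a t b) (h' : Trace f Q a u c) (hb : f b = none)
    (hc : f c = none) : t = u := by
  induction h generalizing u with
  | refl _ => cases h' with
    | refl _ => rfl
    | head _ h _ => rw [hb] at h; cases h
  | head _ hf _ ih => cases h' with
    | refl _ => rw [hc] at hf; cases hf
    | head _ h h' =>
      rw [hf] at h
      cases h
      rw [ih h' hb]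

/-- Configurations of a halting run are indexed by the number of steps that remain, which a
configuration determines. -/
theorem exists_of_le (h : Trace f P a t b) (hu : u ≤ t) : ∃ x, P x ∧ Trace f P x u b := by
  induction h with
  | refl hP => exact ⟨_, hP, by rw [Nat.le_zero.1 hu]; exact .refl hP⟩
  | @head a b c t hP hf htr ih =>
    rcases Nat.le_succ_iff.1 hu with hu | rfl
    · exact ih hu
    · exact ⟨_, hP, .head hP hf htr⟩

/-- A halting run is not longer than the number of configurations. -/
theorem halt_length_lt_card (h : Trace f P a t b) (hb : f b = none) {β : Type*} [Finite β]
    (e : α → β) (he : ∀ x y, P x → P y → e x = e y → x = y) : t < Nat.card β := by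
  choose x hP hx using fun u : Fin (t + 1) => h.exists_of_le (Nat.lt_succ_iff.1 u.2)
  have hinj : Function.Injective (fun u => e (x u)) := by
    intro u u' huu
    have := he _ _ (hP u) (hP u') huu
    have h1 := hx u
    rw [this] at h1
    exact Fin.ext (h1.halt_length_unique (hx u') hb hb)
  have := Nat.card_le_card_of_injective _ hinj
  simpa using this

end Trace

/-- A halting run repeats no configuration, and in space `s` there are only exponentially many. The
constant `D` is independent of the step function, hence of the oracle. -/
theorem Machine.exists_time_le {n : ℕ} (M : Machine n) : ∃ D : ℕ,
    ∀ (f : M.Cfg → Option M.Cfg) (s : ℕ) (a b : M.Cfg) (t : ℕ),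
      Trace f (fun c => total c.stk ≤ s) a t b → f b = none → t < 2 ^ (D * (s + 1)) := by
  refine ⟨Nat.card (Option M.Λ) + Nat.card M.σ + Nat.card (Option M.Γ) * Nat.card M.K, ?_⟩
  intro f s a b t h hb
  -- A stack with at most `s` symbols is determined by its entries below `s`, where `none` marks the
  -- positions beyond its end.
  have hlt := h.halt_length_lt_card (β := Option M.Λ × M.σ × (M.K → Fin s → Option M.Γ)) hb
    (fun c => (c.l, c.var, fun k i => (c.stk k)[(i : ℕ)]?)) (by
      rintro ⟨l, v, S⟩ ⟨l', v', S'⟩ h1 h2 h3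
      simp only [Prod.mk.injEq] at h1 h2 h3
      obtain ⟨rfl, rfl, h3⟩ := h3
      congr 1
      funext k
      refine List.ext_getElem? fun i => ?_
      by_cases hi : i < s
      · exact congrFun (congrFun h3 k) ⟨i, hi⟩
      · have := length_le_total S k
        have := length_le_total S' k
        rw [List.getElem?_eq_none (by omega), List.getElem?_eq_none (by omega)])
  refine hlt.trans_le ?_
  -- Replacing each cardinality `k` by `2 ^ k` makes the bound a power of two whose exponent is
  -- linear in `s`.
  have h2 : ∀ k : ℕ, k ≤ 2 ^ k := fun k => Nat.lt_two_pow_self.le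
  rw [Nat.card_prod, Nat.card_prod, Nat.card_fun, Nat.card_fun, Nat.card_fin]
  calc _ ≤ 2 ^ Nat.card (Option M.Λ) * (2 ^ Nat.card M.σ *
        ((2 ^ Nat.card (Option M.Γ)) ^ s) ^ Nat.card M.K) := by
        gcongr <;> exact h2 _
    _ = 2 ^ (Nat.card (Option M.Λ) + (Nat.card M.σ +
        Nat.card (Option M.Γ) * s * Nat.card M.K)) := by
        rw [← pow_mul, ← pow_mul, ← pow_add, ← pow_add, mul_assoc]
    _ ≤ _ := by
        refine Nat.pow_le_pow_right (by norm_num) ?_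
        nlinarith [Nat.zero_le (Nat.card (Option M.Λ) * s), Nat.zero_le (Nat.card M.σ * s),
          Nat.zero_le (Nat.card (Option M.Γ) * Nat.card M.K)]

/-! ### Replacing the oracle by a finite list -/

theorem oracleStep_congr {K Γ Λ σ : Type} [DecidableEq K]
    {prog : Λ → Turing.TM2.Stmt (fun _ : K => Γ) Λ σ} {query : Option Λ} {yes no : Λ}
    {ans ans' : (K → List Γ) → Bool} {c : Turing.TM2.Cfg (fun _ : K => Γ) Λ σ}
    (h : ans c.stk = ans' c.stk) :
    oracleStep prog query yes no ans c = oracleStep prog query yes no ans' c := by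
  obtain ⟨l, v, S⟩ := c
  cases l with
  | none => rfl
  | some l => simp only [oracleStep]; simp only at h; simp only [h]

/-- The query stack counts as space, so a run in space `N` only asks about strings of length at most
`N`. -/
theorem OracleMachine.trace_congr {n : ℕ} (M : OracleMachine n) {A B : Set (List Bool)} {N : ℕ}
    (hAB : ∀ w : List Bool, w.length ≤ N → (w ∈ A ↔ w ∈ B)) {P : M.Cfg → Prop}
    (hP : ∀ c, P c → total c.stk ≤ N) {c c' : M.Cfg} {t : ℕ} (h : Trace (M.stepWith A) P c t c') :
    Trace (M.stepWith B) P c t c' := by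
  classical
  induction h with
  | refl hc => exact .refl hc
  | @head a b c t ha hf _ ih =>
    refine .head ha ?_ ih
    rw [← hf]
    have : (∃ w ∈ B, a.stk M.qStack = w.map M.bit) ↔ ∃ w ∈ A, a.stk M.qStack = w.map M.bit := by
      have hl := (length_le_total a.stk M.qStack).trans (hP a ha)
      constructor
      · rintro ⟨w, hw, hw'⟩
        exact ⟨w, (hAB w (by rw [hw'] at hl; simpa using hl)).2 hw, hw'⟩
      · rintro ⟨w, hw, hw'⟩
        exact ⟨w, (hAB w (by rw [hw'] at hl; simpa using hl)).1 hw, hw'⟩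
    rw [M.stepWith_eq, M.stepWith_eq]
    exact oracleStep_congr (decide_eq_decide.2 this)

/-- Polynomial space with an oracle reduces to polynomial space without oracle if a list of the
strings in the oracle is part of the input. -/
theorem exists_reduction_of_mem_PSPACEWith {A L : Set (List Bool)} (hL : L ∈ PSPACEWith A) :
    ∃ L' ∈ PSPACE, ∃ m : ℕ → ℕ, PolyBounded m ∧ ∀ y z b r : List Bool, readBlock z = (b, r) →
      (∀ w : List Bool, w.length ≤ y.length + b.length → (w ∈ blocks r ↔ w ∈ A)) →
      (enc y ++ z ∈ L' → y ∈ L) ∧ (m y.length ≤ b.length → y ∈ L → enc y ++ z ∈ L') := by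
  obtain ⟨M, p, hM⟩ := hL
  obtain ⟨C, hC⟩ := Turing.TM2.Stmt.exists_size_le M.prog
  obtain ⟨D, hD⟩ := M.toMachine.exists_time_le
  obtain ⟨L', hL', h⟩ := M.exists_boundedLanguage hC
  -- The summand `D * (p.eval n + 1)` lets the clock outlast the run; the others provide the space
  -- of the run and the reserve of `C` symbols.
  refine ⟨L', hL', fun n => D * (p.eval n + 1) + p.eval n + C, ?_, ?_⟩
  · exact (((PolyBounded.const D).mul ((PolyBounded.eval p).add (.const 1))).add (.eval p)).add
      (.const C)
  · intro y z b r hz hA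
    obtain ⟨h1, h2⟩ := h y z b r hz
    obtain ⟨⟨c, hc, hreach, hacc⟩, hspace⟩ := hM fun _ => y
    simp only [Finset.univ_unique, Finset.sum_const, Finset.card_singleton, one_smul] at hspace
    constructor
    · intro hyz
      obtain ⟨t', c', htr, hc', hacc'⟩ := h1 hyz
      -- The accepting simulation uses space at most `y.length + b.length`, where the list agrees
      -- with `A`; so it is the run of `M` with oracle `A`, whatever the length of `b`.
      have htr' := M.trace_congr (B := A) hA (fun _ h => h) htr
      have := htr'.halt_unique (M.stepWith_eq_none _ hc') hreach (M.stepWith_eq_none _ hc)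
      subst this
      exact hacc.1 hacc'
    · intro hm hy
      simp only at hm
      obtain ⟨t, htr⟩ := Trace.of_reaches (P := fun c : M.Cfg => total c.stk ≤ p.eval y.length)
        hreach hspace
      have ht := hD _ _ _ _ _ htr (M.stepWith_eq_none _ hc)
      have htr' := M.trace_congr (A := A) (B := {w | w ∈ blocks r}) (N := y.length + b.length)
        (fun w hw => (hA w hw).symm) (fun c (hc : total c.stk ≤ p.eval y.length) => by omega) htr
      refine h2 t c (htr'.mono fun c hc => ?_) hc (hacc.2 hy) ?_
      · show total c.stk + C ≤ _
        have : total c.stk ≤ p.eval y.length := hc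
        omega
      · have h3 := Nat.pow_le_pow_right (n := 2) (by norm_num)
          (show D * (p.eval y.length + 1) ≤ b.length by omega)
        rw [pow_succ]
        have := Nat.one_le_two_pow (n := b.length)
        omega

/-! ### Verification of a list of oracle answers -/

namespace Cmd

section Trunc

variable {K Γ Λ σ : Type} [DecidableEq K] {O : (K → List Γ) → Bool} (bit : Bool ↪ Γ)

/-- Cut the stack `X` down to the length of the stack `F`, and empty `F`. -/
def trunc (X F T : K) : Cmd K Γ (Ctl Λ σ Γ) :=
  .seq (each F (.seq (popR X) (ite (fun v => v.reg.isSome) (pushR bit T) (.load id))))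
    (.seq (clear X) (move bit T X))

theorem trunc_run {X F T : K} (hXF : X ≠ F) (hXT : X ≠ T) (hFT : F ≠ T) (v : Ctl Λ σ Γ)
    (S : K → List Γ) (hT : S T = []) :
    Run O (trunc bit X F T) (v, S) (8 * (S F).length + 3 * (S X).length + 6)
      ({ v with reg := none },
        Function.update (Function.update S F []) X ((S X).take (S F).length)) := by
  have key : ∀ (l : List Γ) (v : Ctl Λ σ Γ) (S : K → List Γ), S F = l →
      EachRun O F (.seq (popR X) (ite (fun v => v.reg.isSome) (pushR bit T) (.load id))) (v, S)
        (5 * l.length + 1) ({ v with reg := none }, Function.update (Function.update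
          (Function.update S F []) X ((S X).drop l.length)) T
          (((S X).take l.length).reverse ++ S T)) := by
    intro l
    induction l with
    | nil =>
      intro v S hl
      exact (EachRun.nil hl).conv rfl (by funext k; grind [Function.update_apply]) (by simp)
    | cons g l ih =>
      intro v S hl
      have h1 := popR_run (O := O) X { v with reg := some g } (Function.update S F l)
      rw [Function.update_of_ne hXF] at h1
      cases hX : S X with
      | nil =>
        have h2 := h1.seq (ite_false (p := fun v : Ctl Λ σ Γ => v.reg.isSome) (a := pushR bit T)
          trivial (by simp [hX]) (load_run id _ _))
        refine (EachRun.cons hl h2 (ih _ _ ?_)).conv rfl ?_ ?_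
        · simp [hXF.symm]
        · clear ih h1 h2
          funext k
          grind [Function.update_apply]
        · simp; omega
      | cons a x =>
        have h2 := h1.seq (ite_true (p := fun v : Ctl Λ σ Γ => v.reg.isSome) (b := .load id)
          trivial (by simp [hX]) (pushR_run bit T _ _ (g := a) (by simp [hX])))
        refine (EachRun.cons hl h2 (ih _ _ ?_)).conv rfl ?_ ?_
        · simp [hXF.symm, hFT]
        · clear ih h1 h2
          funext k
          grind [Function.update_apply]
        · simp; omega
  have h1 := (key _ v S rfl).run
  have h2 := h1.seq ((clear_run X _ _).seq (move_run bit hXT.symm _ _))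
  refine h2.conv rfl ?_ ?_
  · clear h1 h2 key
    funext k
    grind [Function.update_apply]
  · simp [hXT, hXT.symm, hT]
    omega

end Trunc

/-! ### Writing a string as a block. -/

section Enc

variable {K Γ Λ σ : Type} [DecidableEq K] {O : (K → List Γ) → Bool} (bit : Bool ↪ Γ)

/-- Move the string on the stack `Y` to the stack `Z`, as a block, and push as many symbols on the
stack `B`. -/
def pushEnc (Y Z B T : K) : Cmd K Γ (Ctl Λ σ Γ) :=
  .seq (pushB bit Z false) (.seq (move bit Y T)
    (each T (.seq (pushR bit Z) (.seq (pushB bit Z true) (pushB bit B false)))))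

/-- The top of a stack is the first symbol, so the block is written from its end: the final `false`,
then each bit followed by its marker. The stack `Y` is consumed, and `B` keeps its length in unary
for later use. -/
theorem pushEnc_run {Y Z B T : K} (hd : [Y, Z, B, T].Nodup) (y : List Bool) (v : Ctl Λ σ Γ)
    (S : K → List Γ) (hY : S Y = y.map bit) (hT : S T = []) :
    Run O (pushEnc bit Y Z B T) (v, S) (8 * y.length + 6)
      ({ v with reg := none }, Function.update (Function.update (Function.update S Y []) Z
        ((enc y).map bit ++ S Z)) B (List.replicate y.length (bit false) ++ S B)) := by
  simp at hd
  obtain ⟨⟨d1, d2, d3⟩, ⟨d4, d5⟩, d6⟩ := hd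
  have key : ∀ (l : List Bool) (v : Ctl Λ σ Γ) (S : K → List Γ), S T = l.map bit →
      EachRun O T (.seq (pushR bit Z) (.seq (pushB bit Z true) (pushB bit B false))) (v, S)
        (5 * l.length + 1) ({ v with reg := none }, Function.update (Function.update
          (Function.update S T []) Z ((l.reverse.flatMap fun b => [true, b]).map bit ++ S Z)) B
          (List.replicate l.length (bit false) ++ S B)) := by
    intro l
    induction l with
    | nil =>
      intro v S hl
      refine (EachRun.nil hl).conv rfl ?_ (by simp)
      rw [List.map_nil] at hl
      simp only [List.reverse_nil, List.flatMap_nil, List.map_nil, List.nil_append, List.length_nil,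
        List.replicate_zero]
      funext k
      grind [Function.update_apply]
    | cons a l ih =>
      intro v S hl
      have h1 := (pushR_run (O := O) bit Z { v with reg := some (bit a) }
        (Function.update S T (l.map bit)) (g := bit a) rfl).seq
        ((pushB_run bit Z true _ _).seq (pushB_run bit B false _ _))
      refine (EachRun.cons hl h1 (ih _ _ ?_)).conv rfl ?_ ?_
      · simp [Ne.symm d5, Ne.symm d6]
      · clear ih h1
        have e : ((a :: l).reverse.flatMap fun b => [true, b]).map bit =
            (l.reverse.flatMap fun b => [true, b]).map bit ++ [bit true, bit a] := by simp
        rw [e, List.length_cons, List.replicate_succ']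
        generalize (l.reverse.flatMap fun b => [true, b]).map bit = X
        funext k
        grind [Function.update_apply]
      · simp; omega
  have h1 := (pushB_run (O := O) bit Z false v S).seq ((move_run bit d3 v _).seq
    (key y.reverse { v with reg := none } _ (by simp [d1, Ne.symm d5, hY, hT])).run)
  refine h1.conv rfl ?_ ?_
  · clear key h1
    have e : (enc y).map bit = (y.reverse.reverse.flatMap fun b => [true, b]).map bit ++ [bit false] := by
      simp [enc]
    rw [e, List.length_reverse]
    generalize (y.reverse.reverse.flatMap fun b => [true, b]).map bit = X
    funext k
    grind [Function.update_apply]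
  · simp [d1, hY]
    omega

end Enc

end Cmd

theorem PolyBounded.comp {f g : ℕ → ℕ} (hf : PolyBounded f) (hg : PolyBounded g) :
    PolyBounded fun n => f (g n) := by
  obtain ⟨p, hp⟩ := hf
  exact (PolyBounded.comp_poly p hg).mono fun n => hp (g n)

namespace Cmd

section InitStk

variable {K Γ : Type} {n : ℕ} (bit : Bool ↪ Γ) (inp : Fin n ↪ K)

theorem initStk_apply (x : Fin n → List Bool) (i : Fin n) :
    initStk bit inp x (inp i) = (x i).map bit := by
  rw [initStk, inp.injective.extend_apply]

theorem initStk_apply_of_notMem (x : Fin n → List Bool) {k : K} (hk : ¬ ∃ i, inp i = k) :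
    initStk bit inp x k = [] := by
  rw [initStk, Function.extend_apply' _ _ _ hk]

theorem update_initStk [DecidableEq K] (x : Fin n → List Bool) (i : Fin n) (w : List Bool) :
    Function.update (initStk bit inp x) (inp i) (w.map bit) =
      initStk bit inp (Function.update x i w) := by
  funext k
  by_cases hk : ∃ j, inp j = k
  · obtain ⟨j, rfl⟩ := hk
    rw [initStk_apply]
    by_cases hj : j = i
    · subst hj
      rw [Function.update_self, Function.update_self]
    · rw [Function.update_of_ne (fun h => hj (inp.injective h)), Function.update_of_ne hj,
        initStk_apply]
  · rw [Function.update_of_ne (fun h => hk ⟨i, h.symm⟩), initStk_apply_of_notMem _ _ _ hk,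
      initStk_apply_of_notMem _ _ _ hk]

end InitStk

end Cmd

/-! ### The stacks of the verifier. -/

/-- The stacks of the machine that verifies a list of strings in the oracle: the argument, the
certificate, the query, unary bounds for lengths, and auxiliary stacks. -/
inductive VerifyStack
  | arg
  | cert
  | query
  | bound
  | fuel
  | aux
  | cert'
  | query'
  | word
  | word'
  | tmp
  deriving DecidableEq

namespace VerifyStack

instance : Fintype VerifyStack where
  elems := {arg, cert, query, bound, fuel, aux, cert', query', word, word', tmp}
  complete k := by cases k <;> decide

/-- The contents of the stacks. -/
def contents {Γ : Type} (y c w b f : List Γ) : VerifyStack → List Γ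
  | arg => y
  | cert => c
  | query => w
  | bound => b
  | fuel => f
  | _ => []

variable {K Γ : Type} {l : ℕ}

/-- The input stacks. -/
def input (inp : Fin (l + 1) ↪ K) : Fin (l + 3) ↪ K ⊕ VerifyStack where
  toFun := Fin.cons (Sum.inr arg) (Fin.cons (Sum.inr cert) (Fin.cons (Sum.inr query)
    fun i => Sum.inl (inp i.succ)))
  inj' := by
    simp only [Fin.cons_injective_iff]
    refine ⟨?_, ?_, ?_, ?_⟩
    · rintro ⟨i, hi⟩
      refine Fin.cases ?_ (fun i => ?_) i hi
      · simp
      · refine Fin.cases ?_ (fun i => ?_) i <;> simp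
    · rintro ⟨i, hi⟩
      refine Fin.cases ?_ (fun i => ?_) i hi <;> simp
    · rintro ⟨i, hi⟩
      simp at hi
    · intro i j h
      simpa using h

/-- The state of all stacks. -/
noncomputable def state (bit : Bool ↪ Γ) (inp : Fin (l + 1) ↪ K) (x : Fin (l + 1) → List Bool)
    (y c w b f : List Γ) : K ⊕ VerifyStack → List Γ :=
  Sum.elim (Cmd.initStk bit inp x) (contents y c w b f)

variable (bit : Bool ↪ Γ) (inp : Fin (l + 1) ↪ K) (x : Fin (l + 1) → List Bool)
  (y c w b f : List Γ)

/-- The simulated machine finds the strings from `x 3` on directly on its input stacks. Its first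
input stack starts empty, because the program assembles the encoded argument and the certificate
there. -/
theorem initStk_input (x : Fin (l + 3) → List Bool) :
    Cmd.initStk bit (input inp) x = state bit inp (Fin.cons [] fun i => x i.succ.succ.succ)
      ((x 0).map bit) ((x 1).map bit) ((x 2).map bit) [] [] := by
  funext j
  by_cases hj : ∃ i, input inp i = j
  · obtain ⟨i, rfl⟩ := hj
    rw [Cmd.initStk_apply]
    refine Fin.cases rfl (fun i => ?_) i
    refine Fin.cases rfl (fun i => ?_) i
    refine Fin.cases rfl (fun i => ?_) i
    exact (Cmd.initStk_apply bit inp (Fin.cons [] fun i => x i.succ.succ.succ) i.succ).symm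
  · rw [Cmd.initStk_apply_of_notMem _ _ _ hj]
    rcases j with k | k
    · show _ = Cmd.initStk _ _ _ k
      by_cases hk : ∃ i, inp i = k
      · obtain ⟨i, rfl⟩ := hk
        rw [Cmd.initStk_apply]
        revert hj
        refine Fin.cases ?_ (fun i => ?_) i
        · intro _; rfl
        · intro hj; exact absurd ⟨i.succ.succ.succ, rfl⟩ hj
      · rw [Cmd.initStk_apply_of_notMem _ _ _ hk]
    · cases k with
      | arg => exact absurd ⟨0, rfl⟩ hj
      | cert => exact absurd ⟨1, rfl⟩ hj
      | query => exact absurd ⟨2, rfl⟩ hj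
      | _ => rfl

theorem state_inp (i : Fin (l + 1)) :
    state bit inp x y c w b f (Sum.inl (inp i)) = (x i).map bit :=
  Cmd.initStk_apply bit inp x i

theorem update_inp [DecidableEq K] (i : Fin (l + 1)) (z : List Bool) :
    Function.update (state bit inp x y c w b f) (Sum.inl (inp i)) (z.map bit) =
      state bit inp (Function.update x i z) y c w b f := by
  rw [state, Sum.update_elim_inl, Cmd.update_initStk, state]

theorem update_arg [DecidableEq K] (y' : List Γ) :
    Function.update (state bit inp x y c w b f) (Sum.inr arg) y' =
    state bit inp x y' c w b f := by
  rw [state, Sum.update_elim_inr, state]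
  congr 1
  funext k
  cases k <;> simp [contents]

theorem update_cert [DecidableEq K] (c' : List Γ) :
    Function.update (state bit inp x y c w b f) (Sum.inr cert) c' =
    state bit inp x y c' w b f := by
  rw [state, Sum.update_elim_inr, state]
  congr 1
  funext k
  cases k <;> simp [contents]

theorem update_query [DecidableEq K] (w' : List Γ) :
    Function.update (state bit inp x y c w b f) (Sum.inr query) w' =
      state bit inp x y c w' b f := by
  rw [state, Sum.update_elim_inr, state]
  congr 1
  funext k
  cases k <;> simp [contents]

theorem update_bound [DecidableEq K] (b' : List Γ) :
    Function.update (state bit inp x y c w b f) (Sum.inr bound) b' =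
      state bit inp x y c w b' f := by
  rw [state, Sum.update_elim_inr, state]
  congr 1
  funext k
  cases k <;> simp [contents]

theorem update_fuel [DecidableEq K] (f' : List Γ) :
    Function.update (state bit inp x y c w b f) (Sum.inr fuel) f' =
    state bit inp x y c w b f' := by
  rw [state, Sum.update_elim_inr, state]
  congr 1
  funext k
  cases k <;> simp [contents]

end VerifyStack

namespace Cmd

open VerifyStack

/-! ### Truncating the quantified strings. -/

section TruncArgs

variable {K Γ Λ σ : Type} [DecidableEq K] {l : ℕ} (bit : Bool ↪ Γ) (inp : Fin (l + 1) ↪ K)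
  {O : (K ⊕ VerifyStack → List Γ) → Bool}

/-- Cut an argument of the simulated machine down to the length of the stack `fuel`. -/
def truncArg (i : Fin l) : Cmd (K ⊕ VerifyStack) Γ (Ctl Λ σ Γ) :=
  .seq (copy bit (Sum.inr fuel) (Sum.inr aux) (Sum.inr tmp))
    (trunc bit (Sum.inl (inp i.succ)) (Sum.inr aux) (Sum.inr tmp))

theorem truncArg_run (i : Fin l) (v : Ctl Λ σ Γ) (z : List Bool) (u : Fin l → List Bool)
    (y c w b f : List Γ) :
    Run O (truncArg bit inp i) (v, state bit inp (Fin.cons z u) y c w b f)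
      (15 * f.length + 3 * (u i).length + 10)
      ({ v with reg := none },
        state bit inp (Fin.cons z (Function.update u i ((u i).take f.length))) y c w b f) := by
  have h1 := copy_run (O := O) bit (a := Sum.inr fuel) (b := Sum.inr aux) (c := Sum.inr tmp)
    (by simp) (by simp) (by simp) v (state bit inp (Fin.cons z u) y c w b f) rfl
  have h2 := trunc_run (O := O) bit (X := Sum.inl (inp i.succ)) (F := Sum.inr aux)
    (T := Sum.inr tmp) (by simp) (by simp) (by simp) { v with reg := none }
    (Function.update (state bit inp (Fin.cons z u) y c w b f) (Sum.inr aux)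
      (state bit inp (Fin.cons z u) y c w b f (Sum.inr fuel) ++
        state bit inp (Fin.cons z u) y c w b f (Sum.inr aux)))
    (by rw [Function.update_of_ne (by simp)]; rfl)
  have e0 : state bit inp (Fin.cons z u) y c w b f (Sum.inr fuel) ++
        state bit inp (Fin.cons z u) y c w b f (Sum.inr aux) = f := List.append_nil f
  have e1 : Function.update (state bit inp (Fin.cons z u) y c w b f) (Sum.inr aux) [] =
      state bit inp (Fin.cons z u) y c w b f := Function.update_eq_self (Sum.inr aux) _
  rw [e0] at h1 h2
  rw [Function.update_idem, Function.update_self, Function.update_of_ne (by simp), e1, state_inp,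
    Fin.cons_succ, ← List.map_take, update_inp, ← Fin.cons_update] at h2
  refine (h1.seq h2).weaken ?_
  have : (state bit inp (Fin.cons z u) y c w b f (Sum.inr fuel)).length = f.length := rfl
  rw [this, List.length_map]
  omega

theorem truncArgs_run (v : Ctl Λ σ Γ) (z : List Bool) (u : Fin l → List Bool)
    (y c w b f : List Γ) (N F : ℕ) (hu : ∀ i, (u i).length ≤ N) (hf : f.length ≤ F) :
    ∃ r, Run O (seqAll (truncArg bit inp) (List.finRange l))
      (v, state bit inp (Fin.cons z u) y c w b f) (l * (15 * F + 3 * N + 10) + 1)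
      ({ v with reg := r }, state bit inp (Fin.cons z fun i => (u i).take f.length) y c w b f) := by
  have key : ∀ (is : List (Fin l)) (v : Ctl Λ σ Γ) (u : Fin l → List Bool),
      (∀ i, (u i).length ≤ N) → ∃ r, Run O (seqAll (truncArg bit inp) is)
        (v, state bit inp (Fin.cons z u) y c w b f) (is.length * (15 * F + 3 * N + 10) + 1)
        ({ v with reg := r }, state bit inp (Fin.cons z fun i =>
          if i ∈ is then (u i).take f.length else u i) y c w b f) := by
    intro is
    induction is with
    | nil => intro v u _; exact ⟨v.reg, (load_run id _ _).conv rfl (by simp) (by simp)⟩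
    | cons j is ih =>
      intro v u hu
      have h1 := truncArg_run (O := O) bit inp j v z u y c w b f
      obtain ⟨r, h2⟩ := ih { v with reg := none } (Function.update u j ((u j).take f.length))
        (fun i => by
          have := hu i
          have := hu j
          rw [Function.update_apply]
          split_ifs <;> simp <;> omega)
      refine ⟨r, (h1.seq h2).conv rfl ?_ ?_⟩
      · congr 2
        funext i
        by_cases hi : i = j
        · subst hi
          simp
        · simp [hi]
      · have := hu j
        rw [List.length_cons, Nat.add_mul is.length 1, one_mul]
        omega
  obtain ⟨r, h⟩ := key (List.finRange l) v u hu
  exact ⟨r, h.conv rfl (by simp) (by simp)⟩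

end TruncArgs

end Cmd

/-- The relation that is verified by the machine: the string `x 1`, cut down to polynomial length,
gives correct oracle answers as far as the string `x 2` can tell, and the relation `R` holds of the
argument together with this string, and of further strings, cut down to polynomial length. -/
def verifyRel (A : Set (List Bool)) (q p : Polynomial ℕ) {l : ℕ}
    (R : (Fin (l + 1) → List Bool) → Prop) (x : Fin (l + 3) → List Bool) : Prop :=
  ((x 2).take ((x 0).length + (readBlock ((x 1).take (q.eval (x 0).length))).1.length) ∈
      blocks (readBlock ((x 1).take (q.eval (x 0).length))).2 ↔
    (x 2).take ((x 0).length + (readBlock ((x 1).take (q.eval (x 0).length))).1.length) ∈ A) ∧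
  R (Fin.cons (enc (x 0) ++ (x 1).take (q.eval (x 0).length)) fun i =>
    (x i.succ.succ.succ).take
      (p.eval (enc (x 0) ++ (x 1).take (q.eval (x 0).length)).length))

namespace Cmd

open VerifyStack

variable {l : ℕ} (M : Machine (l + 1))

/-- Cut the certificate down, and load it into the simulated machine, after the argument. -/
noncomputable def certC (q : List ℕ) : Cmd (M.K ⊕ VerifyStack) M.Γ (Ctl M.Λ M.σ M.Γ) :=
  .seq (poly M.bit (Sum.inr arg) (Sum.inr fuel) (Sum.inr aux) (Sum.inr tmp) q)
    (.seq (trunc M.bit (Sum.inr cert) (Sum.inr fuel) (Sum.inr tmp))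
    (.seq (copy M.bit (Sum.inr cert) (Sum.inl (M.inp 0)) (Sum.inr tmp))
      (pushEnc M.bit (Sum.inr arg) (Sum.inl (M.inp 0)) (Sum.inr bound) (Sum.inr tmp))))

theorem certC_run {O : (M.K ⊕ VerifyStack → List M.Γ) → Bool} (q : List ℕ) (v : Ctl M.Λ M.σ M.Γ)
    (u : Fin l → List Bool) (y c : List Bool) (w : List M.Γ) (n : ℕ) (hy : y.length ≤ n)
    (hc : c.length ≤ n) :
    Run O (certC M q) (v, state M.bit M.inp (Fin.cons [] u) (y.map M.bit) (c.map M.bit) w [] [])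
      (polyTime n q + 8 * hornerEval n q + 18 * n + 16)
      ({ v with reg := none }, state M.bit M.inp
        (Fin.cons (enc y ++ c.take (hornerEval y.length q)) u) []
        ((c.take (hornerEval y.length q)).map M.bit) w (List.replicate y.length (M.bit false)) []) := by
  set c' := c.take (hornerEval y.length q) with hc'
  have hc'len : c'.length ≤ n := by rw [hc', List.length_take]; omega
  obtain ⟨f, r, hf, h1⟩ := poly_run (O := O) M.bit (x := Sum.inr arg) (acc := Sum.inr fuel)
    (acc' := Sum.inr aux) (tmp := Sum.inr tmp) (by simp) (by simp) (by simp) (by simp) (by simp)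
    (by simp) q v (state M.bit M.inp (Fin.cons [] u) (y.map M.bit) (c.map M.bit) w [] []) rfl rfl rfl
  have e1 : (state M.bit M.inp (Fin.cons [] u) (y.map M.bit) (c.map M.bit) w [] []
      (Sum.inr arg)).length = y.length := List.length_map _
  rw [e1] at hf h1
  rw [update_fuel] at h1
  have h2 := trunc_run (O := O) M.bit (X := Sum.inr cert) (F := Sum.inr fuel)
    (T := Sum.inr tmp) (by simp) (by simp) (by simp) { v with reg := r }
    (state M.bit M.inp (Fin.cons [] u) (y.map M.bit) (c.map M.bit) w [] f) rfl
  have e2 : List.take (state M.bit M.inp (Fin.cons [] u) (y.map M.bit) (c.map M.bit) w [] f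
      (Sum.inr fuel)).length (state M.bit M.inp (Fin.cons [] u) (y.map M.bit) (c.map M.bit) w [] f
      (Sum.inr cert)) = c'.map M.bit := by
    show List.take f.length (c.map M.bit) = _
    rw [hf, hc', List.map_take]
  have e2' : 8 * (state M.bit M.inp (Fin.cons [] u) (y.map M.bit) (c.map M.bit) w [] f
      (Sum.inr fuel)).length + 3 * (state M.bit M.inp (Fin.cons [] u) (y.map M.bit) (c.map M.bit) w
      [] f (Sum.inr cert)).length + 6 ≤ 8 * hornerEval n q + 3 * n + 6 := by
    show 8 * f.length + 3 * (c.map M.bit).length + 6 ≤ _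
    have : hornerEval y.length q ≤ hornerEval n q := hornerEval_mono q hy
    rw [hf, List.length_map]
    omega
  rw [e2, update_fuel, update_cert] at h2
  have h3 := copy_run (O := O) M.bit (a := Sum.inr cert) (b := Sum.inl (M.inp 0))
    (c := Sum.inr tmp) (by simp) (by simp) (by simp) { v with reg := none }
    (state M.bit M.inp (Fin.cons [] u) (y.map M.bit) (c'.map M.bit) w [] []) rfl
  have e3 : state M.bit M.inp (Fin.cons [] u) (y.map M.bit) (c'.map M.bit) w [] [] (Sum.inr cert) =
      c'.map M.bit := rfl
  rw [state_inp, e3, Fin.cons_zero, List.map_nil, List.append_nil, update_inp,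
    Fin.update_cons_zero, List.length_map] at h3
  have h4 := pushEnc_run (O := O) M.bit (Y := Sum.inr arg) (Z := Sum.inl (M.inp 0))
    (B := Sum.inr bound) (T := Sum.inr tmp) (by simp) y { v with reg := none }
    (state M.bit M.inp (Fin.cons c' u) (y.map M.bit) (c'.map M.bit) w [] []) rfl rfl
  have e4 : state M.bit M.inp (Fin.cons c' u) (y.map M.bit) (c'.map M.bit) w [] [] (Sum.inr bound) =
      [] := rfl
  rw [state_inp, e4, Fin.cons_zero, List.append_nil, ← List.map_append, update_arg, update_inp,
    Fin.update_cons_zero, update_bound] at h4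
  refine (h1.seq (h2.seq (h3.seq h4))).weaken ?_
  have : polyTime y.length q ≤ polyTime n q := polyTime_mono q hy
  omega

/-- Compare the answer to the query with the list in the certificate. -/
noncomputable def checkC : Cmd (M.K ⊕ VerifyStack) M.Γ (Ctl M.Λ M.σ M.Γ) :=
  .seq (readB M.bit (Sum.inr cert) (Sum.inr bound))
    (.seq (trunc M.bit (Sum.inr query) (Sum.inr bound) (Sum.inr tmp))
    (.seq (lookup M.bit (Sum.inr cert) (Sum.inr query) (Sum.inr cert') (Sum.inr query')
      (Sum.inr word) (Sum.inr word') (Sum.inr tmp))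
      (.ask fun v b => { v with ok := v.res == b })))

open Classical in
-- The first block of the certificate is pushed on `bound` above the symbols `b`, which stand for
-- the length of the argument. The height of `bound` is then the length to which the query is cut in
-- `verifyRel`. A single question to the oracle follows.
theorem checkC_run (A : Set (List Bool)) (v : Ctl M.Λ M.σ M.Γ) (x : Fin (l + 1) → List Bool)
    (c w : List Bool) (b : List M.Γ) (n : ℕ) (hc : c.length ≤ n) (hw : w.length ≤ n)
    (hb : b.length ≤ n) :
    ∃ (v' : Ctl M.Λ M.σ M.Γ) (c' w' : List M.Γ),
      (v'.ok = true ↔ (w.take (b.length + (readBlock c).1.length) ∈ blocks (readBlock c).2 ↔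
        w.take (b.length + (readBlock c).1.length) ∈ A)) ∧
      Run (fun S => decide (∃ w ∈ A, S (Sum.inr query) = w.map M.bit)) (checkC M)
        (v, state M.bit M.inp x [] (c.map M.bit) (w.map M.bit) b [])
        (n * (40 * n + 30) + 43 * n + 22) (v', state M.bit M.inp x [] c' w' [] []) := by
  set O : (M.K ⊕ VerifyStack → List M.Γ) → Bool :=
    fun S => decide (∃ w ∈ A, S (Sum.inr query) = w.map M.bit) with hO
  have hlen := length_readBlock c
  obtain ⟨q1, h1⟩ := readB_run (O := O) M.bit (Z := Sum.inr cert) (D := Sum.inr bound) (by simp) c v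
    (state M.bit M.inp x [] (c.map M.bit) (w.map M.bit) b []) rfl
  rw [update_cert, update_bound] at h1
  have e1 : state M.bit M.inp x [] (c.map M.bit) (w.map M.bit) b [] (Sum.inr bound) = b := rfl
  rw [e1] at h1
  set b' := (readBlock c).1.reverse.map M.bit ++ b with hb'
  set r := (readBlock c).2 with hr
  have hb'len : b'.length = b.length + (readBlock c).1.length := by
    rw [hb', List.length_append, List.length_map, List.length_reverse, add_comm]
  have h2 := trunc_run (O := O) M.bit (X := Sum.inr query) (F := Sum.inr bound)
    (T := Sum.inr tmp) (by simp) (by simp) (by simp) { v with reg := q1 }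
    (state M.bit M.inp x [] (r.map M.bit) (w.map M.bit) b' []) rfl
  set w' := w.take (b.length + (readBlock c).1.length) with hw'
  have hw'len : w'.length ≤ n := by rw [hw', List.length_take]; omega
  have e2 : List.take (state M.bit M.inp x [] (r.map M.bit) (w.map M.bit) b' []
      (Sum.inr bound)).length (state M.bit M.inp x [] (r.map M.bit) (w.map M.bit) b' []
      (Sum.inr query)) = w'.map M.bit := by
    show List.take b'.length (w.map M.bit) = _
    rw [hb'len, hw', List.map_take]
  have e2' : 8 * (state M.bit M.inp x [] (r.map M.bit) (w.map M.bit) b' []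
      (Sum.inr bound)).length + 3 * (state M.bit M.inp x [] (r.map M.bit) (w.map M.bit) b' []
      (Sum.inr query)).length + 6 ≤ 19 * n + 6 := by
    show 8 * b'.length + 3 * (w.map M.bit).length + 6 ≤ _
    rw [hb'len, List.length_map]
    omega
  rw [e2, update_bound, update_query] at h2
  obtain ⟨q3, f3, h3⟩ := lookup_run (O := O) M.bit (Z := Sum.inr cert) (Q := Sum.inr query)
    (Z' := Sum.inr cert') (Q' := Sum.inr query') (D := Sum.inr word) (D' := Sum.inr word')
    (T := Sum.inr tmp) (by simp) r { v with reg := none }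
    (state M.bit M.inp x [] (r.map M.bit) (w'.map M.bit) [] []) rfl rfl rfl rfl rfl rfl
  have e3 : state M.bit M.inp x [] (r.map M.bit) (w'.map M.bit) [] [] (Sum.inr query) =
      w'.map M.bit := rfl
  have hinj : ∀ w₁ w₂ : List Bool, w₁.map M.bit = w₂.map M.bit ↔ w₁ = w₂ := fun w₁ w₂ =>
    (List.map_injective_iff.2 M.bit.injective).eq_iff
  rw [e3] at h3
  have h4 := Exec.ask (O := O) (P := fun _ => True)
    (f := fun (v : Ctl M.Λ M.σ M.Γ) b => { v with ok := v.res == b })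
    (v := { v with reg := none, reg2 := q3, flag := f3,
                   res := decide (∃ w ∈ blocks r, w'.map M.bit = w.map M.bit) })
    (S := state M.bit M.inp x [] (r.map M.bit) (w'.map M.bit) [] []) trivial
  refine ⟨_, r.map M.bit, w'.map M.bit, ?_, (h1.seq (h2.seq (h3.seq h4))).weaken ?_⟩
  · simp only [hO, e3, hinj, beq_iff_eq, decide_eq_decide]
    simp
  · rw [List.length_map]
    have hm : r.length * (20 * r.length + 20 * w'.length + 30) ≤ n * (40 * n + 30) :=
      Nat.mul_le_mul (by omega) (by omega)
    omega

/-- Verify the certificate, and simulate the machine `M`. -/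
noncomputable def verifyC (q p : List ℕ) : Cmd (M.K ⊕ VerifyStack) M.Γ (Ctl M.Λ M.σ M.Γ) :=
  .seq (certC M q) (.seq (checkC M)
    (.seq (poly M.bit (Sum.inl (M.inp 0)) (Sum.inr fuel) (Sum.inr aux) (Sum.inr tmp) p)
    (.seq (seqAll (truncArg M.bit M.inp) (List.finRange l))
    (.seq (.load fun v => { v with lab := some M.start, var := M.init })
      (simC M.bit M.prog none M.start M.start)))))

end Cmd

theorem PolyTimeRel.verifyRel {l : ℕ} {R : (Fin (l + 1) → List Bool) → Prop}
    (hR : PolyTimeRel (l + 1) R) (A : Set (List Bool)) (q p : Polynomial ℕ) :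
    PolyTimeRelWith A (l + 3) (verifyRel A q p R) := by
  classical
  obtain ⟨M, pM, hM⟩ := hR
  obtain ⟨C, hC⟩ := Turing.TM2.Stmt.exists_size_le M.prog
  obtain ⟨lq, hq⟩ := Cmd.exists_hornerEval q
  obtain ⟨lp, hp⟩ := Cmd.exists_hornerEval p
  let B : ℕ → ℕ := fun n => (Cmd.polyTime n lq + 8 * Cmd.hornerEval n lq + 18 * n + 16) +
    ((n * (40 * n + 30) + 43 * n + 22) + (Cmd.polyTime (3 * n + 1) lp +
    ((l * (15 * Cmd.hornerEval (3 * n + 1) lp + 3 * n + 10) + 1) +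
    (1 + ((4 * C + 7) * pM.eval (4 * n + 1) + 1)))))
  have hmul : ∀ a : ℕ, PolyBounded fun n => a * n := fun a => (PolyBounded.const a).mul .id
  have h3 : PolyBounded fun n => 3 * n + 1 := (hmul 3).add (.const 1)
  have hB : PolyBounded B :=
    ((((Cmd.polyBounded_polyTime lq).add ((PolyBounded.const 8).mul
      (Cmd.polyBounded_hornerEval lq))).add (hmul 18)).add (.const 16)).add
    ((((PolyBounded.id.mul ((hmul 40).add (.const 30))).add (hmul 43)).add (.const 22)).add
    (((Cmd.polyBounded_polyTime lp).comp h3).add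
    ((((PolyBounded.const l).mul ((((PolyBounded.const 15).mul
      ((Cmd.polyBounded_hornerEval lp).comp h3)).add (hmul 3)).add (.const 10))).add (.const 1)).add
    ((PolyBounded.const 1).add (((PolyBounded.const _).mul
      (.comp_poly pM ((hmul 4).add (.const 1)))).add (.const 1))))))
  refine Cmd.polyTimeRelWith (Cmd.verifyC M lq lp) M.bit (VerifyStack.input M.inp)
    (⟨none, M.init, none, none, true, false, false⟩) (fun v => v.ok && M.accept v.var)
    (Sum.inr .query) hB fun x => ?_
  rw [VerifyStack.initStk_input]
  set u : Fin l → List Bool := fun i => x i.succ.succ.succ with hu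
  set y := x 0 with hy
  set n := ∑ i, (x i).length with hn
  have hle : ∀ i, (x i).length ≤ n := fun i =>
    Finset.single_le_sum (f := fun i => (x i).length) (fun _ _ => Nat.zero_le _) (Finset.mem_univ i)
  have hsum : ∑ i, (u i).length ≤ n := by
    rw [hn, Fin.sum_univ_succ, Fin.sum_univ_succ, Fin.sum_univ_succ]
    simp only [hu]
    omega
  have hyn : y.length ≤ n := hle 0
  have h1 := Cmd.certC_run (O := fun S => decide (∃ w ∈ A, S (Sum.inr .query) = w.map M.bit)) M lq
    ⟨none, M.init, none, none, true, false, false⟩ u y (x 1) ((x 2).map M.bit) n hyn (hle 1)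
  set c := (x 1).take (Cmd.hornerEval y.length lq) with hc
  have hcn : c.length ≤ n := (List.length_take_le' _ _).trans (hle 1)
  obtain ⟨v2, c2, w2, hv2, h2⟩ := Cmd.checkC_run M A ⟨none, M.init, none, none, true, false, false⟩
    (Fin.cons (enc y ++ c) u) c (x 2) (List.replicate y.length (M.bit false)) n hcn (hle 2)
    (by simpa using hyn)
  set z := enc y ++ c with hz
  have hzn : z.length ≤ 3 * n + 1 := by
    rw [hz, List.length_append, length_enc]
    omega
  obtain ⟨f, r3, hf, h3⟩ := Cmd.poly_run
    (O := fun S => decide (∃ w ∈ A, S (Sum.inr .query) = w.map M.bit)) M.bit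
    (x := Sum.inl (M.inp 0)) (acc := Sum.inr VerifyStack.fuel)
    (acc' := Sum.inr .aux) (tmp := Sum.inr .tmp) (by simp) (by simp) (by simp) (by simp) (by simp)
    (by simp) lp v2 (VerifyStack.state M.bit M.inp (Fin.cons z u) [] c2 w2 [] []) rfl rfl rfl
  rw [VerifyStack.state_inp, Fin.cons_zero, List.length_map] at hf h3
  rw [VerifyStack.update_fuel] at h3
  obtain ⟨r4, h4⟩ := Cmd.truncArgs_run
    (O := fun S => decide (∃ w ∈ A, S (Sum.inr .query) = w.map M.bit)) M.bit M.inp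
    { v2 with reg := r3 } z u [] c2 w2 [] f n (Cmd.hornerEval (3 * n + 1) lp) (fun i => hle _)
    (by rw [hf]; exact Cmd.hornerEval_mono lp hzn)
  set u' : Fin l → List Bool := fun i => (u i).take f.length with hu'
  obtain ⟨c', hc', ⟨⟨⟨t, ht⟩, htp⟩⟩, hacc⟩ := hM (Fin.cons z u')
  have tr := Trace.of_evalsTo t _ _ ht
  -- As `M` has no query label, the answer function is arbitrary; this choice makes the oracle
  -- condition of `simC_exec` hold by definition.
  rw [M.step_eq fun S => decide (∃ w ∈ A, Sum.elim S (VerifyStack.contents [] c2 w2 [] f)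
    (Sum.inr VerifyStack.query) = w.map M.bit)] at tr
  obtain ⟨r5, h5⟩ := Cmd.simC_exec
    (O := fun S => decide (∃ w ∈ A, S (Sum.inr VerifyStack.query) = w.map M.bit)) M.bit hC
    (e := VerifyStack.contents [] c2 w2 [] f) (fun S => rfl)
    (P₀ := fun S => True) (P := fun S => True) (fun S hS c v t s' ht h => h) (fun S hS => trivial)
    tr hc' { v2 with reg := r4, lab := some M.start, var := M.init } rfl rfl
  have hrun := h1.seq (h2.seq (h3.seq (h4.seq ((Cmd.load_run
    (fun v : Ctl M.Λ M.σ M.Γ => { v with lab := some M.start, var := M.init }) _ _).seq h5))))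
  refine ⟨_, hrun.weaken ?_, ?_⟩
  -- The first input of `M` has length at most `3 * n + 1`, the others together at most `n`.
  · have htM : t ≤ pM.eval (4 * n + 1) := by
      refine htp.trans (pM.eval_nat_mono ?_)
      rw [Fin.sum_univ_succ]
      simp only [Fin.cons_zero, Fin.cons_succ]
      have : ∑ i, (u' i).length ≤ ∑ i, (u i).length :=
        Finset.sum_le_sum fun i _ => List.length_take_le' _ _
      omega
    have h6 : Cmd.polyTime z.length lp ≤ Cmd.polyTime (3 * n + 1) lp := Cmd.polyTime_mono lp hzn
    have h7 := Nat.mul_le_mul_left (4 * C + 7) htM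
    simp only [B]
    omega
  · simp only [Bool.and_eq_true, hv2, hacc, List.length_replicate]
    rw [_root_.verifyRel, ← hy, ← hq, ← hc, ← hz, ← hp, ← hf]

/-! ### Sparse oracles -/

/-- A set of strings is sparse if it has only few strings of length at most `m`, for all `m`. -/
def Sparse (A : Set (List Bool)) : Prop :=
  ∃ N : ℕ, ∀ m : ℕ, ∃ l : List (List Bool), (∀ w, w ∈ l ↔ w ∈ A ∧ w.length ≤ m) ∧ l.length ≤ N + m

/-- With one string per length, `B` has at most `m + 1` strings of length at most `m`; the finite
set `F` adds a constant. -/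
theorem sparse_of_injOn {A B : Set (List Bool)} {F : Finset (List Bool)}
    (hB : Set.InjOn List.length B) (hA : A ⊆ F ∪ B) : Sparse A := by
  classical
  refine ⟨F.card + 1, fun m => ?_⟩
  have hfin : {w ∈ A | w.length ≤ m}.Finite :=
    (List.finite_length_le Bool m).subset fun w hw => hw.2
  refine ⟨hfin.toFinset.toList, fun w => by simp, ?_⟩
  rw [Finset.length_toList]
  have h1 : hfin.toFinset ⊆ F ∪ hfin.toFinset.filter (· ∈ B) := by
    intro w hw
    rcases hA (hfin.mem_toFinset.1 hw).1 with h | h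
    · exact Finset.mem_union_left _ h
    · exact Finset.mem_union_right _ (Finset.mem_filter.2 ⟨hw, h⟩)
  have h2 : (hfin.toFinset.filter (· ∈ B)).card ≤ (Finset.range (m + 1)).card := by
    refine Finset.card_le_card_of_injOn List.length ?_ ?_
    · intro w hw
      simp only [Finset.coe_filter, Set.Finite.mem_toFinset, Set.mem_ofPred_eq] at hw
      simp only [Finset.coe_range, Set.mem_Iio]
      omega
    · intro w hw w' hw' h
      simp only [Finset.coe_filter, Set.mem_ofPred_eq] at hw hw'
      exact hB hw.2 hw'.2 h
  have h3 := (Finset.card_le_card h1).trans (Finset.card_union_le _ _)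
  rw [Finset.card_range] at h2
  omega

/-- There are only finitely many strings up to a given length, so an infinite set of indices
realizes infinitely many lengths. One index is chosen for each. -/
theorem exists_infinite_injOn_length (s : ℕ ≃ List Bool) {A : Set ℕ} (hA : A.Infinite) :
    ∃ B ⊆ A, B.Infinite ∧ Set.InjOn (fun i => (s i).length) B := by
  have himg : ((fun i => (s i).length) '' A).Infinite := by
    intro hfin
    obtain ⟨m, hm⟩ := hfin.bddAbove
    refine hA (((List.finite_length_le Bool m).preimage s.injective.injOn).subset fun i hi => ?_)
    exact hm ⟨i, hi, rfl⟩
  obtain ⟨B, hBA, hB⟩ := Set.exists_subset_bijOn A (fun i => (s i).length)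
  exact ⟨B, hBA, fun hfin => himg (by rw [← hB.image_eq]; exact hfin.image _), hB.injOn⟩

/-! ### The Ellentuck topology -/

theorem exists_ellentuckBasic_subset {U : Set InfiniteSets} (hU : IsOpen U) {H : InfiniteSets}
    (hH : H ∈ U) : ∃ (a : Finset ℕ) (A : Set ℕ), A.Infinite ∧ Disjoint (a : Set ℕ) A ∧
      H ∈ ellentuckBasic a A ∧ ellentuckBasic a A ⊆ U := by
  classical
  induction hU with
  | basic U hU =>
    obtain ⟨a, A, h1, h2, rfl⟩ := hU
    exact ⟨a, A, h1, h2, hH, subset_rfl⟩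
  | univ =>
    exact ⟨∅, Set.univ, Set.infinite_univ, by simp, by simp [ellentuckBasic], Set.subset_univ _⟩
  | inter U V _ _ ihU ihV =>
    obtain ⟨a, A, hA, haA, hHa, hU⟩ := ihU hH.1
    obtain ⟨b, B, hB, hbB, hHb, hV⟩ := ihV hH.2
    have key : ∀ {a : Finset ℕ} {A : Set ℕ} (_ : Disjoint (a : Set ℕ) A) (H : InfiniteSets),
        H ∈ ellentuckBasic a A ↔ ↑a ⊆ H.1 ∧ H.1 ⊆ ↑a ∪ A := by
      intro a A h H
      rw [Set.disjoint_left] at h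
      simp only [ellentuckBasic, Set.mem_ofPred_eq, Set.ext_iff, Set.subset_def, Set.mem_sdiff,
        Set.mem_union]
      grind
    have hd : Disjoint ((a ∪ b : Finset ℕ) : Set ℕ) (H.1 \ (a ∪ b : Finset ℕ)) :=
      Set.disjoint_sdiff_right
    -- If `H` lies in `[a, A]` and in `[b, B]`, so does every infinite set between `a ∪ b` and `H`.
    refine ⟨a ∪ b, H.1 \ (a ∪ b : Finset ℕ), H.2.sdiff (Finset.finite_toSet _), hd, ?_, ?_⟩
    · rw [key haA] at hHa
      rw [key hbB] at hHb
      rw [key hd]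
      constructor
      · rw [Finset.coe_union]; exact Set.union_subset hHa.1 hHb.1
      · rw [Set.union_sdiff_self]; exact Set.subset_union_right
    · intro G hG
      rw [key haA] at hHa
      rw [key hbB] at hHb
      rw [key hd, Finset.coe_union, Set.union_sdiff_self] at hG
      have hGH : G.1 ⊆ H.1 := hG.2.trans (Set.union_subset (Set.union_subset hHa.1 hHb.1) subset_rfl)
      refine ⟨hU ((key haA G).2 ⟨?_, hGH.trans hHa.2⟩), hV ((key hbB G).2 ⟨?_, hGH.trans hHb.2⟩)⟩
      · exact Set.subset_union_left.trans hG.1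
      · exact Set.subset_union_right.trans hG.1
  | sUnion S _ ih =>
    obtain ⟨U, hU, hHU⟩ := hH
    obtain ⟨a, A, h1, h2, h3, h4⟩ := ih U hU hHU
    exact ⟨a, A, h1, h2, h3, h4.trans (Set.subset_sUnion_of_mem hU)⟩

/-- The sets that do not code sparse oracles are nowhere dense. -/
theorem isNowhereDense_not_sparse (s : ℕ ≃ List Bool) :
    IsNowhereDense {H : InfiniteSets | ¬ Sparse (s '' H.1)} := by
  classical
  rw [IsNowhereDense, Set.eq_empty_iff_forall_notMem]
  intro H hH
  obtain ⟨a, A, hA, haA, hHA, hsub⟩ := exists_ellentuckBasic_subset isOpen_interior hH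
  obtain ⟨B, hBA, hB, hinj⟩ := exists_infinite_injOn_length s hA
  have haB : Disjoint (a : Set ℕ) B := haA.mono_right hBA
  -- `G` lies in `[a, A]`, hence in the closure of the non-sparse sets. Its neighbourhood `[a, B]`
  -- therefore contains a non-sparse set, yet the elements of `[a, B]` consist of `a` and a part of
  -- `B`.
  let G : InfiniteSets := ⟨a ∪ B, hB.mono Set.subset_union_right⟩
  have hGB : G ∈ ellentuckBasic a B := by
    rw [Set.disjoint_left] at haB
    simp only [ellentuckBasic, Set.ext_iff, Set.subset_def, Set.mem_sdiff, G]
    grind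
  have hGA : G ∈ ellentuckBasic a A := by
    rw [Set.disjoint_left] at haA
    have := fun x => @hBA x
    simp only [ellentuckBasic, Set.ext_iff, Set.subset_def, Set.mem_sdiff, G]
    grind
  have hopen : IsOpen (ellentuckBasic a B) :=
    TopologicalSpace.isOpen_generateFrom_of_mem ⟨a, B, hB, haB, rfl⟩
  obtain ⟨F, hF, hF'⟩ := mem_closure_iff.1 (interior_subset (hsub hGA)) _ hopen hGB
  refine hF' (sparse_of_injOn (B := s '' B) (F := a.image s) ?_ ?_)
  · rintro _ ⟨i, hi, rfl⟩ _ ⟨j, hj, rfl⟩ h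
    rw [hinj hi hj h]
  · rintro _ ⟨i, hi, rfl⟩
    by_cases hia : i ∈ a
    · exact .inl (by simpa using hia)
    · exact .inr ⟨i, hF.2 ⟨hi, by simpa using hia⟩, rfl⟩

/-! ### Alternating quantifiers -/

/-- Truncation maps the strings of length at most `P` onto those of length at most `m`. It is needed
because all quantifiers in `PHOver` share one bound, while those taken over from `L'` have their
own. -/
theorem altQuant_take {m P : ℕ} (h : m ≤ P) (l : ℕ) (b : Bool)
    (R : (Fin l → List Bool) → Prop) :
    AltQuant P l b (fun v => R fun i => (v i).take m) ↔ AltQuant m l b R := by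
  induction l generalizing b with
  | zero =>
    cases b <;>
    · simp only [AltQuant]
      exact iff_of_eq (congrArg R (Subsingleton.elim _ _))
  | succ l ih =>
    have hcons : ∀ (x : List Bool) (v : Fin l → List Bool),
        (fun i => ((Fin.cons x v : Fin (l + 1) → List Bool) i).take m) =
          Fin.cons (x.take m) fun i => (v i).take m := by
      intro x v
      funext i
      refine Fin.cases ?_ (fun i => ?_) i <;> simp
    cases b with
    | true =>
      simp only [AltQuant, hcons]
      constructor
      · rintro ⟨x, _, hx⟩
        exact ⟨x.take m, by simp, (ih false fun v => R (Fin.cons (x.take m) v)).1 hx⟩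
      · rintro ⟨x, hxm, hx⟩
        refine ⟨x, hxm.trans h, (ih false fun v => R (Fin.cons (x.take m) v)).2 ?_⟩
        rwa [List.take_of_length_le hxm]
    | false =>
      simp only [AltQuant, hcons]
      constructor
      · intro H x hxm
        have := (ih true fun v => R (Fin.cons (x.take m) v)).1 (H x (hxm.trans h))
        rwa [List.take_of_length_le hxm] at this
      · intro H x _
        exact (ih true fun v => R (Fin.cons (x.take m) v)).2 (H (x.take m) (by simp))

/-- Every quantifier has a nonempty range, as it contains `[]`. -/
theorem altQuant_and {m : ℕ} (l : ℕ) (b : Bool) (p : Prop) (R : (Fin l → List Bool) → Prop) :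
    AltQuant m l b (fun v => p ∧ R v) ↔ p ∧ AltQuant m l b R := by
  induction l generalizing b with
  | zero => cases b <;> simp [AltQuant]
  | succ l ih =>
    cases b with
    | true =>
      simp only [AltQuant, ih]
      exact ⟨fun ⟨x, h1, h2, h3⟩ => ⟨h2, x, h1, h3⟩, fun ⟨h2, x, h1, h3⟩ => ⟨x, h1, h2, h3⟩⟩
    | false =>
      simp only [AltQuant, ih]
      exact ⟨fun H => ⟨(H [] (Nat.zero_le _)).1, fun x hx => (H x hx).2⟩,
        fun ⟨h, H⟩ x hx => ⟨h, H x hx⟩⟩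

/-! ### Sparse oracles do not separate -/

theorem length_flatMap_enc_le {k : ℕ} (l : List (List Bool)) (h : ∀ w ∈ l, w.length ≤ k) :
    (l.flatMap enc).length ≤ l.length * (2 * k + 1) := by
  induction l with
  | nil => simp
  | cons w l ih =>
    have h1 := h w (by simp)
    have h2 := ih fun w hw => h w (by simp [hw])
    rw [List.flatMap_cons, List.length_append, length_enc, List.length_cons, Nat.add_mul l.length 1]
    omega

theorem Sparse.PSPACEWith_subset_PHWith {A : Set (List Bool)} (hA : Sparse A)
    (h : PSPACE ⊆ PH) : PSPACEWith A ⊆ PHWith A := by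
  intro L hL
  obtain ⟨L', hL', m₀, ⟨m, hm⟩, hred⟩ := exists_reduction_of_mem_PSPACEWith hL
  obtain ⟨l, R, p, hR, hRL⟩ := h hL'
  obtain ⟨N, hN⟩ := hA
  -- Room for a certificate: a block of `m.eval n` symbols takes `2 * m.eval n + 1`, and up to the
  -- length `n + m.eval n` there are at most `N + (n + m.eval n)` strings in `A`, each with a code
  -- of length at most `2 * (n + m.eval n) + 1`.
  have hq : PolyBounded fun n => 2 * m.eval n + 1 + (N + (n + m.eval n)) *
      (2 * (n + m.eval n) + 1) :=
    (((PolyBounded.const 2).mul (.eval m)).add (.const 1)).add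
      (((PolyBounded.const N).add (PolyBounded.id.add (.eval m))).mul
        (((PolyBounded.const 2).mul (PolyBounded.id.add (.eval m))).add (.const 1)))
  obtain ⟨q, hq⟩ := hq
  -- A common bound for the certificate, for the strings on which it is checked, and for the
  -- quantifiers of `L'` at inputs of length at most `2 * n + 1 + q.eval n`.
  have hP : PolyBounded fun n => n + q.eval n + p.eval (2 * n + 1 + q.eval n) :=
    (PolyBounded.id.add (.eval q)).add (.comp_poly p
      ((((PolyBounded.const 2).mul .id).add (.const 1)).add (.eval q)))
  obtain ⟨P, hP⟩ := hP
  -- After `∃ c ∀ w` the next quantifier is existential again, so the prefix of `L'` continues the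
  -- alternation.
  refine ⟨l + 2, verifyRel A q p R, P, hR.verifyRel A q p, fun y => ?_⟩
  have hPy := hP y.length
  have hqy := hq y.length
  simp only at hPy hqy
  have key : ∀ c w : List Bool,
      AltQuant (P.eval y.length) l true
        (fun v => verifyRel A q p R (Fin.cons y (Fin.cons c (Fin.cons w v)))) ↔
      (w.take (y.length + (readBlock (c.take (q.eval y.length))).1.length) ∈
          blocks (readBlock (c.take (q.eval y.length))).2 ↔
        w.take (y.length + (readBlock (c.take (q.eval y.length))).1.length) ∈ A) ∧
      enc y ++ c.take (q.eval y.length) ∈ L' := by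
    intro c w
    rw [hRL, ← altQuant_take (P := P.eval y.length)
      (m := p.eval (enc y ++ c.take (q.eval y.length)).length) ?_ l true
      (fun v => R (Fin.cons (enc y ++ c.take (q.eval y.length)) v)), ← altQuant_and]
    · rfl
    · refine le_trans (p.eval_nat_mono ?_) ((Nat.le_add_left _ _).trans hPy)
      rw [List.length_append, length_enc, List.length_take]
      omega
  simp only [AltQuant, key]
  constructor
  · intro hy
    obtain ⟨ws, hws, hwsN⟩ := hN (y.length + m.eval y.length)
    -- The correct certificate: a block just long enough for the simulation, and all strings of `A`
    -- that the check can reach.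
    let c := enc (List.replicate (m.eval y.length) true) ++ ws.flatMap enc
    have hc : c.length ≤ q.eval y.length := by
      refine le_trans ?_ hqy
      rw [List.length_append, length_enc, List.length_replicate]
      have h1 := length_flatMap_enc_le ws fun w hw => ((hws w).1 hw).2
      have h2 := Nat.mul_le_mul_right (2 * (y.length + m.eval y.length) + 1) hwsN
      omega
    have hread : readBlock c = (List.replicate (m.eval y.length) true, ws.flatMap enc) :=
      readBlock_enc_append _ _
    have hgood : ∀ w : List Bool,
        w.length ≤ y.length + (List.replicate (m.eval y.length) true).length →
        (w ∈ blocks (ws.flatMap enc) ↔ w ∈ A) := by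
      intro w hw
      rw [List.length_replicate] at hw
      rw [blocks_flatMap_enc, hws]
      exact ⟨And.left, fun h => ⟨h, hw⟩⟩
    refine ⟨c, by omega, fun w _ => ?_⟩
    rw [List.take_of_length_le hc, hread]
    refine ⟨hgood _ (by simp), (hred y c _ _ hread hgood).2 ?_ hy⟩
    simpa using hm y.length
  · rintro ⟨c, _, H⟩
    have hc : (c.take (q.eval y.length)).length ≤ q.eval y.length := List.length_take_le _ _
    have hlen := length_readBlock (c.take (q.eval y.length))
    -- Membership in `L'` does not depend on `w`, so the instance `[]` yields it; the instances with
    -- short `w` show that the list agrees with `A` as far as the simulation can ask.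
    refine (hred y (c.take (q.eval y.length)) _ _ rfl fun w hw => ?_).1 (H [] (Nat.zero_le _)).2
    have := (H w (by omega)).1
    rwa [List.take_of_length_le hw] at this

theorem mainTheorem5 (s : ℕ ≃ List Bool) (hS : RamseyPositive (separatingOracles s)) :
    ¬ PSPACE ⊆ PH := by
  intro h
  refine hS (IsMeagre.mono (?_ : _ ⊆ {H : InfiniteSets | ¬ Sparse (s '' H.1)})
    (isNowhereDense_not_sparse s).isMeagre)
  intro H hH hsparse
  exact hH ((PHWith_subset_PSPACEWith _).antisymm (hsparse.PSPACEWith_subset_PHWith h))
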